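/- For $p\in[1,\infty]$ let $W^{1,p}=W^{1,p}(\mathbb R)$ be the space of real-valued $u\in L^p(\mathbb R)$ whose weak derivative $u_x$ lies in $L^p(\mathbb R)$, with $\|u\|_{W^{1,p}}=\|u\|_{L^p}+\|u_x\|_{L^p}$. Put $\|(u_0,u_1)\|_{W^{1,p}\times L^p}=\|u_0\|_{W^{1,p}}+\|u_1\|_{L^p}$ and $\|(\delta,y,v_0,v_1)\|_{\mathbb R\times\mathbb R\times W^{1,p}\times L^p}=|\delta|+|y|+\|v_0\|_{W^{1,p}}+\|v_1\|_{L^p}$, and let $Y_0^p(r)\subset W^{1,p}\times L^p$ and $Y_1^p(r)\subset\mathbb R\times\mathbb R\times W^{1,p}\times L^p$ be the open balls of radius $r$ about $0$ for these norms. Fix $\beta_0\in(-1,1)$. For $t,x_0\in\mathbb R$ let $Q(t,x;\beta_0,x_0)=4\arctan\big(e^{\gamma_0(x-\beta_0t-x_0)}\big)$ with $\gamma_0=(1-\beta_0^2)^{-1/2}$, $Q_0=Q(t,\cdot;\beta_0,x_0)$, $Q_1=\partial_tQ(t,\cdot;\beta_0,x_0)$, $a_0=\sqrt{\tfrac{1+\beta_0}{1-\beta_0}}$,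 and for $\delta>-a_0$ let $a(\delta)=a_0+\delta$, $\beta(\delta)=\frac{a(\delta)^2-1}{a(\delta)^2+1}$, $\gamma(\delta)=(1-\beta(\delta)^2)^{-1/2}$. For $(\delta,y,v_0,v_1,u_0,u_1)\in(-a_0,\infty)\times\mathbb R\times W^{1,p}\times L^p\times W^{1,p}\times L^p$ let $\mathcal F=\mathcal F_{(\beta_0,t,x_0)}=(\mathcal F_1,\mathcal F_2,\mathcal F_3)$ with $$\begin{aligned}\mathcal F_1&=Q_{0,x}+u_{0,x}-v_1-\tfrac1{a(\delta)}\sin\tfrac{u_0+Q_0+v_0}2-a(\delta)\sin\tfrac{u_0+Q_0-v_0}2,\\ \mathcal F_2&=Q_1+u_1-v_{0,x}-\tfrac1{a(\delta)}\sin\tfrac{u_0+Q_0+v_0}2+a(\delta)\sin\tfrac{u_0+Q_0-v_0}2,\\ \mathcal F_3&=\int_{\mathbb R}(u_0+Q_0)(x)\,\operatorname{sech}\big(\gamma(\delta)(x-\beta_0t-x_0-y)\big)\,dx-\frac{\pi^2}{\gamma(\delta)}.\end{aligned}$$ (a) For every $p\in[1,\infty]$ there exist $r_0,r_1,r_2\in(0,1)$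 with $r_2\le\min(r_0,r_1)$, a constant $C$, all independent of $(t,x_0)$, and for all $t,x_0\in\mathbb R$ two $C^1$ maps $\Phi=\Phi_{(\beta_0,t,x_0)}:Y_0^p(r_0)\to\mathbb R\times\mathbb R\times W^{1,p}\times L^p$ and $\Psi=\Psi_{(\beta_0,t,x_0)}:Y_1^p(r_1)\to W^{1,p}\times L^p$ such that: (i) $\mathcal F(\Phi(u_0,u_1),u_0,u_1)=0$ and $\|\Phi(u_0,u_1)\|\le C\|(u_0,u_1)\|$ for all $(u_0,u_1)\in Y_0^p(r_0)$, the first component of $\Phi(u_0,u_1)$ being $>-a_0$; (ii) $\mathcal F(\delta,y,v_0,v_1,\Psi(\delta,y,v_0,v_1))=0$ and $\|\Psi(\delta,y,v_0,v_1)\|\le C\|(\delta,y,v_0,v_1)\|$ for all $(\delta,y,v_0,v_1)\in Y_1^p(r_1)$, and $\delta>-a_0$ on $Y_1^p(r_1)$; (iii) $\Phi(Y_0^p(r_2))\subset Y_1^p(r_1)$, $\Psi(Y_1^p(r_2))\subset Y_0^p(r_0)$, $\Psi\circ\Phi=\mathrm{Id}$ on $Y_0^p(r_2)$ and $\Phi\circ\Psi=\mathrm{Id}$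 on $Y_1^p(r_2)$; (iv) there are open neighborhoods $U\subset Y_0^p(r_0)$ and $V\subset Y_1^p(r_1)$ of the respective origins such that $\Phi:U\to V$ is a $C^1$ diffeomorphism with inverse $\Psi|_V$. (b) Let $1<p\le q\le\infty$, and let $(\Phi_p,\Psi_p)$ and $(\Phi_q,\Psi_q)$ be any families of maps as in (a) for $p$ and for $q$. Then there is $r_{p,q}\in(0,1)$, not larger than any of the radii $r_0,r_1$ of the two families and independent of $(t,x_0)$, such that for all $t,x_0\in\mathbb R$ $$\Phi_p(u_0,u_1)=\Phi_q(u_0,u_1)\quad\text{if }\|(u_0,u_1)\|_{W^{1,p}\times L^p}+\|(u_0,u_1)\|_{W^{1,q}\times L^q}<r_{p,q},$$ $$\Psi_p(\delta,y,v_0,v_1)=\Psi_q(\delta,y,v_0,v_1)\quad\text{if }|\delta|+|y|+\|(v_0,v_1)\|_{W^{1,p}\times L^p}+\|(v_0,v_1)\|_{W^{1,q}\times L^q}<r_{p,q}.$$ -/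

import Mathlib

open MeasureTheory Set
open scoped ENNReal ContDiff

namespace SineGordon

/-! ### Sobolev spaces on the line -/

/-- `g` is the weak derivative of `u` on `ℝ`. -/
def HasWeakDeriv (u g : ℝ → ℝ) : Prop :=
  ∀ φ : ℝ → ℝ, ContDiff ℝ ∞ φ → HasCompactSupport φ →
    ∫ x, u x * deriv φ x = -∫ x, g x * φ x

theorem integrable_mul_test {p : ℝ≥0∞} [Fact (1 ≤ p)] (u : Lp ℝ p (volume : Measure ℝ))
    {φ : ℝ → ℝ} (hφ : Continuous φ) (hc : HasCompactSupport φ) :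
    Integrable (fun x => u x * φ x) := by
  have h : LocallyIntegrable (fun x => u x) (volume : Measure ℝ) :=
    (Lp.memLp u).locallyIntegrable Fact.out
  simpa [mul_comm] using h.integrable_smul_left_of_hasCompactSupport hφ hc

/-- The space `W^{1,p}(ℝ)`: a function `u ∈ L^p` stored together with its weak derivative
`u_x ∈ L^p`.  The norm is `‖u‖_{L^p} + ‖u_x‖_{L^p}`. -/
def sobolevSubmodule (p : ℝ≥0∞) [Fact (1 ≤ p)] :
    Submodule ℝ (WithLp 1 (Lp ℝ p (volume : Measure ℝ) × Lp ℝ p (volume : Measure ℝ))) where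
  carrier := {w | HasWeakDeriv w.fst w.snd}
  zero_mem' := by
    intro φ _ _
    have h0 := Lp.coeFn_zero ℝ p (volume : Measure ℝ)
    have e (ψ : ℝ → ℝ) : (∫ x, (0 : Lp ℝ p (volume : Measure ℝ)) x * ψ x) = 0 := by
      rw [integral_congr_ae (g := fun _ => (0 : ℝ))]
      · simp
      · filter_upwards [h0] with x hx
        rw [hx, Pi.zero_apply, zero_mul]
    simp only [WithLp.zero_fst, WithLp.zero_snd]
    rw [e, e, neg_zero]
  add_mem' := by
    intro a b ha hb φ hφ hc
    have hd : Continuous (deriv φ) := hφ.continuous_deriv (by simp)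
    have e1 : (∫ x, (a.fst + b.fst : Lp ℝ p (volume : Measure ℝ)) x * deriv φ x)
        = (∫ x, a.fst x * deriv φ x) + ∫ x, b.fst x * deriv φ x := by
      rw [← integral_add (integrable_mul_test _ hd hc.deriv) (integrable_mul_test _ hd hc.deriv)]
      refine integral_congr_ae ?_
      filter_upwards [Lp.coeFn_add a.fst b.fst] with x hx
      rw [hx, Pi.add_apply, add_mul]
    have e2 : (∫ x, (a.snd + b.snd : Lp ℝ p (volume : Measure ℝ)) x * φ x)
        = (∫ x, a.snd x * φ x) + ∫ x, b.snd x * φ x := by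
      rw [← integral_add (integrable_mul_test _ hφ.continuous hc)
        (integrable_mul_test _ hφ.continuous hc)]
      refine integral_congr_ae ?_
      filter_upwards [Lp.coeFn_add a.snd b.snd] with x hx
      rw [hx, Pi.add_apply, add_mul]
    have h1 := ha φ hφ hc
    have h2 := hb φ hφ hc
    simp only [WithLp.add_fst, WithLp.add_snd]
    rw [e1, e2, h1, h2]
    ring
  smul_mem' := by
    intro c a ha φ hφ hc
    have e1 : (∫ x, (c • a.fst : Lp ℝ p (volume : Measure ℝ)) x * deriv φ x)
        = c * ∫ x, a.fst x * deriv φ x := by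
      rw [← integral_const_mul]
      refine integral_congr_ae ?_
      filter_upwards [Lp.coeFn_smul c a.fst] with x hx
      simp [hx, mul_assoc]
    have e2 : (∫ x, (c • a.snd : Lp ℝ p (volume : Measure ℝ)) x * φ x)
        = c * ∫ x, a.snd x * φ x := by
      rw [← integral_const_mul]
      refine integral_congr_ae ?_
      filter_upwards [Lp.coeFn_smul c a.snd] with x hx
      simp [hx, mul_assoc]
    have h1 := ha φ hφ hc
    simp only [WithLp.smul_fst, WithLp.smul_snd]
    rw [e1, e2, h1]
    ring

/-- `L^p(ℝ)`. -/
abbrev LL (p : ℝ≥0∞) : Type := Lp ℝ p (volume : Measure ℝ)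

/-- `W^{1,p}(ℝ)`, as a normed space. -/
abbrev W1 (p : ℝ≥0∞) [Fact (1 ≤ p)] : Type := sobolevSubmodule p

/-- The function underlying an element of `W^{1,p}`. -/
noncomputable def W1.fn {p : ℝ≥0∞} [Fact (1 ≤ p)] (u : W1 p) : LL p := u.1.fst

/-- The weak derivative of an element of `W^{1,p}`. -/
noncomputable def W1.dx {p : ℝ≥0∞} [Fact (1 ≤ p)] (u : W1 p) : LL p := u.1.snd

theorem W1.norm_eq {p : ℝ≥0∞} [Fact (1 ≤ p)] (u : W1 p) : ‖u‖ = ‖u.fn‖ + ‖u.dx‖ :=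
  WithLp.prod_norm_eq_of_L1 u.1

/-- An element of `W^{1,p}` is determined by its underlying function. -/
theorem W1.fn_injective {p : ℝ≥0∞} [Fact (1 ≤ p)] :
    Function.Injective (W1.fn : W1 p → LL p) := by
  intro u w h
  have hd : u.dx = w.dx := by
    apply Lp.ext
    refine ae_eq_of_integral_contDiff_smul_eq ((Lp.memLp u.dx).locallyIntegrable Fact.out)
      ((Lp.memLp w.dx).locallyIntegrable Fact.out) ?_
    intro φ hφ hc
    have h1 := u.2 φ hφ hc
    have h2 := w.2 φ hφ hc
    have h' : u.1.fst = w.1.fst := h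
    rw [h', h2] at h1
    have h3 := (neg_injective h1).symm
    simpa [mul_comm, W1.dx] using h3
  apply Subtype.ext
  apply (WithLp.equiv 1 _).injective
  exact Prod.ext h hd

/-! ### Kinks and the Bäcklund functional -/

/-- The Lorentz factor `(1 - β²)^{-1/2}`. -/
noncomputable def lorentz (β : ℝ) : ℝ := 1 / √(1 - β ^ 2)

/-- The hyperbolic secant. -/
noncomputable def sech (x : ℝ) : ℝ := 1 / Real.cosh x

/-- The kink `Q(t,x;β,x₀)`. -/
noncomputable def kink (β x₀ t x : ℝ) : ℝ :=
  4 * Real.arctan (Real.exp (lorentz β * (x - β * t - x₀)))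

/-- `a₀`, the Bäcklund parameter of velocity `β₀`. -/
noncomputable def param (β₀ : ℝ) : ℝ := √((1 + β₀) / (1 - β₀))

/-- `a(δ) = a₀ + δ`. -/
noncomputable def paramAt (β₀ δ : ℝ) : ℝ := param β₀ + δ

/-- `β(δ)`. -/
noncomputable def velocityAt (β₀ δ : ℝ) : ℝ :=
  (paramAt β₀ δ ^ 2 - 1) / (paramAt β₀ δ ^ 2 + 1)

/-- `γ(δ)`. -/
noncomputable def lorentzAt (β₀ δ : ℝ) : ℝ := lorentz (velocityAt β₀ δ)

section

variable {p : ℝ≥0∞} [Fact (1 ≤ p)]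

/-- The first component of the functional, as a function of `x`. -/
noncomputable def F₁ (β₀ t x₀ δ : ℝ) (v₀ : W1 p) (v₁ : LL p) (u₀ : W1 p) (x : ℝ) : ℝ :=
  deriv (fun z => kink β₀ x₀ t z) x + u₀.dx x - v₁ x
    - 1 / paramAt β₀ δ * Real.sin ((u₀.fn x + kink β₀ x₀ t x + v₀.fn x) / 2)
    - paramAt β₀ δ * Real.sin ((u₀.fn x + kink β₀ x₀ t x - v₀.fn x) / 2)

/-- The second component of the functional, as a function of `x`. -/
noncomputable def F₂ (β₀ t x₀ δ : ℝ) (v₀ u₀ : W1 p) (u₁ : LL p) (x : ℝ) : ℝ :=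
  deriv (fun s => kink β₀ x₀ s x) t + u₁ x - v₀.dx x
    - 1 / paramAt β₀ δ * Real.sin ((u₀.fn x + kink β₀ x₀ t x + v₀.fn x) / 2)
    + paramAt β₀ δ * Real.sin ((u₀.fn x + kink β₀ x₀ t x - v₀.fn x) / 2)

/-- The third component of the functional. -/
noncomputable def F₃ (β₀ t x₀ δ y : ℝ) (u₀ : W1 p) : ℝ :=
  (∫ x, (u₀.fn x + kink β₀ x₀ t x) * sech (lorentzAt β₀ δ * (x - β₀ * t - x₀ - y)))
    - Real.pi ^ 2 / lorentzAt β₀ δ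

/-- The equation `F(δ,y,v₀,v₁,u₀,u₁) = 0`, an identity in `L^p × L^p × ℝ`; it includes the
requirement that `δ ∈ (-a₀,∞)`, on which the functional is defined. -/
def FEqZero (β₀ t x₀ : ℝ) (z : ℝ × ℝ × W1 p × LL p) (u : W1 p × LL p) : Prop :=
  -param β₀ < z.1 ∧
  (∀ᵐ x, F₁ β₀ t x₀ z.1 z.2.2.1 z.2.2.2 u.1 x = 0) ∧
  (∀ᵐ x, F₂ β₀ t x₀ z.1 z.2.2.1 u.1 u.2 x = 0) ∧
  F₃ β₀ t x₀ z.1 z.2.1 u.1 = 0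

/-! ### Neighborhoods -/

/-- The norm of `W^{1,p} × L^p`. -/
noncomputable def norm₀ (u : W1 p × LL p) : ℝ := ‖u.1‖ + ‖u.2‖

/-- The norm of `ℝ × ℝ × W^{1,p} × L^p`. -/
noncomputable def norm₁ (z : ℝ × ℝ × W1 p × LL p) : ℝ :=
  |z.1| + |z.2.1| + ‖z.2.2.1‖ + ‖z.2.2.2‖

variable (p) in
/-- `Y₀(r)`. -/
def Y₀ (r : ℝ) : Set (W1 p × LL p) := {u | norm₀ u < r}

variable (p) in
/-- `Y₁(r)`. -/
def Y₁ (r : ℝ) : Set (ℝ × ℝ × W1 p × LL p) := {z | norm₁ z < r}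

/-- The families `Φ t x₀` and `Ψ t x₀` are `C¹` maps on `Y₀(r₀)` and `Y₁(r₁)` that solve the
equation `F = 0` with linear bounds (constant `C`), that are inverse to each other on `Y₀(r₂)` and
`Y₁(r₂)`, and that restrict to `C¹` diffeomorphisms between open neighborhoods of the origins.
The numbers `r₀, r₁, r₂, C` serve all `(t, x₀)`.  The values of `Φ t x₀` outside `Y₀(r₀)` and of
`Ψ t x₀` outside `Y₁(r₁)` are irrelevant. -/
structure IsBacklundPair (β₀ r₀ r₁ r₂ C : ℝ)
    (Φ : ℝ → ℝ → W1 p × LL p → ℝ × ℝ × W1 p × LL p)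
    (Ψ : ℝ → ℝ → ℝ × ℝ × W1 p × LL p → W1 p × LL p) : Prop where
  r₀_mem : r₀ ∈ Ioo (0 : ℝ) 1
  r₁_mem : r₁ ∈ Ioo (0 : ℝ) 1
  r₂_mem : r₂ ∈ Ioo (0 : ℝ) 1
  contDiffOn_Φ : ∀ t x₀, ContDiffOn ℝ 1 (Φ t x₀) (Y₀ p r₀)
  contDiffOn_Ψ : ∀ t x₀, ContDiffOn ℝ 1 (Ψ t x₀) (Y₁ p r₁)
  eq_Φ : ∀ t x₀, ∀ u ∈ Y₀ p r₀, FEqZero β₀ t x₀ (Φ t x₀ u) u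
  eq_Ψ : ∀ t x₀, ∀ z ∈ Y₁ p r₁, FEqZero β₀ t x₀ z (Ψ t x₀ z)
  bound_Φ : ∀ t x₀, ∀ u ∈ Y₀ p r₀, norm₁ (Φ t x₀ u) ≤ C * norm₀ u
  bound_Ψ : ∀ t x₀, ∀ z ∈ Y₁ p r₁, norm₀ (Ψ t x₀ z) ≤ C * norm₁ z
  r₂_le_r₀ : r₂ ≤ r₀
  r₂_le_r₁ : r₂ ≤ r₁
  mapsTo_Φ : ∀ t x₀, MapsTo (Φ t x₀) (Y₀ p r₂) (Y₁ p r₁)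
  mapsTo_Ψ : ∀ t x₀, MapsTo (Ψ t x₀) (Y₁ p r₂) (Y₀ p r₀)
  left_inv : ∀ t x₀, ∀ u ∈ Y₀ p r₂, Ψ t x₀ (Φ t x₀ u) = u
  right_inv : ∀ t x₀, ∀ z ∈ Y₁ p r₂, Φ t x₀ (Ψ t x₀ z) = z
  diffeo : ∀ t x₀, ∃ (U : Set (W1 p × LL p)) (V : Set (ℝ × ℝ × W1 p × LL p)),
    IsOpen U ∧ IsOpen V ∧ 0 ∈ U ∧ 0 ∈ V ∧ U ⊆ Y₀ p r₀ ∧ V ⊆ Y₁ p r₁ ∧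
    BijOn (Φ t x₀) U V ∧ InvOn (Ψ t x₀) (Φ t x₀) U V ∧
    ContDiffOn ℝ 1 (Φ t x₀) U ∧ ContDiffOn ℝ 1 (Ψ t x₀) V

end

/-- `u ∈ W^{1,p} × L^p` and `w ∈ W^{1,q} × L^q` are the same pair of functions. -/
def SamePair {p q : ℝ≥0∞} [Fact (1 ≤ p)] [Fact (1 ≤ q)]
    (u : W1 p × LL p) (w : W1 q × LL q) : Prop :=
  (u.1.fn =ᵐ[volume] w.1.fn) ∧ (u.2 =ᵐ[volume] w.2)

end SineGordon

namespace SineGordon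

open Filter Topology

/-! ### Weak derivatives -/

/-! The kink depends on `x` only through `x - β₀ t - x₀`. Translating by `β₀ * t + x₀` therefore
turns the equation for any `(t, x₀)` into a single one, the vanishing of `functional`
(`fEqZero_iff_functional`). Translations are isometries for all the norms, so every radius and
constant obtained for that one equation is uniform in `(t, x₀)`.

The identities `sin (Q/2) = sech`, `Q_x = (a₀⁻¹ + a₀) sech` and `Q_t = (a₀⁻¹ - a₀) sech` make the
kink terms cancel at the origin. What remains is a map of Banach spaces that vanishes at `0` and is
`C¹` near it, because `W^{1,p}` embeds in `L^∞` (`contDiffAt_sinShift`, `contDiffAt_sechFam`).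

For existence, the implicit function theorem is applied twice to the same map, solving for either
block of variables (`exists_implicit_pair`). The two linearizations are triangular and reduce to
first-order operators with `c = γ₀`. In the block `(δ, y, v₀, v₁)` the core is `v_x - c tanh(c x) v
- d sech(c x)`: without `d`, solvability requires orthogonality to `sech`, and the freedom in `δ`
supplies exactly this missing direction. In the block `(u₀, u₁)` the core is `u_x + c tanh(c x) u`,
whose kernel is spanned by `sech` and is fixed by the pairing with `sech` in the third component.
The variable `y` is recovered because the derivative of the orthogonality condition in `y` is a
positive multiple of `∫ sech²`. Both operators are bijective for all `1 ≤ p ≤ ∞` (`opT_surjective`,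
`opR_surjective`): their explicit inverses are controlled by convolution with an exponential kernel.
Both implicit functions parametrize the same zero set near the origin, so they are inverse to each
other there.

For two exponents, both solutions are viewed in `L^∞`. The difference of the unknowns satisfies an
equation from which the common data has cancelled; its weak derivative is a difference of bounded
nonlinear terms, so it lies in `W^{1,∞}`. The linearized operator at `p = ∞` is bounded below and
the nonlinear remainder has a small Lipschitz constant, so the difference vanishes
(`exists_unique_left`, `exists_unique_right`). -/

theorem HasWeakDeriv.congr {u u' g g' : ℝ → ℝ} (h : HasWeakDeriv u g)
    (hu : u =ᵐ[volume] u') (hg : g =ᵐ[volume] g') : HasWeakDeriv u' g' := by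
  intro φ hφ hc
  have e1 : ∫ x, u' x * deriv φ x = ∫ x, u x * deriv φ x :=
    integral_congr_ae (hu.symm.mul (ae_eq_refl (deriv φ)))
  have e2 : ∫ x, g' x * φ x = ∫ x, g x * φ x :=
    integral_congr_ae (hg.symm.mul (ae_eq_refl φ))
  rw [e1, e2, h φ hφ hc]

theorem integrable_mul_of_compactSupport {u φ : ℝ → ℝ} (hu : LocallyIntegrable u)
    (hφ : Continuous φ) (hc : HasCompactSupport φ) : Integrable (fun x => u x * φ x) := by
  simpa [mul_comm] using hu.integrable_smul_left_of_hasCompactSupport hφ hc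

theorem HasWeakDeriv.sub {u u' g g' : ℝ → ℝ} (h : HasWeakDeriv u g) (h' : HasWeakDeriv u' g')
    (hu : LocallyIntegrable u) (hg : LocallyIntegrable g) (hu' : LocallyIntegrable u')
    (hg' : LocallyIntegrable g') :
    HasWeakDeriv (fun x => u x - u' x) (fun x => g x - g' x) := by
  intro φ hφ hc
  have hd : Continuous (deriv φ) := hφ.continuous_deriv (by simp)
  simp only [sub_mul]
  rw [integral_sub (integrable_mul_of_compactSupport hu hd hc.deriv)
    (integrable_mul_of_compactSupport hu' hd hc.deriv),
    integral_sub (integrable_mul_of_compactSupport hg hφ.continuous hc)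
    (integrable_mul_of_compactSupport hg' hφ.continuous hc), h φ hφ hc, h' φ hφ hc]
  ring

/-- The product `s φ` is again a test function, and testing `u` against it gives the product rule.
The lemma provides the integrating factors `sech (c x)` and `cosh (c x)` for the linearized
equations. -/
theorem HasWeakDeriv.mul_smooth {u g s : ℝ → ℝ} (h : HasWeakDeriv u g) (hs : ContDiff ℝ ∞ s)
    (hu : LocallyIntegrable u) (hg : LocallyIntegrable g) :
    HasWeakDeriv (fun x => u x * s x) (fun x => g x * s x + u x * deriv s x) := by
  intro φ hφ hc
  have hsd : Continuous (deriv s) := hs.continuous_deriv (by simp)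
  have hφd : Continuous (deriv φ) := hφ.continuous_deriv (by simp)
  have key := h (fun x => s x * φ x) (hs.mul hφ) hc.mul_left
  have hder : deriv (fun x => s x * φ x) = fun x => deriv s x * φ x + s x * deriv φ x := by
    funext x
    exact deriv_fun_mul (hs.differentiable (by simp) x) (hφ.differentiable (by simp) x)
  rw [hder] at key
  have i1 : Integrable (fun x => u x * (deriv s x * φ x)) :=
    integrable_mul_of_compactSupport hu (hsd.mul hφ.continuous) hc.mul_left
  have i2 : Integrable (fun x => u x * (s x * deriv φ x)) :=
    integrable_mul_of_compactSupport hu (hs.continuous.mul hφd) hc.deriv.mul_left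
  have i3 : Integrable (fun x => g x * (s x * φ x)) :=
    integrable_mul_of_compactSupport hg (hs.continuous.mul hφ.continuous) hc.mul_left
  simp only [mul_add] at key
  rw [integral_add i1 i2] at key
  have e1 : ∫ x, u x * s x * deriv φ x = ∫ x, u x * (s x * deriv φ x) := by
    simp only [mul_assoc]
  have e2 : ∫ x, (g x * s x + u x * deriv s x) * φ x
      = (∫ x, g x * (s x * φ x)) + ∫ x, u x * (deriv s x * φ x) := by
    rw [← integral_add i3 i1]
    simp only [add_mul, mul_assoc]
  rw [e1, e2]
  linarith

/-- A primitive is absolutely continuous on compact intervals and has derivative `g` almost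
everywhere. Integration by parts on an interval containing the support of `φ` has no boundary terms.
-/
theorem hasWeakDeriv_integral {g : ℝ → ℝ} (hg : LocallyIntegrable g) (c : ℝ) :
    HasWeakDeriv (fun x => c + ∫ t in (0 : ℝ)..x, g t) g := by
  intro φ hφ hc
  obtain ⟨R, hR0, hR⟩ : ∃ R : ℝ, 0 < R ∧ ∀ x, φ x ≠ 0 → x ∈ Ioo (-R) R := by
    obtain ⟨R, hR⟩ := hc.isCompact.isBounded.subset_ball (0 : ℝ)
    refine ⟨max R 1, by positivity, fun x hx => ?_⟩
    have := hR (subset_tsupport φ hx)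
    rw [Metric.mem_ball, dist_zero_right, Real.norm_eq_abs, abs_lt] at this
    exact ⟨by linarith [le_max_left R 1], by linarith [le_max_left R 1]⟩
  have hR' : ∀ x, deriv φ x ≠ 0 → x ∈ Icc (-R) R := by
    intro x hx
    have h1 : x ∈ tsupport φ := support_deriv_subset hx
    exact closure_minimal (fun y hy => Ioo_subset_Icc_self (hR y hy)) isClosed_Icc h1
  have hgi : ∀ a b, IntervalIntegrable g volume a b := fun a b => (hg.integrableOn_isCompact isCompact_uIcc).intervalIntegrable
  set G : ℝ → ℝ := fun x => c + ∫ t in (0 : ℝ)..x, g t with hG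
  have hac : AbsolutelyContinuousOnInterval G (-R) R := by
    have h1 := (hgi (-R) R).absolutelyContinuousOnInterval_intervalIntegral (c := 0)
      (by simp [uIcc_of_le, hR0.le])
    have h2 : AbsolutelyContinuousOnInterval (fun _ : ℝ => c) (-R) R := by
      have : LipschitzOnWith 0 (fun _ : ℝ => c) (uIcc (-R) R) := by
        exact (LipschitzWith.const c).lipschitzOnWith
      exact this.absolutelyContinuousOnInterval
    exact h2.add h1
  have hφac : AbsolutelyContinuousOnInterval φ (-R) R := by
    obtain ⟨K, hK⟩ := hφ.contDiffOn.exists_lipschitzOnWith (s := uIcc (-R) R)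
      (by simp) (convex_uIcc _ _) isCompact_uIcc
    exact hK.absolutelyContinuousOnInterval
  have parts := hac.integral_mul_deriv_eq_deriv_mul hφac
  have z1 : φ R = 0 := by
    by_contra h; exact lt_irrefl _ (hR R h).2
  have z2 : φ (-R) = 0 := by
    by_contra h; exact lt_irrefl _ (hR (-R) h).1
  have hder : ∀ᵐ x, deriv G x = g x := by
    filter_upwards [_root_.LocallyIntegrable.ae_hasDerivAt_integral hg] with x hx
    exact ((hx 0).const_add c).deriv
  have e1 : ∫ x, G x * deriv φ x = ∫ x in (-R)..R, G x * deriv φ x := by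
    symm
    rw [intervalIntegral.integral_of_le (by linarith), ← integral_Icc_eq_integral_Ioc]
    refine setIntegral_eq_integral_of_forall_compl_eq_zero fun x hx => ?_
    by_contra h
    exact hx (hR' x (right_ne_zero_of_mul h))
  have e2 : ∫ x, g x * φ x = ∫ x in (-R)..R, deriv G x * φ x := by
    symm
    rw [intervalIntegral.integral_of_le (by linarith), ← integral_Icc_eq_integral_Ioc,
      setIntegral_eq_integral_of_forall_compl_eq_zero fun x hx => ?_]
    · refine integral_congr_ae ?_
      filter_upwards [hder] with x hx
      rw [hx]
    · by_contra h
      exact hx (Ioo_subset_Icc_self (hR x (right_ne_zero_of_mul h)))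
  rw [e1, e2, parts, z1, z2]
  ring

/-- Modulo derivatives of test functions, every test function `ψ` is a multiple `(∫ ψ) η` of one
fixed bump of mass one. Hence `u` pairs with `ψ` exactly as the constant `∫ u η` does. -/
theorem HasWeakDeriv.exists_ae_eq_const {u : ℝ → ℝ} (hu : LocallyIntegrable u)
    (h : HasWeakDeriv u 0) : ∃ c : ℝ, ∀ᵐ x, u x = c := by
  let b : ContDiffBump (0 : ℝ) := ⟨1, 2, by norm_num, by norm_num⟩
  set η : ℝ → ℝ := b.normed volume with hη
  have hηs : ContDiff ℝ ∞ η := b.contDiff_normed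
  have hηc : HasCompactSupport η := b.hasCompactSupport_normed
  have hη1 : ∫ x, η x = 1 := b.integral_normed
  have hηi : Integrable η := hηs.continuous.integrable_of_hasCompactSupport hηc
  refine ⟨∫ x, u x * η x, ?_⟩
  refine ae_eq_of_integral_contDiff_smul_eq hu (locallyIntegrable_const _) ?_
  intro ψ hψ hψc
  have hψi : Integrable ψ := hψ.continuous.integrable_of_hasCompactSupport hψc
  set m : ℝ := ∫ x, ψ x with hm
  set χ : ℝ → ℝ := fun x => ψ x - m * η x with hχ
  have hχs : ContDiff ℝ ∞ χ := hψ.sub (contDiff_const.mul hηs)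
  have hχi : Integrable χ := hψi.sub (hηi.const_mul m)
  have hχ0 : ∫ x, χ x = 0 := by
    rw [hχ, integral_sub hψi (hηi.const_mul m), integral_const_mul, hη1]; simp [hm]
  obtain ⟨R, hR⟩ : ∃ R : ℝ, ∀ x, R < |x| → χ x = 0 := by
    obtain ⟨R, hR⟩ := (hψc.isCompact.union hηc.isCompact).isBounded.subset_closedBall (0 : ℝ)
    refine ⟨R, fun x hx => ?_⟩
    have : x ∉ tsupport ψ ∪ tsupport η := fun h => by
      have := hR h
      rw [Metric.mem_closedBall, dist_zero_right, Real.norm_eq_abs] at this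
      linarith
    rw [mem_union, not_or] at this
    simp [hχ, image_eq_zero_of_notMem_tsupport this.1, image_eq_zero_of_notMem_tsupport this.2]
  -- As `χ` has compact support and mean zero, this primitive vanishes far out on both sides, which
  -- makes it an admissible test function.
  set φ : ℝ → ℝ := fun x => ∫ t in Iic x, χ t with hφ
  have hφd : ∀ x, HasDerivAt φ (χ x) x := by
    intro x
    have e : φ = fun y => (∫ t in Iic (0 : ℝ), χ t) + ∫ t in (0 : ℝ)..y, χ t := by
      funext y
      rw [← intervalIntegral.integral_Iic_sub_Iic hχi.integrableOn hχi.integrableOn]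
      simp [hφ]
    rw [e]
    exact (hχs.continuous.integral_hasStrictDerivAt 0 x).hasDerivAt.const_add _
  have hφ' : deriv φ = χ := funext fun x => (hφd x).deriv
  have hφs : ContDiff ℝ ∞ φ := by
    rw [contDiff_infty_iff_deriv]
    exact ⟨fun x => (hφd x).differentiableAt, hφ' ▸ hχs⟩
  have hφc : HasCompactSupport φ := by
    refine HasCompactSupport.intro (isCompact_Icc (a := -R) (b := R)) fun x hx => ?_
    rw [mem_Icc, not_and_or, not_le, not_le] at hx
    rcases hx with hx | hx
    · refine setIntegral_eq_zero_of_forall_eq_zero fun t ht => hR t ?_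
      have : t ≤ x := ht
      linarith [neg_abs_le t]
    · have h2 : ∫ t in Ioi x, χ t = 0 :=
        setIntegral_eq_zero_of_forall_eq_zero fun t ht => hR t (by
          have : x < t := ht
          linarith [le_abs_self t])
      have h3 := intervalIntegral.integral_Iic_add_Ioi (b := x) (μ := volume)
        hχi.integrableOn hχi.integrableOn
      rw [h2, hχ0, add_zero] at h3
      exact h3
  have key := h φ hφs hφc
  rw [hφ'] at key
  simp only [Pi.zero_apply, zero_mul, integral_zero, neg_zero] at key
  have i1 := integrable_mul_of_compactSupport hu hψ.continuous hψc
  have i2 := integrable_mul_of_compactSupport hu hηs.continuous hηc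
  have e3 : ∫ x, u x * χ x = (∫ x, u x * ψ x) - m * ∫ x, u x * η x := by
    rw [← integral_const_mul, ← integral_sub i1 (i2.const_mul m)]
    refine integral_congr_ae (Eventually.of_forall fun x => ?_)
    simp only [hχ]; ring
  rw [e3] at key
  simp only [smul_eq_mul]
  rw [integral_mul_const]
  simp only [mul_comm (ψ _)]
  linarith

theorem hasWeakDeriv_of_contDiff {s : ℝ → ℝ} (hs : ContDiff ℝ ∞ s) :
    HasWeakDeriv s (deriv s) := by
  have h0 : HasWeakDeriv (fun _ => (1 : ℝ)) (fun _ => 0) := by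
    have := hasWeakDeriv_integral (g := fun _ => (0 : ℝ)) (locallyIntegrable_const _) 1
    simpa using this
  have := h0.mul_smooth hs (locallyIntegrable_const _) (locallyIntegrable_const _)
  simpa using this

theorem HasWeakDeriv.exists_ae_eq_add_integral {u g : ℝ → ℝ} (h : HasWeakDeriv u g)
    (hu : LocallyIntegrable u) (hg : LocallyIntegrable g) :
    ∃ c : ℝ, ∀ᵐ x, u x = c + ∫ t in (0 : ℝ)..x, g t := by
  have hG := hasWeakDeriv_integral hg 0
  have hGc : Continuous (fun x => (0 : ℝ) + ∫ t in (0 : ℝ)..x, g t) :=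
    continuous_const.add (intervalIntegral.continuous_primitive
      (fun a b => (hg.integrableOn_isCompact isCompact_uIcc).intervalIntegrable) 0)
  have hd := h.sub hG hu hg hGc.locallyIntegrable hg
  simp only [sub_self, zero_add] at hd hGc
  obtain ⟨c, hc⟩ := HasWeakDeriv.exists_ae_eq_const (hu.sub hGc.locallyIntegrable) hd
  refine ⟨c, ?_⟩
  filter_upwards [hc] with x hx
  simp only [Pi.sub_apply] at hx
  linarith

/-! ### Structure of the Sobolev spaces -/

section Spaces

variable {p : ℝ≥0∞} [Fact (1 ≤ p)]

theorem LL.locallyIntegrable (f : LL p) : LocallyIntegrable f :=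
  (Lp.memLp f).locallyIntegrable Fact.out

/-- The element of `W^{1,p}` with given function and weak derivative. -/
def W1.mk (f g : LL p) (h : HasWeakDeriv f g) : W1 p := ⟨WithLp.toLp 1 (f, g), h⟩

@[simp] theorem W1.fn_mk (f g : LL p) (h : HasWeakDeriv f g) : (W1.mk f g h).fn = f := rfl

@[simp] theorem W1.dx_mk (f g : LL p) (h : HasWeakDeriv f g) : (W1.mk f g h).dx = g := rfl

theorem W1.hasWeakDeriv (u : W1 p) : HasWeakDeriv u.fn u.dx := u.2

theorem W1.norm_fn_le (u : W1 p) : ‖u.fn‖ ≤ ‖u‖ := by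
  rw [W1.norm_eq]; linarith [norm_nonneg u.dx]

theorem W1.norm_dx_le (u : W1 p) : ‖u.dx‖ ≤ ‖u‖ := by
  rw [W1.norm_eq]; linarith [norm_nonneg u.fn]

variable (p) in
/-- The inclusion of `W^{1,p}` into `L^p`. -/
noncomputable def W1.fnL : W1 p →L[ℝ] LL p :=
  LinearMap.mkContinuous ⟨⟨W1.fn, fun _ _ => rfl⟩, fun _ _ => rfl⟩ 1
    (fun u => by rw [one_mul]; exact W1.norm_fn_le u)

variable (p) in
/-- The weak derivative as a map `W^{1,p} → L^p`. -/
noncomputable def W1.dxL : W1 p →L[ℝ] LL p :=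
  LinearMap.mkContinuous ⟨⟨W1.dx, fun _ _ => rfl⟩, fun _ _ => rfl⟩ 1
    (fun u => by rw [one_mul]; exact W1.norm_dx_le u)

@[simp] theorem W1.fnL_apply (u : W1 p) : W1.fnL p u = u.fn := rfl

theorem LL.setIntegral_abs_le (f : LL p) (x : ℝ) : ∫ t in Ioc x (x + 1), |f t| ≤ ‖f‖ := by
  have hprob : IsProbabilityMeasure (volume.restrict (Ioc x (x + 1))) := ⟨by simp⟩
  have hm : AEStronglyMeasurable f (volume.restrict (Ioc x (x + 1))) :=
    (Lp.memLp f).1.restrict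
  have h1 : eLpNorm f 1 (volume.restrict (Ioc x (x + 1))) ≤ eLpNorm f p volume :=
    (eLpNorm_le_eLpNorm_of_exponent_le Fact.out hm).trans (eLpNorm_restrict_le _ _ _ _)
  have h2 : ∫ t in Ioc x (x + 1), |f t|
      = (eLpNorm f 1 (volume.restrict (Ioc x (x + 1)))).toReal := by
    rw [eLpNorm_one_eq_lintegral_enorm]
    exact integral_norm_eq_lintegral_enorm hm
  rw [h2, Lp.norm_def]
  exact ENNReal.toReal_mono (Lp.eLpNorm_ne_top f) h1

/-- Sobolev embedding with constant one. The continuous representative varies over `(x, x + 1]` by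
at most the integral of `|u_x|`; averaging over this interval leaves two `L¹` norms, bounded by
`L^p` norms because the interval has length one. -/
theorem W1.ae_abs_le (u : W1 p) : ∀ᵐ x, |u.fn x| ≤ ‖u‖ := by
  obtain ⟨c, hc⟩ := u.hasWeakDeriv.exists_ae_eq_add_integral u.fn.locallyIntegrable
    u.dx.locallyIntegrable
  have hgi : ∀ a b, IntervalIntegrable u.dx volume a b := fun a b =>
    (u.dx.locallyIntegrable.integrableOn_isCompact isCompact_uIcc).intervalIntegrable
  set U : ℝ → ℝ := fun x => c + ∫ t in (0 : ℝ)..x, u.dx t with hU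
  have hUc : Continuous U :=
    continuous_const.add (intervalIntegral.continuous_primitive hgi 0)
  filter_upwards [hc] with x hx
  have hx' : u.fn x = U x := hx
  rw [hx', W1.norm_eq]
  have hdiff : ∀ y ∈ Ioc x (x + 1), |U x| ≤ |U y| + ∫ t in Ioc x (x + 1), |u.dx t| := by
    intro y hy
    have e : U y - U x = ∫ t in x..y, u.dx t := by
      simp only [hU]
      rw [← intervalIntegral.integral_interval_sub_left (hgi 0 y) (hgi 0 x)]
      ring
    have h1 : |U y - U x| ≤ ∫ t in Ioc x (x + 1), |u.dx t| := by
      rw [e, intervalIntegral.integral_of_le hy.1.le]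
      refine (abs_integral_le_integral_abs).trans ?_
      refine setIntegral_mono_set ?_ (Eventually.of_forall fun _ => abs_nonneg _)
        (Ioc_subset_Ioc_right hy.2).eventuallyLE
      exact (intervalIntegrable_iff_integrableOn_Ioc_of_le (by linarith)).1
        (hgi x (x + 1)).abs
    have h2 : |U x| ≤ |U y| + |U y - U x| := by
      have := abs_sub (U y) (U y - U x)
      simpa using this
    linarith
  have hint : ∫ t in Ioc x (x + 1), |U t| = ∫ t in Ioc x (x + 1), |u.fn t| := by
    refine integral_congr_ae (ae_restrict_of_ae ?_)
    filter_upwards [hc] with t ht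
    have ht' : u.fn t = U t := ht
    rw [ht']
  have hUi : IntegrableOn (fun t => |U t|) (Ioc x (x + 1)) :=
    (hUc.abs.integrableOn_Icc).mono_set Ioc_subset_Icc_self
  have hfin : |U x| ≤ (∫ t in Ioc x (x + 1), |U t|) + ∫ t in Ioc x (x + 1), |u.dx t| := by
    have h3 : ∫ _ in Ioc x (x + 1), |U x|
        ≤ ∫ y in Ioc x (x + 1), (|U y| + ∫ t in Ioc x (x + 1), |u.dx t|) := by
      refine setIntegral_mono_on (by simp) (hUi.add (by simp)) measurableSet_Ioc hdiff
    rw [integral_add hUi (by simp)] at h3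
    simpa using h3
  rw [hint] at hfin
  linarith [u.fn.setIntegral_abs_le x, u.dx.setIntegral_abs_le x]

theorem W1.memLp_top (u : W1 p) : MemLp u.fn ∞ volume :=
  memLp_top_of_bound (Lp.memLp u.fn).1 ‖u‖ (by simpa using u.ae_abs_le)

theorem LL.norm_top_le {f : LL ∞} {C : ℝ} (hC : 0 ≤ C) (h : ∀ᵐ x, |f x| ≤ C) : ‖f‖ ≤ C := by
  rw [Lp.norm_def]
  refine ENNReal.toReal_le_of_le_ofReal hC ?_
  rw [eLpNorm_exponent_top]
  exact eLpNormEssSup_le_of_ae_bound h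

theorem LL.ae_abs_le (f : LL ∞) : ∀ᵐ x, |f x| ≤ ‖f‖ := by
  have h := ae_le_eLpNormEssSup (f := f) (μ := (volume : Measure ℝ))
  filter_upwards [h] with x hx
  rw [Lp.norm_def, eLpNorm_exponent_top]
  have h2 := Lp.eLpNorm_ne_top f
  rw [eLpNorm_exponent_top] at h2
  have := ENNReal.toReal_mono h2 hx
  simpa using this

variable (p) in
/-- The Sobolev embedding of `W^{1,p}` into `L^∞`. -/
noncomputable def W1.supL : W1 p →L[ℝ] LL ∞ :=
  LinearMap.mkContinuous
    { toFun := fun u => u.memLp_top.toLp u.fn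
      map_add' := fun u w => by
        apply Lp.ext
        filter_upwards [u.memLp_top.coeFn_toLp, w.memLp_top.coeFn_toLp,
          (u + w).memLp_top.coeFn_toLp, Lp.coeFn_add u.fn w.fn,
          Lp.coeFn_add (u.memLp_top.toLp u.fn) (w.memLp_top.toLp w.fn)] with x h1 h2 h3 h4 h5
        rw [h3, h5, Pi.add_apply, h1, h2]
        exact h4
      map_smul' := fun c u => by
        apply Lp.ext
        filter_upwards [u.memLp_top.coeFn_toLp, (c • u).memLp_top.coeFn_toLp,
          Lp.coeFn_smul c u.fn, Lp.coeFn_smul c (u.memLp_top.toLp u.fn)] with x h1 h2 h3 h4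
        rw [RingHom.id_apply, h2, h4, Pi.smul_apply, h1]
        exact h3 } 1
    (fun u => by
      rw [one_mul]
      refine LL.norm_top_le (norm_nonneg _) ?_
      filter_upwards [u.memLp_top.coeFn_toLp, u.ae_abs_le] with x h1 h2
      change |(u.memLp_top.toLp u.fn) x| ≤ _
      rwa [h1])

theorem W1.coeFn_supL (u : W1 p) : W1.supL p u =ᵐ[volume] u.fn := u.memLp_top.coeFn_toLp

theorem W1.norm_supL_le (u : W1 p) : ‖W1.supL p u‖ ≤ ‖u‖ := by
  have h : ‖W1.supL p‖ ≤ 1 := LinearMap.mkContinuous_norm_le _ zero_le_one _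
  simpa using (W1.supL p).le_of_opNorm_le h u

/-! ### Completeness of the Sobolev spaces. -/

theorem integral_mul_continuous {q : ℝ≥0∞} [ENNReal.HolderConjugate p q] [Fact (1 ≤ q)]
    {φ : ℝ → ℝ} (hφ : MemLp φ q volume) : Continuous fun f : LL p => ∫ x, f x * φ x := by
  have h : (fun f : LL p => ∫ x, f x * φ x) = fun f =>
      (ContinuousLinearMap.mul ℝ ℝ).lpPairing volume p q f (hφ.toLp φ) := by
    funext f
    rw [ContinuousLinearMap.lpPairing_eq_integral]
    refine integral_congr_ae ?_
    filter_upwards [hφ.coeFn_toLp] with x hx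
    simp [hx]
  rw [h]
  exact ((ContinuousLinearMap.mul ℝ ℝ).lpPairing volume p q).flip (hφ.toLp φ) |>.continuous

/-- Each test function imposes a closed condition, since by Hölder the pairing with it is continuous
on `L^p`. Completeness is what the implicit function and open mapping theorems need. -/
theorem isClosed_sobolevSubmodule : IsClosed (sobolevSubmodule p :
    Set (WithLp 1 (Lp ℝ p (volume : Measure ℝ) × Lp ℝ p (volume : Measure ℝ)))) := by
  have hset : (sobolevSubmodule p : Set (WithLp 1 (LL p × LL p))) =
      ⋂ φ : {φ : ℝ → ℝ // ContDiff ℝ ∞ φ ∧ HasCompactSupport φ},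
        {w | ∫ x, w.fst x * deriv φ.1 x = -∫ x, w.snd x * φ.1 x} := by
    ext w
    simp only [mem_iInter, Subtype.forall, and_imp]
    rfl
  rw [hset]
  refine isClosed_iInter fun φ => ?_
  have hp : (1 : ℝ≥0∞) ≤ p := Fact.out
  have hq : ENNReal.HolderConjugate p (ENNReal.conjExponent p) := .conjExponent hp
  have hq1 : Fact (1 ≤ ENNReal.conjExponent p) := ⟨ENNReal.HolderConjugate.one_le _ p⟩
  have hc := φ.2.1.continuous.memLp_of_hasCompactSupport (p := ENNReal.conjExponent p)
    (μ := volume) φ.2.2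
  have hd := (φ.2.1.continuous_deriv (by simp)).memLp_of_hasCompactSupport
    (p := ENNReal.conjExponent p) (μ := volume) φ.2.2.deriv
  refine isClosed_eq ?_ ?_
  · exact (integral_mul_continuous hd).comp (WithLp.prod_continuous_ofLp 1 _ _ |>.fst)
  · exact ((integral_mul_continuous hc).comp (WithLp.prod_continuous_ofLp 1 _ _ |>.snd)).neg

instance : CompleteSpace (W1 p) := isClosed_sobolevSubmodule.completeSpace_coe

/-! ### Translations -/

variable (p) in
/-- Translation `f ↦ f(· + c)` of `L^p`. -/
noncomputable def LL.shift (c : ℝ) : LL p →L[ℝ] LL p :=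
  (Lp.compMeasurePreservingₗᵢ ℝ (fun x => x + c)
    (measurePreserving_add_right volume c)).toContinuousLinearMap

theorem LL.coeFn_shift (c : ℝ) (f : LL p) : LL.shift p c f =ᵐ[volume] fun x => f (x + c) :=
  Lp.coeFn_compMeasurePreserving f (measurePreserving_add_right volume c)

@[simp] theorem LL.norm_shift (c : ℝ) (f : LL p) : ‖LL.shift p c f‖ = ‖f‖ :=
  Lp.norm_compMeasurePreserving f (measurePreserving_add_right volume c)

theorem ae_comp_add {P : ℝ → Prop} (h : ∀ᵐ x, P x) (c : ℝ) : ∀ᵐ x, P (x + c) :=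
  (measurePreserving_add_right volume c).quasiMeasurePreserving.ae h

theorem LL.shift_shift (c d : ℝ) (h : d + c = 0) (f : LL p) :
    LL.shift p c (LL.shift p d f) = f := by
  apply Lp.ext
  filter_upwards [LL.coeFn_shift c (LL.shift p d f), ae_comp_add (LL.coeFn_shift d f) c]
    with x h1 h2
  rw [h1, h2, add_assoc, add_comm c, h, add_zero]

theorem HasWeakDeriv.shift {u g : ℝ → ℝ} (h : HasWeakDeriv u g) (c : ℝ) :
    HasWeakDeriv (fun x => u (x + c)) (fun x => g (x + c)) := by
  intro φ hφ hc
  have hs : ContDiff ℝ ∞ fun x => φ (x - c) := hφ.comp (contDiff_id.sub contDiff_const)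
  have hsc : HasCompactSupport fun x => φ (x - c) := by
    simpa [sub_eq_add_neg, Function.comp_def] using
      hc.comp_homeomorph (Homeomorph.addRight (-c))
  have := h _ hs hsc
  rw [← integral_add_right_eq_self _ c, ← integral_add_right_eq_self (fun x => g x * _) c] at this
  simpa [deriv_comp_sub_const] using this

variable (p) in
/-- Translation of `W^{1,p}`. -/
noncomputable def W1.shift (c : ℝ) : W1 p →L[ℝ] W1 p :=
  LinearMap.mkContinuous
    { toFun := fun u => W1.mk (LL.shift p c u.fn) (LL.shift p c u.dx)
        ((u.hasWeakDeriv.shift c).congr (LL.coeFn_shift c u.fn).symm (LL.coeFn_shift c u.dx).symm)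
      map_add' := fun u w => W1.fn_injective (map_add (LL.shift p c) u.fn w.fn)
      map_smul' := fun r u => W1.fn_injective (map_smul (LL.shift p c) r u.fn) } 1
    (fun u => by
      rw [one_mul, W1.norm_eq, W1.norm_eq]
      exact (congrArg₂ _ (LL.norm_shift c u.fn) (LL.norm_shift c u.dx)).le)

@[simp] theorem W1.fn_shift (c : ℝ) (u : W1 p) : (W1.shift p c u).fn = LL.shift p c u.fn := rfl

@[simp] theorem W1.dx_shift (c : ℝ) (u : W1 p) : (W1.shift p c u).dx = LL.shift p c u.dx := rfl

@[simp] theorem W1.norm_shift (c : ℝ) (u : W1 p) : ‖W1.shift p c u‖ = ‖u‖ := by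
  rw [W1.norm_eq, W1.norm_eq, W1.fn_shift, W1.dx_shift, LL.norm_shift, LL.norm_shift]

theorem W1.shift_shift (c d : ℝ) (h : d + c = 0) (u : W1 p) :
    W1.shift p c (W1.shift p d u) = u :=
  W1.fn_injective (LL.shift_shift c d h u.fn)

/-! ### Products and pairings -/

variable (p) in
/-- Multiplication `L^∞ × L^p → L^p`. -/
noncomputable def LL.mulL : LL ∞ →L[ℝ] LL p →L[ℝ] LL p :=
  (ContinuousLinearMap.mul ℝ ℝ).holderL volume ∞ p p

theorem LL.coeFn_mulL (m : LL ∞) (f : LL p) : LL.mulL p m f =ᵐ[volume] fun x => m x * f x :=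
  (ContinuousLinearMap.mul ℝ ℝ).coeFn_holder m f

/-- The pairing of `L^∞` and `L^1`. -/
noncomputable def LL.pairing : LL ∞ →L[ℝ] LL 1 →L[ℝ] ℝ :=
  (ContinuousLinearMap.mul ℝ ℝ).lpPairing volume ∞ 1

theorem LL.pairing_apply (m : LL ∞) (f : LL 1) : LL.pairing m f = ∫ x, m x * f x :=
  (ContinuousLinearMap.mul ℝ ℝ).lpPairing_eq_integral m f

end Spaces

/-! ### Quadratic remainders -/

/-- A quadratic remainder at every point of `B` identifies `S'` as the derivative throughout `B`,
and its continuity gives `C¹`. Both infinite-dimensional nonlinearities, `sinShift` and `sechFam`,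
are treated this way. -/
theorem contDiffAt_of_quadratic {E F : Type*} [NormedAddCommGroup E] [NormedSpace ℝ E]
    [NormedAddCommGroup F] [NormedSpace ℝ F] {B : Set E} (hB : IsOpen B) {S : E → F}
    {S' : E → E →L[ℝ] F} {C : ℝ}
    (h : ∀ x ∈ B, ∀ y ∈ B, ‖S y - S x - S' x (y - x)‖ ≤ C * ‖y - x‖ ^ 2)
    (hc : ContinuousOn S' B) {x : E} (hx : x ∈ B) :
    ContDiffAt ℝ 1 S x ∧ HasFDerivAt S (S' x) x := by
  have hd : ∀ x ∈ B, HasFDerivAt S (S' x) x := by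
    intro x hx
    refine HasFDerivAt.of_isLittleO ?_
    refine Asymptotics.IsBigO.trans_isLittleO (g := fun y => ‖y - x‖ ^ 2) ?_ ?_
    · refine Asymptotics.IsBigO.of_bound C ?_
      filter_upwards [hB.mem_nhds hx] with y hy
      simpa using h x hx y hy
    · have := Asymptotics.isLittleO_norm_pow_id (E' := E) (n := 2) (by norm_num)
      have ht : Tendsto (fun y => y - x) (𝓝 x) (𝓝 0) := by
        have : Tendsto (fun y => y - x) (𝓝 x) (𝓝 (x - x)) :=
          (continuous_id.sub continuous_const).tendsto x
        simpa using this
      exact this.comp_tendsto ht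
  exact ⟨contDiffAt_one_iff.2 ⟨S', B, hB.mem_nhds hx, hc, hd⟩, hd x hx⟩

/-- The mean value inequality is used twice, the second time for `k x - k' s * x`. The second
derivative is bounded only between `s` and `t`, so `M` may carry the decay of `sech`. -/
theorem abs_taylor_le {k k' k'' : ℝ → ℝ} {M : ℝ} (hk : ∀ x, HasDerivAt k (k' x) x)
    (hk' : ∀ x, HasDerivAt k' (k'' x) x) {s t : ℝ} (hM : ∀ x ∈ uIcc s t, |k'' x| ≤ M) :
    |k' t - k' s| ≤ M * |t - s| ∧ |k t - k s - k' s * (t - s)| ≤ M * |t - s| ^ 2 := by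
  have h1 : ∀ x ∈ uIcc s t, |k' x - k' s| ≤ M * |x - s| := fun x hx =>
    (convex_uIcc s t).norm_image_sub_le_of_norm_hasDerivWithin_le
      (fun y _ => (hk' y).hasDerivWithinAt) hM left_mem_uIcc hx
  have hM0 : 0 ≤ M := (abs_nonneg _).trans (hM s left_mem_uIcc)
  refine ⟨h1 t right_mem_uIcc, ?_⟩
  have h2 := (convex_uIcc s t).norm_image_sub_le_of_norm_hasDerivWithin_le
    (f := fun x => k x - k' s * x) (f' := fun x => k' x - k' s) (C := M * |t - s|)
    (fun y _ => ((hk y).sub (by simpa using (hasDerivAt_id y).const_mul (k' s))).hasDerivWithinAt)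
    (fun x hx => (h1 x hx).trans (mul_le_mul_of_nonneg_left
      (abs_sub_left_of_mem_uIcc hx) hM0)) left_mem_uIcc right_mem_uIcc
  simp only [Real.norm_eq_abs] at h2
  calc |k t - k s - k' s * (t - s)| = |k t - k' s * t - (k s - k' s * s)| := by congr 1; ring
    _ ≤ M * |t - s| * |t - s| := h2
    _ = M * |t - s| ^ 2 := by ring

/-! ### Superposition operators -/

section Nemytskii

open Classical in
/-- The class of `f` in `L^p`. -/
noncomputable def mkLp (p : ℝ≥0∞) (f : ℝ → ℝ) : LL p :=
  -- Zero is a default value; every use goes through a proof that `f` lies in `L^p`.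
  if h : MemLp f p volume then h.toLp f else 0

theorem coeFn_mkLp {p : ℝ≥0∞} {f : ℝ → ℝ} (h : MemLp f p volume) : mkLp p f =ᵐ[volume] f := by
  rw [mkLp, dif_pos h]; exact h.coeFn_toLp

variable {p : ℝ≥0∞} {Q : ℝ → ℝ}

/-- The superposition operator `w ↦ sin((w + Q)/2) - sin(Q/2)`. -/
noncomputable def sinShift (p : ℝ≥0∞) (Q : ℝ → ℝ) (w : LL p) : LL p :=
  mkLp p fun x => Real.sin ((w x + Q x) / 2) - Real.sin (Q x / 2)

/-- The function `½ cos((w + Q)/2)`. -/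
noncomputable def cosShift (Q : ℝ → ℝ) (w : LL ∞) : LL ∞ :=
  mkLp ∞ fun x => 1 / 2 * Real.cos ((w x + Q x) / 2)

theorem abs_sin_sub_sin_le (x y : ℝ) : |Real.sin x - Real.sin y| ≤ |x - y| := by
  have h := (abs_taylor_le (k := fun x => -Real.cos x) (s := y) (t := x) (M := 1)
    (fun x => by simpa using (Real.hasDerivAt_cos x).fun_neg) Real.hasDerivAt_sin
    (fun x _ => Real.abs_cos_le_one x)).1
  simpa using h

theorem abs_cos_sub_cos_le (x y : ℝ) : |Real.cos x - Real.cos y| ≤ |x - y| := by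
  have h := (abs_taylor_le (k := Real.sin) (s := y) (t := x) (M := 1)
    Real.hasDerivAt_sin Real.hasDerivAt_cos
    (fun x _ => by simpa using Real.abs_sin_le_one x)).1
  simpa using h

theorem abs_sin_taylor_le (x y : ℝ) :
    |Real.sin y - Real.sin x - Real.cos x * (y - x)| ≤ |y - x| ^ 2 := by
  have h := (abs_taylor_le (k := Real.sin) (s := x) (t := y) (M := 1)
    Real.hasDerivAt_sin Real.hasDerivAt_cos
    (fun x _ => by simpa using Real.abs_sin_le_one x)).2
  simpa using h

theorem coeFn_sinShift (hQ : Continuous Q) (w : LL p) : sinShift p Q w =ᵐ[volume]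
    fun x => Real.sin ((w x + Q x) / 2) - Real.sin (Q x / 2) := by
  refine coeFn_mkLp ((Lp.memLp w).of_le ?_ (Eventually.of_forall fun x => ?_))
  · exact ((Real.continuous_sin.comp (continuous_id.div_const 2)).comp_aestronglyMeasurable
      ((Lp.memLp w).1.add hQ.aestronglyMeasurable)).sub
      (Real.continuous_sin.comp (hQ.div_const 2)).aestronglyMeasurable
  · have := abs_sin_sub_sin_le ((w x + Q x) / 2) (Q x / 2)
    simp only [Real.norm_eq_abs]
    refine this.trans ?_
    rw [show (w x + Q x) / 2 - Q x / 2 = w x / 2 by ring, abs_div, abs_two]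
    linarith [abs_nonneg (w x)]

theorem coeFn_cosShift (hQ : Continuous Q) (w : LL ∞) : cosShift Q w =ᵐ[volume]
    fun x => 1 / 2 * Real.cos ((w x + Q x) / 2) := by
  refine coeFn_mkLp (memLp_top_of_bound ?_ 1 (Eventually.of_forall fun x => ?_))
  · exact ((Real.continuous_cos.comp (continuous_id.div_const 2)).comp_aestronglyMeasurable
      ((Lp.memLp w).1.add hQ.aestronglyMeasurable)).const_mul _
  · have := Real.abs_cos_le_one ((w x + Q x) / 2)
    rw [Real.norm_eq_abs, abs_mul]
    norm_num
    linarith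

theorem norm_cosShift_sub_le (hQ : Continuous Q) (w w' : LL ∞) :
    ‖cosShift Q w - cosShift Q w'‖ ≤ ‖w - w'‖ := by
  refine Lp.norm_le_norm_of_ae_le ?_
  filter_upwards [Lp.coeFn_sub (cosShift Q w) (cosShift Q w'), Lp.coeFn_sub w w',
    coeFn_cosShift hQ w, coeFn_cosShift hQ w'] with x h1 h2 h3 h4
  rw [h1, h2, Pi.sub_apply, Pi.sub_apply, h3, h4, ← mul_sub, Real.norm_eq_abs, abs_mul]
  have := abs_cos_sub_cos_le ((w x + Q x) / 2) ((w' x + Q x) / 2)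
  rw [show (w x + Q x) / 2 - (w' x + Q x) / 2 = (w x - w' x) / 2 by ring, abs_div,
    abs_two] at this
  rw [Real.norm_eq_abs, abs_of_pos (by norm_num : (0 : ℝ) < 1 / 2)]
  linarith [abs_nonneg (w x - w' x)]

/-- The pointwise Taylor remainder of the sine is at most the square of the increment. One factor is
measured in `L^∞` through `E`, the other in `L^p` through `J`, which gives a quadratic bound in `X`.
The space `X` is `W^{1,p}` for existence and `L^∞` itself for comparing exponents. -/
theorem contDiffAt_sinShift [Fact (1 ≤ p)] {X : Type*} [NormedAddCommGroup X] [NormedSpace ℝ X]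
    (hQ : Continuous Q) (J : X →L[ℝ] LL p) (E : X →L[ℝ] LL ∞)
    (hJE : ∀ u, E u =ᵐ[volume] J u) (u : X) :
    ContDiffAt ℝ 1 (fun w => sinShift p Q (J w)) u ∧
      HasFDerivAt (fun w => sinShift p Q (J w)) (LL.mulL p (cosShift Q (E u)) ∘L J) u := by
  refine contDiffAt_of_quadratic (S' := fun u => LL.mulL p (cosShift Q (E u)) ∘L J)
    (C := ‖E‖ * ‖J‖) isOpen_univ ?_ ?_ (mem_univ u)
  · intro u _ w _
    have key : ‖sinShift p Q (J w) - sinShift p Q (J u)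
        - LL.mulL p (cosShift Q (E u)) (J (w - u))‖ ≤ ‖E (w - u)‖ * ‖J (w - u)‖ := by
      refine Lp.norm_le_mul_norm_of_ae_le_mul ?_
      filter_upwards [Lp.coeFn_sub (sinShift p Q (J w) - sinShift p Q (J u))
        (LL.mulL p (cosShift Q (E u)) (J (w - u))),
        Lp.coeFn_sub (sinShift p Q (J w)) (sinShift p Q (J u)),
        LL.coeFn_mulL (cosShift Q (E u)) (J (w - u)), coeFn_sinShift hQ (J w),
        coeFn_sinShift hQ (J u), coeFn_cosShift hQ (E u), hJE u, hJE (w - u),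
        LL.ae_abs_le (E (w - u)), Lp.coeFn_sub (J w) (J u)] with x h1 h2 h3 h4 h5 h6 h7 h8 h9 h10
      rw [h8] at h9
      rw [h1, Pi.sub_apply, h2, Pi.sub_apply, h3, h4, h5, h6, h7, Real.norm_eq_abs,
        Real.norm_eq_abs]
      have hd : (J (w - u)) x = (J w) x - (J u) x := by rw [map_sub, h10, Pi.sub_apply]
      have ht := abs_sin_taylor_le (((J u) x + Q x) / 2) (((J w) x + Q x) / 2)
      have e : ((J w) x + Q x) / 2 - ((J u) x + Q x) / 2 = (J (w - u)) x / 2 := by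
        rw [hd]; ring
      rw [e] at ht
      calc |Real.sin (((J w) x + Q x) / 2) - Real.sin (Q x / 2)
            - (Real.sin (((J u) x + Q x) / 2) - Real.sin (Q x / 2))
            - 1 / 2 * Real.cos (((J u) x + Q x) / 2) * (J (w - u)) x|
          = |Real.sin (((J w) x + Q x) / 2) - Real.sin (((J u) x + Q x) / 2)
            - Real.cos (((J u) x + Q x) / 2) * ((J (w - u)) x / 2)| := by congr 1; ring
        _ ≤ |(J (w - u)) x / 2| ^ 2 := ht
        _ ≤ |(J (w - u)) x| * |(J (w - u)) x| := by
            rw [abs_div, abs_two]; nlinarith [abs_nonneg ((J (w - u)) x)]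
        _ ≤ ‖E (w - u)‖ * |(J (w - u)) x| := by gcongr
    refine key.trans ?_
    calc ‖E (w - u)‖ * ‖J (w - u)‖ ≤ (‖E‖ * ‖w - u‖) * (‖J‖ * ‖w - u‖) := by
          gcongr <;> exact ContinuousLinearMap.le_opNorm _ _
      _ = ‖E‖ * ‖J‖ * ‖w - u‖ ^ 2 := by ring
  · have hcs : Continuous (cosShift Q) := by
      refine (LipschitzWith.of_dist_le_mul (K := 1) fun a b => ?_).continuous
      simpa [dist_eq_norm] using norm_cosShift_sub_le hQ a b
    have h1 : Continuous fun u => LL.mulL p (cosShift Q (E u)) :=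
      (LL.mulL p).continuous.comp (hcs.comp E.continuous)
    exact (h1.clm_comp continuous_const).continuousOn

theorem sinShift_zero (hQ : Continuous Q) : sinShift p Q 0 = 0 := by
  apply Lp.ext
  filter_upwards [coeFn_sinShift hQ (0 : LL p), Lp.coeFn_zero ℝ p (volume : Measure ℝ)]
    with x h1 h2
  rw [h1, h2]
  simp

end Nemytskii

/-! ### The hyperbolic secant -/

theorem sech_pos (x : ℝ) : 0 < sech x := one_div_pos.2 (Real.cosh_pos x)

theorem sech_le_one (x : ℝ) : sech x ≤ 1 := by
  rw [sech, div_le_one (Real.cosh_pos x)]; exact Real.one_le_cosh x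

theorem sech_neg (x : ℝ) : sech (-x) = sech x := by simp [sech]

theorem cosh_mul_sech (x : ℝ) : Real.cosh x * sech x = 1 := by
  rw [sech, mul_one_div_cancel (Real.cosh_pos x).ne']

theorem contDiff_sech {n : WithTop ℕ∞} : ContDiff ℝ n sech :=
  contDiff_const.div Real.contDiff_cosh fun x => (Real.cosh_pos x).ne'

theorem continuous_sech : Continuous sech := (contDiff_sech (n := 0)).continuous

theorem contDiff_tanh {n : WithTop ℕ∞} : ContDiff ℝ n Real.tanh := by
  have : Real.tanh = fun x => Real.sinh x / Real.cosh x :=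
    funext fun x => Real.tanh_eq_sinh_div_cosh x
  rw [this]
  exact Real.contDiff_sinh.div Real.contDiff_cosh fun x => (Real.cosh_pos x).ne'

theorem continuous_tanh : Continuous Real.tanh := (contDiff_tanh (n := 0)).continuous

theorem sech_sq_add_tanh_sq (x : ℝ) : sech x ^ 2 + Real.tanh x ^ 2 = 1 := by
  rw [sech, Real.tanh_eq_sinh_div_cosh]
  have := (Real.cosh_pos x).ne'
  field_simp
  linarith [Real.cosh_sq x]

theorem abs_tanh_le_one (x : ℝ) : |Real.tanh x| ≤ 1 := by
  rw [← sq_le_one_iff_abs_le_one]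
  nlinarith [sech_sq_add_tanh_sq x, sq_nonneg (sech x)]

theorem hasDerivAt_sech (x : ℝ) : HasDerivAt sech (-(sech x * Real.tanh x)) x := by
  have h := (hasDerivAt_const x (1 : ℝ)).fun_div (Real.hasDerivAt_cosh x) (Real.cosh_pos x).ne'
  refine h.congr_deriv ?_
  rw [sech, Real.tanh_eq_sinh_div_cosh]
  have := (Real.cosh_pos x).ne'
  field_simp
  ring

theorem hasDerivAt_tanh (x : ℝ) : HasDerivAt Real.tanh (sech x ^ 2) x := by
  have h := (Real.hasDerivAt_sinh x).fun_div (Real.hasDerivAt_cosh x) (Real.cosh_pos x).ne'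
  have e : Real.tanh = fun x => Real.sinh x / Real.cosh x :=
    funext fun x => Real.tanh_eq_sinh_div_cosh x
  rw [e]
  refine h.congr_deriv ?_
  rw [sech]
  have := (Real.cosh_pos x).ne'
  field_simp
  linarith [Real.cosh_sq x]

theorem hasDerivAt_deriv_sech (x : ℝ) : HasDerivAt (fun x => -(sech x * Real.tanh x))
    (sech x * (Real.tanh x ^ 2 - sech x ^ 2)) x := by
  refine ((hasDerivAt_sech x).mul (hasDerivAt_tanh x)).fun_neg.congr_deriv ?_
  ring

theorem abs_deriv_sech_le (x : ℝ) : |(-(sech x * Real.tanh x))| ≤ sech x := by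
  rw [abs_neg, abs_mul, abs_of_pos (sech_pos x)]
  exact mul_le_of_le_one_right (sech_pos x).le (abs_tanh_le_one x)

theorem abs_deriv_deriv_sech_le (x : ℝ) :
    |sech x * (Real.tanh x ^ 2 - sech x ^ 2)| ≤ sech x := by
  rw [abs_mul, abs_of_pos (sech_pos x)]
  refine mul_le_of_le_one_right (sech_pos x).le (abs_le.2 ⟨?_, ?_⟩) <;>
  nlinarith [sech_sq_add_tanh_sq x, sq_nonneg (sech x), sq_nonneg (Real.tanh x)]

theorem sech_le_exp (x : ℝ) : sech x ≤ 2 * Real.exp (-|x|) := by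
  rw [sech, ← Real.cosh_abs, div_le_iff₀ (Real.cosh_pos _), Real.cosh_eq, Real.exp_neg]
  have := Real.exp_pos |x|
  field_simp
  nlinarith [Real.exp_pos (-|x|)]

theorem integrable_exp_neg_mul_abs {c : ℝ} (hc : 0 < c) :
    Integrable fun x : ℝ => Real.exp (-(c * |x|)) := by
  rw [← integrableOn_univ, ← Iic_union_Ioi (a := (0 : ℝ))]
  refine IntegrableOn.union ?_ ?_
  · refine (integrableOn_exp_mul_Iic hc 0).congr_fun (fun x hx => ?_) measurableSet_Iic
    have hx' : x ≤ 0 := hx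
    simp [abs_of_nonpos hx']
  · refine (integrableOn_exp_mul_Ioi (a := -c) (by linarith) 0).congr_fun (fun x hx => ?_)
      measurableSet_Ioi
    have hx' : 0 < x := hx
    simp [abs_of_pos hx']

theorem integrable_sech : Integrable sech := by
  refine ((integrable_exp_neg_mul_abs one_pos).const_mul 2).mono'
    continuous_sech.aestronglyMeasurable (Eventually.of_forall fun x => ?_)
  rw [Real.norm_eq_abs, abs_of_pos (sech_pos x)]
  simpa using sech_le_exp x

theorem memLp_sech_mul (p : ℝ≥0∞) {c : ℝ} (hc : c ≠ 0) :
    MemLp (fun x => sech (c * x)) p volume := by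
  have hm : Continuous fun x => sech (c * x) := continuous_sech.comp (continuous_const_mul c)
  have ht : MemLp (fun x => sech (c * x)) ∞ volume :=
    memLp_top_of_bound hm.aestronglyMeasurable 1 (Eventually.of_forall fun x => by
      rw [Real.norm_eq_abs, abs_of_pos (sech_pos _)]; exact sech_le_one _)
  rcases eq_or_ne p 0 with rfl | hp0
  · exact memLp_zero_iff_aestronglyMeasurable.2 hm.aestronglyMeasurable
  rcases eq_or_ne p ∞ with rfl | hp
  · exact ht
  have hpr := ENNReal.toReal_pos hp0 hp
  rw [← integrable_norm_rpow_iff hm.aestronglyMeasurable hp0 hp]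
  refine ((integrable_exp_neg_mul_abs (c := p.toReal * |c|)
    (mul_pos hpr (abs_pos.2 hc))).const_mul (2 ^ p.toReal)).mono'
    (hm.norm.rpow_const fun _ => Or.inr hpr.le).aestronglyMeasurable
    (Eventually.of_forall fun x => ?_)
  rw [Real.norm_eq_abs, Real.norm_eq_abs, abs_of_pos (sech_pos _),
    abs_of_nonneg (Real.rpow_nonneg (sech_pos _).le _)]
  refine (Real.rpow_le_rpow (sech_pos _).le (sech_le_exp _) hpr.le).trans (le_of_eq ?_)
  rw [Real.mul_rpow (by norm_num) (Real.exp_pos _).le, ← Real.exp_mul, abs_mul]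
  congr 2
  ring

theorem hasDerivAt_arctan_exp (x : ℝ) :
    HasDerivAt (fun x => 2 * Real.arctan (Real.exp x)) (sech x) x := by
  refine ((Real.hasDerivAt_exp x).arctan.const_mul 2).congr_deriv ?_
  rw [sech, Real.cosh_eq, Real.exp_neg]
  have := Real.exp_pos x
  field_simp
  ring

/-! ### The family `sech (α x - b)` in `L¹` -/

/-- An integrable majorant for `(1 + |x|)² sech (α x - b)`. -/
noncomputable def sechWeight (a B x : ℝ) : ℝ :=
  2 * Real.exp B * (8 / a ^ 2 * Real.exp (a / 2)) * Real.exp (-(a / 2 * |x|))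

theorem integrable_sechWeight {a : ℝ} (ha : 0 < a) (B : ℝ) : Integrable (sechWeight a B) :=
  (integrable_exp_neg_mul_abs (half_pos ha)).const_mul _

/-- The inequality `s² / 2 ≤ e^s` at `s = a/2 (1 + |x|)` trades the polynomial weight for half of
the exponential decay. -/
theorem sech_mul_sq_le_sechWeight {a B x z : ℝ} (ha : 0 < a) (hz : a * |x| - B ≤ |z|) :
    2 * Real.exp (-(a * |x| - B)) * (1 + |x|) ^ 2 ≤ sechWeight a B x ∧
      sech z ≤ 2 * Real.exp (-(a * |x| - B)) := by
  constructor
  · have h := Real.quadratic_le_exp_of_nonneg (x := a / 2 * (1 + |x|)) (by positivity)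
    have h2 : (1 + |x|) ^ 2 ≤ 8 / a ^ 2 * Real.exp (a / 2 * (1 + |x|)) := by
      have : (a / 2 * (1 + |x|)) ^ 2 / 2 ≤ Real.exp (a / 2 * (1 + |x|)) := by
        have : 0 ≤ a / 2 * (1 + |x|) := by positivity
        linarith
      rw [div_mul_eq_mul_div, le_div_iff₀ (by positivity)]
      nlinarith
    calc 2 * Real.exp (-(a * |x| - B)) * (1 + |x|) ^ 2
        ≤ 2 * Real.exp (-(a * |x| - B)) * (8 / a ^ 2 * Real.exp (a / 2 * (1 + |x|))) := by gcongr
      _ = sechWeight a B x := by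
        rw [sechWeight, show -(a * |x| - B) = B + -(a / 2 * |x|) + -(a / 2 * |x|) by ring,
          show a / 2 * (1 + |x|) = a / 2 + a / 2 * |x| by ring, Real.exp_add, Real.exp_add,
          Real.exp_add]
        have : Real.exp (-(a / 2 * |x|)) * Real.exp (a / 2 * |x|) = 1 := by
          rw [← Real.exp_add]; simp
        linear_combination (2 * Real.exp B * Real.exp (-(a / 2 * |x|)) * (8 / a ^ 2)
          * Real.exp (a / 2)) * this
  · refine (sech_le_exp z).trans ?_
    gcongr

/-- A region of parameters. -/
def sechRegion (a B : ℝ) : Set (ℝ × ℝ) := {q | a < q.1 ∧ |q.2| < B}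

theorem isOpen_sechRegion (a B : ℝ) : IsOpen (sechRegion a B) :=
  (isOpen_lt continuous_const continuous_fst).inter
    (isOpen_lt continuous_snd.abs continuous_const)

/-- For `x ≥ 0` both endpoints are at least `a x - B`, and for `x ≤ 0` both are at most `a x + B`.
The whole segment obeys the same bound, so Taylor's formula keeps uniform decay at intermediate
points. -/
theorem le_abs_of_mem_uIcc {a B x z : ℝ} {q q' : ℝ × ℝ} (hq : q ∈ sechRegion a B)
    (hq' : q' ∈ sechRegion a B) (hz : z ∈ uIcc (q.1 * x - q.2) (q'.1 * x - q'.2)) :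
    a * |x| - B ≤ |z| := by
  obtain ⟨h1, h2⟩ := hq
  obtain ⟨h3, h4⟩ := hq'
  rw [abs_lt] at h2 h4
  rcases le_total 0 x with hx | hx
  · rw [abs_of_nonneg hx]
    refine le_trans ?_ (le_abs_self z)
    refine le_trans (le_inf ?_ ?_) hz.1
    · nlinarith
    · nlinarith
  · rw [abs_of_nonpos hx]
    refine le_trans ?_ (neg_le_abs z)
    have : z ≤ a * x + B := hz.2.trans (sup_le (by nlinarith) (by nlinarith))
    linarith

theorem abs_arg_sub_le (q q' : ℝ × ℝ) (x : ℝ) :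
    |(q'.1 * x - q'.2) - (q.1 * x - q.2)| ≤ ‖q' - q‖ * (1 + |x|) := by
  have h1 : |q'.1 - q.1| ≤ ‖q' - q‖ := norm_fst_le (q' - q)
  have h2 : |q'.2 - q.2| ≤ ‖q' - q‖ := norm_snd_le (q' - q)
  calc |(q'.1 * x - q'.2) - (q.1 * x - q.2)| = |(q'.1 - q.1) * x - (q'.2 - q.2)| := by
        congr 1; ring
    _ ≤ |(q'.1 - q.1) * x| + |q'.2 - q.2| := abs_sub _ _
    _ ≤ ‖q' - q‖ * |x| + ‖q' - q‖ := by rw [abs_mul]; gcongr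
    _ = ‖q' - q‖ * (1 + |x|) := by ring

/-- Changing `(α, b)` moves the argument by at most `‖q' - q‖ (1 + |x|)`. The resulting factor `(1 +
|x|)²` is absorbed by `sechWeight`, so integration turns these pointwise bounds into bounds in `L¹`.
The extra `1 + |x|` in the first one pays for the factor `x` in `xdsechFam`. -/
theorem sech_taylor {a B x : ℝ} (ha : 0 < a) {q q' : ℝ × ℝ} (hq : q ∈ sechRegion a B)
    (hq' : q' ∈ sechRegion a B) :
    |(-(sech (q'.1 * x - q'.2) * Real.tanh (q'.1 * x - q'.2)))
        - (-(sech (q.1 * x - q.2) * Real.tanh (q.1 * x - q.2)))| * (1 + |x|)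
      ≤ ‖q' - q‖ * sechWeight a B x ∧
    |sech (q'.1 * x - q'.2) - sech (q.1 * x - q.2)
        - (-(sech (q.1 * x - q.2) * Real.tanh (q.1 * x - q.2)))
          * ((q'.1 * x - q'.2) - (q.1 * x - q.2))|
      ≤ ‖q' - q‖ ^ 2 * sechWeight a B x := by
  set M := 2 * Real.exp (-(a * |x| - B)) with hM
  have hM0 : 0 ≤ M := by positivity
  have h := abs_taylor_le (M := M) (s := q.1 * x - q.2) (t := q'.1 * x - q'.2) hasDerivAt_sech
    hasDerivAt_deriv_sech (fun z hz => (abs_deriv_deriv_sech_le z).trans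
      (sech_mul_sq_le_sechWeight ha (le_abs_of_mem_uIcc hq hq' hz)).2)
  have hw := (sech_mul_sq_le_sechWeight (x := x) ha (le_abs_of_mem_uIcc hq hq' left_mem_uIcc)).1
  have hd := abs_arg_sub_le q q' x
  have hn := norm_nonneg (q' - q)
  have hx := abs_nonneg x
  constructor
  · calc _ ≤ M * |q'.1 * x - q'.2 - (q.1 * x - q.2)| * (1 + |x|) := by gcongr; exact h.1
      _ ≤ M * (‖q' - q‖ * (1 + |x|)) * (1 + |x|) := by gcongr
      _ = ‖q' - q‖ * (M * (1 + |x|) ^ 2) := by ring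
      _ ≤ _ := by gcongr
  · calc _ ≤ M * |q'.1 * x - q'.2 - (q.1 * x - q.2)| ^ 2 := h.2
      _ ≤ M * (‖q' - q‖ * (1 + |x|)) ^ 2 := by gcongr
      _ = ‖q' - q‖ ^ 2 * (M * (1 + |x|) ^ 2) := by ring
      _ ≤ _ := by gcongr

/-- The function `x ↦ sech (α x - b)` as an element of `L¹`, where `q = (α, b)`. -/
noncomputable def sechFam (q : ℝ × ℝ) : LL 1 := mkLp 1 fun x => sech (q.1 * x - q.2)

/-- The function `sech'(α x - b)`. -/
noncomputable def dsechFam (q : ℝ × ℝ) : LL 1 :=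
  mkLp 1 fun x => -(sech (q.1 * x - q.2) * Real.tanh (q.1 * x - q.2))

/-- The function `x sech'(α x - b)`. -/
noncomputable def xdsechFam (q : ℝ × ℝ) : LL 1 :=
  mkLp 1 fun x => -(sech (q.1 * x - q.2) * Real.tanh (q.1 * x - q.2)) * x

/-- The derivative of `sechFam`. -/
noncomputable def sechFamDeriv (q : ℝ × ℝ) : ℝ × ℝ →L[ℝ] LL 1 :=
  (ContinuousLinearMap.fst ℝ ℝ ℝ).smulRight (xdsechFam q)
    - (ContinuousLinearMap.snd ℝ ℝ ℝ).smulRight (dsechFam q)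

theorem memLp_one_of_sech_bound {q : ℝ × ℝ} (hq : 0 < q.1) {f : ℝ → ℝ} (hf : Continuous f)
    (h : ∀ x, |f x| ≤ sech (q.1 * x - q.2) * (1 + |x|)) : MemLp f 1 volume := by
  rw [memLp_one_iff_integrable]
  refine (integrable_sechWeight (half_pos hq) (|q.2| + 1)).mono' hf.aestronglyMeasurable
    (Eventually.of_forall fun x => ?_)
  have hmem : q ∈ sechRegion (q.1 / 2) (|q.2| + 1) := ⟨by linarith, by linarith⟩
  have hb := sech_mul_sq_le_sechWeight (half_pos hq)
    (le_abs_of_mem_uIcc (x := x) hmem hmem left_mem_uIcc)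
  have hx := abs_nonneg x
  refine (h x).trans (le_trans ?_ hb.1)
  refine mul_le_mul hb.2 ?_ (by linarith) (by positivity)
  nlinarith

theorem coeFn_sechFam {q : ℝ × ℝ} (hq : 0 < q.1) :
    sechFam q =ᵐ[volume] fun x => sech (q.1 * x - q.2) := by
  refine coeFn_mkLp (memLp_one_of_sech_bound hq (continuous_sech.comp (by fun_prop)) fun x => ?_)
  rw [abs_of_pos (sech_pos _)]
  exact le_mul_of_one_le_right (sech_pos _).le (by linarith [abs_nonneg x])

theorem continuous_dsech (q : ℝ × ℝ) :
    Continuous fun x => -(sech (q.1 * x - q.2) * Real.tanh (q.1 * x - q.2)) :=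
  ((continuous_sech.comp (by fun_prop)).mul (continuous_tanh.comp (by fun_prop))).neg

theorem coeFn_dsechFam {q : ℝ × ℝ} (hq : 0 < q.1) : dsechFam q =ᵐ[volume]
    fun x => -(sech (q.1 * x - q.2) * Real.tanh (q.1 * x - q.2)) := by
  refine coeFn_mkLp (memLp_one_of_sech_bound hq (continuous_dsech q) fun x => ?_)
  exact (abs_deriv_sech_le _).trans
    (le_mul_of_one_le_right (sech_pos _).le (by linarith [abs_nonneg x]))

theorem coeFn_xdsechFam {q : ℝ × ℝ} (hq : 0 < q.1) : xdsechFam q =ᵐ[volume]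
    fun x => -(sech (q.1 * x - q.2) * Real.tanh (q.1 * x - q.2)) * x := by
  refine coeFn_mkLp (memLp_one_of_sech_bound hq ((continuous_dsech q).mul continuous_id)
    fun x => ?_)
  rw [abs_mul]
  exact mul_le_mul (abs_deriv_sech_le _) (by linarith) (abs_nonneg x) (sech_pos _).le

theorem LL.norm_one_le {f : LL 1} {w : ℝ → ℝ} (hw : Integrable w)
    (h : ∀ᵐ x, |f x| ≤ w x) : ‖f‖ ≤ ∫ x, w x := by
  rw [L1.norm_eq_integral_norm]
  exact integral_mono_ae (L1.integrable_coeFn f).norm hw h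

theorem contDiffAt_sechFam {q : ℝ × ℝ} (hq : 0 < q.1) :
    ContDiffAt ℝ 1 sechFam q ∧ HasFDerivAt sechFam (sechFamDeriv q) q := by
  set a := q.1 / 2 with ha
  set B := |q.2| + 1 with hB
  have ha0 : 0 < a := half_pos hq
  have hmem : q ∈ sechRegion a B := ⟨by linarith, by linarith⟩
  have hW := integrable_sechWeight ha0 B
  refine contDiffAt_of_quadratic (S' := sechFamDeriv) (C := ∫ x, sechWeight a B x)
    (isOpen_sechRegion a B) ?_ ?_ hmem
  · intro q hq q' hq'
    have h0 := ha0.trans hq.1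
    have h0' := ha0.trans hq'.1
    rw [mul_comm, ← integral_const_mul]
    refine LL.norm_one_le (hW.const_mul _) ?_
    simp only [sechFamDeriv, sub_apply, ContinuousLinearMap.smulRight_apply,
      ContinuousLinearMap.coe_fst', ContinuousLinearMap.coe_snd', Prod.fst_sub, Prod.snd_sub]
    filter_upwards [Lp.coeFn_sub (sechFam q' - sechFam q)
      ((q'.1 - q.1) • xdsechFam q - (q'.2 - q.2) • dsechFam q),
      Lp.coeFn_sub (sechFam q') (sechFam q), Lp.coeFn_sub ((q'.1 - q.1) • xdsechFam q)
      ((q'.2 - q.2) • dsechFam q), Lp.coeFn_smul (q'.1 - q.1) (xdsechFam q),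
      Lp.coeFn_smul (q'.2 - q.2) (dsechFam q), coeFn_sechFam h0, coeFn_sechFam h0',
      coeFn_dsechFam h0, coeFn_xdsechFam h0] with x h1 h2 h3 h4 h5 h6 h7 h8 h9
    rw [h1, Pi.sub_apply, h2, h3, Pi.sub_apply, Pi.sub_apply, h4, h5, Pi.smul_apply,
      Pi.smul_apply, h6, h7, h8, h9, smul_eq_mul, smul_eq_mul]
    refine le_trans (le_of_eq ?_) (sech_taylor (x := x) ha0 hq hq').2
    congr 1
    ring
  · have key : ∀ F : ℝ × ℝ → LL 1, (∀ q ∈ sechRegion a B, ∀ q' ∈ sechRegion a B,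
        ‖F q' - F q‖ ≤ ∫ x, ‖q' - q‖ * sechWeight a B x) → ContinuousOn F (sechRegion a B) := by
      intro F hF
      have hI : 0 ≤ ∫ x, sechWeight a B x :=
        integral_nonneg fun x => by unfold sechWeight; positivity
      refine (LipschitzOnWith.of_dist_le_mul (K := ⟨_, hI⟩) fun x hx y hy => ?_).continuousOn
      have := hF y hy x hx
      rw [integral_const_mul, mul_comm] at this
      rw [dist_eq_norm, dist_eq_norm]
      exact this
    have k1 : ContinuousOn xdsechFam (sechRegion a B) := by
      refine key _ fun q hq q' hq' => LL.norm_one_le (hW.const_mul _) ?_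
      filter_upwards [Lp.coeFn_sub (xdsechFam q') (xdsechFam q),
        coeFn_xdsechFam (ha0.trans hq.1), coeFn_xdsechFam (ha0.trans hq'.1)] with x h1 h2 h3
      rw [h1, Pi.sub_apply, h2, h3, ← sub_mul, abs_mul]
      refine le_trans ?_ (sech_taylor (x := x) ha0 hq hq').1
      gcongr
      linarith
    have k2 : ContinuousOn dsechFam (sechRegion a B) := by
      refine key _ fun q hq q' hq' => LL.norm_one_le (hW.const_mul _) ?_
      filter_upwards [Lp.coeFn_sub (dsechFam q') (dsechFam q),
        coeFn_dsechFam (ha0.trans hq.1), coeFn_dsechFam (ha0.trans hq'.1)] with x h1 h2 h3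
      rw [h1, Pi.sub_apply, h2, h3]
      refine le_trans ?_ (sech_taylor (x := x) ha0 hq hq').1
      exact le_mul_of_one_le_right (abs_nonneg _) (by linarith [abs_nonneg x])
    have c1 : Continuous fun f : LL 1 => (ContinuousLinearMap.fst ℝ ℝ ℝ).smulRight f :=
      (ContinuousLinearMap.smulRightL ℝ (ℝ × ℝ) (LL 1) (ContinuousLinearMap.fst ℝ ℝ ℝ)).continuous
    have c2 : Continuous fun f : LL 1 => (ContinuousLinearMap.snd ℝ ℝ ℝ).smulRight f :=
      (ContinuousLinearMap.smulRightL ℝ (ℝ × ℝ) (LL 1) (ContinuousLinearMap.snd ℝ ℝ ℝ)).continuous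
    exact (c1.comp_continuousOn k1).sub (c2.comp_continuousOn k2)

/-! ### Convolution with an exponential kernel -/

/-- The exponential kernel. -/
noncomputable def expKer (c x y : ℝ) : ℝ≥0∞ := ENNReal.ofReal (Real.exp (-(c * |x - y|)))

theorem continuous_expKer (c : ℝ) : Continuous fun z : ℝ × ℝ => expKer c z.1 z.2 :=
  ENNReal.continuous_ofReal.comp (by fun_prop)

theorem lintegral_expKer (c x : ℝ) : ∫⁻ y, expKer c x y = ∫⁻ y, expKer c 0 y := by
  rw [← lintegral_add_right_eq_self _ x]
  simp [expKer]

theorem lintegral_expKer_left (c y : ℝ) : ∫⁻ x, expKer c x y = ∫⁻ y, expKer c 0 y := by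
  rw [← lintegral_expKer c y]
  simp [expKer, abs_sub_comm]

theorem lintegral_expKer_ne_top {c : ℝ} (hc : 0 < c) : ∫⁻ y, expKer c 0 y ≠ (∞ : ℝ≥0∞) := by
  have h := (integrable_exp_neg_mul_abs hc).lintegral_lt_top
  simpa [expKer] using h.ne

/-- Young's inequality for convolution with an integrable exponential. For `p = ∞` the mass of the
kernel suffices; for finite `p`, Jensen's inequality is combined with Tonelli's theorem and the
symmetry of the kernel. -/
theorem memLp_of_le_expKer {p : ℝ≥0∞} (hp1 : 1 ≤ p) {c : ℝ} (hc : 0 < c) {K : ℝ≥0∞}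
    (hK : K ≠ (∞ : ℝ≥0∞)) {f g : ℝ → ℝ} (hf : MemLp f p volume) (hg : AEStronglyMeasurable g volume)
    (h : ∀ x, ‖g x‖ₑ ≤ K * ∫⁻ y, expKer c x y * ‖f y‖ₑ) : MemLp g p volume := by
  set A : ℝ≥0∞ := ∫⁻ y, expKer c 0 y with hA
  have hA' : A ≠ (∞ : ℝ≥0∞) := lintegral_expKer_ne_top hc
  have hkm : ∀ x, Measurable fun y => expKer c x y := fun x =>
    ((continuous_expKer c).comp (by fun_prop : Continuous fun y : ℝ => (x, y))).measurable
  refine ⟨hg, ?_⟩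
  rcases eq_or_ne p ∞ with rfl | hp
  · rw [eLpNorm_exponent_top]
    refine lt_of_le_of_lt (essSup_le_of_ae_le (K * (A * eLpNorm f ∞ volume))
      (Eventually.of_forall fun x => (h x).trans ?_))
      (ENNReal.mul_lt_top hK.lt_top (ENNReal.mul_lt_top hA'.lt_top hf.2))
    refine mul_le_mul' le_rfl ?_
    rw [hA, ← lintegral_expKer c x, ← lintegral_mul_const _ (hkm x)]
    refine lintegral_mono_ae ?_
    filter_upwards [ae_le_eLpNormEssSup (f := f) (μ := (volume : Measure ℝ))] with y hy
    rw [eLpNorm_exponent_top]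
    gcongr
  · have hp0 : p ≠ 0 := (zero_lt_one.trans_le hp1).ne'
    set r := p.toReal with hr
    have hr1 : 1 ≤ r := by
      rw [hr, ← ENNReal.toReal_one]; exact ENNReal.toReal_mono hp hp1
    have hr0 : 0 < r := zero_lt_one.trans_le hr1
    -- Monotonicity of power means for the measure with density `expKer c x`, whose total mass `A`
    -- does not depend on `x`.
    have jensen : ∀ x, (∫⁻ y, expKer c x y * ‖f y‖ₑ) ^ r
        ≤ A ^ (r - 1) * ∫⁻ y, expKer c x y * ‖f y‖ₑ ^ r := by
      intro x
      have hfm : AEStronglyMeasurable f (volume.withDensity (expKer c x)) :=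
        hf.1.mono_ac (withDensity_absolutelyContinuous _ _)
      have h1 := eLpNorm'_le_eLpNorm'_mul_rpow_measure_univ zero_lt_one hr1 hfm
      have hu : (volume.withDensity (expKer c x)) univ = A := by
        rw [withDensity_apply _ MeasurableSet.univ, Measure.restrict_univ, lintegral_expKer]
      have hl : ∀ G : ℝ → ℝ≥0∞, AEMeasurable G volume →
          ∫⁻ y, G y ∂(volume.withDensity (expKer c x)) = ∫⁻ y, expKer c x y * G y := by
        intro G hG
        rw [lintegral_withDensity_eq_lintegral_mul₀ (hkm x).aemeasurable hG]
        rfl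
      rw [hu, eLpNorm', eLpNorm', hl _ (hf.1.enorm.pow_const _), hl _ (hf.1.enorm.pow_const _)]
        at h1
      simp only [ENNReal.rpow_one, one_div, inv_one] at h1
      refine (ENNReal.rpow_le_rpow h1 hr0.le).trans (le_of_eq ?_)
      rw [ENNReal.mul_rpow_of_nonneg _ _ hr0.le, ← ENNReal.rpow_mul, ← ENNReal.rpow_mul,
        inv_mul_cancel₀ hr0.ne', ENNReal.rpow_one, sub_mul, one_mul, inv_mul_cancel₀ hr0.ne',
        mul_comm]
    rw [eLpNorm_lt_top_iff_lintegral_rpow_enorm_lt_top hp0 hp]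
    have hfr : ∫⁻ y, ‖f y‖ₑ ^ r < (∞ : ℝ≥0∞) :=
      (eLpNorm_lt_top_iff_lintegral_rpow_enorm_lt_top hp0 hp).1 hf.2
    have hprod : AEMeasurable (Function.uncurry fun x y => expKer c x y * ‖f y‖ₑ ^ r)
        ((volume : Measure ℝ).prod volume) :=
      (continuous_expKer c).measurable.aemeasurable.mul (hf.1.enorm.pow_const r).comp_snd
    calc ∫⁻ x, ‖g x‖ₑ ^ r
        ≤ ∫⁻ x, K ^ r * (A ^ (r - 1) * ∫⁻ y, expKer c x y * ‖f y‖ₑ ^ r) := by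
          refine lintegral_mono fun x => ?_
          refine (ENNReal.rpow_le_rpow (h x) hr0.le).trans ?_
          rw [ENNReal.mul_rpow_of_nonneg _ _ hr0.le]
          gcongr
          exact jensen x
      _ = K ^ r * (A ^ (r - 1) * ∫⁻ x, ∫⁻ y, expKer c x y * ‖f y‖ₑ ^ r) := by
          rw [lintegral_const_mul' _ _ (ENNReal.rpow_ne_top_of_nonneg hr0.le hK),
            lintegral_const_mul' _ _ (ENNReal.rpow_ne_top_of_nonneg (by linarith) hA')]
      _ = K ^ r * (A ^ (r - 1) * (A * ∫⁻ y, ‖f y‖ₑ ^ r)) := by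
          rw [lintegral_lintegral_swap hprod]
          congr 2
          rw [← lintegral_const_mul' _ _ hA']
          refine lintegral_congr fun y => ?_
          rw [lintegral_mul_const, lintegral_expKer_left]
          exact ((continuous_expKer c).comp
            (by fun_prop : Continuous fun x : ℝ => (x, y))).measurable
      _ < (∞ : ℝ≥0∞) := by
          refine ENNReal.mul_lt_top (ENNReal.rpow_lt_top_of_nonneg hr0.le hK)
            (ENNReal.mul_lt_top (ENNReal.rpow_lt_top_of_nonneg (by linarith) hA')
              (ENNReal.mul_lt_top hA'.lt_top hfr))

/-- The hypothesis says that `x` lies between `0` and `y`. The growth `e^{c|x|}` and the decay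
`e^{-c|y|}` then combine into a convolution kernel, which bounds the solution formulas for both
linearized equations. -/
theorem cosh_mul_sech_le {c x y : ℝ} (hc : 0 < c) (h : |x - y| ≤ |y| - |x|) :
    Real.cosh (c * x) * sech (c * y) ≤ 2 * Real.exp (-(c * |x - y|)) := by
  have h1 : Real.cosh (c * x) ≤ Real.exp (c * |x|) := by
    rw [← Real.cosh_abs, abs_mul, abs_of_pos hc, Real.cosh_eq]
    have : Real.exp (-(c * |x|)) ≤ Real.exp (c * |x|) := Real.exp_le_exp.2 (by
      have := mul_nonneg hc.le (abs_nonneg x); linarith)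
    linarith
  have h2 := sech_le_exp (c * y)
  rw [abs_mul, abs_of_pos hc] at h2
  calc _ ≤ Real.exp (c * |x|) * (2 * Real.exp (-(c * |y|))) := by
        gcongr; exact (sech_pos _).le
    _ = 2 * Real.exp (c * |x| + -(c * |y|)) := by rw [Real.exp_add]; ring
    _ ≤ _ := by gcongr; nlinarith

theorem enorm_mul_setIntegral_le {c m x : ℝ} {F f : ℝ → ℝ} {s : Set ℝ} (hs : MeasurableSet s)
    (h : ∀ y ∈ s, |m| * |F y| ≤ 2 * Real.exp (-(c * |x - y|)) * |f y|) :
    ‖m * ∫ y in s, F y‖ₑ ≤ 2 * ∫⁻ y, expKer c x y * ‖f y‖ₑ := by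
  calc ‖m * ∫ y in s, F y‖ₑ = ‖∫ y in s, m * F y‖ₑ := by rw [integral_const_mul]
    _ ≤ ∫⁻ y in s, ‖m * F y‖ₑ := enorm_integral_le_lintegral_enorm _
    _ ≤ ∫⁻ y in s, 2 * (expKer c x y * ‖f y‖ₑ) := by
        refine setLIntegral_mono' hs fun y hy => ?_
        rw [← ofReal_norm, ← ofReal_norm, expKer,
          ← ENNReal.ofReal_mul (Real.exp_pos _).le, show (2 : ℝ≥0∞) = ENNReal.ofReal 2 by simp,
          ← ENNReal.ofReal_mul (by norm_num)]
        refine ENNReal.ofReal_le_ofReal ?_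
        rw [norm_mul, ← mul_assoc]
        exact h y hy
    _ ≤ ∫⁻ y, 2 * (expKer c x y * ‖f y‖ₑ) := setLIntegral_le_lintegral _ _
    _ = _ := lintegral_const_mul' _ _ (by simp)

/-! ### The linearized operators -/

section Linear

variable {p : ℝ≥0∞} [Fact (1 ≤ p)] {c : ℝ}

/-- `sech (c x)` in `L^p`. -/
noncomputable def sechLp (p : ℝ≥0∞) (c : ℝ) : LL p := mkLp p fun x => sech (c * x)

/-- `tanh (c x)` in `L^∞`. -/
noncomputable def tanhLp (c : ℝ) : LL ∞ := mkLp ∞ fun x => Real.tanh (c * x)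

theorem coeFn_sechLp (p : ℝ≥0∞) (hc : 0 < c) : sechLp p c =ᵐ[volume] fun x => sech (c * x) :=
  coeFn_mkLp (memLp_sech_mul p hc.ne')

theorem coeFn_tanhLp (c : ℝ) : tanhLp c =ᵐ[volume] fun x => Real.tanh (c * x) :=
  coeFn_mkLp (memLp_top_of_bound
    (continuous_tanh.comp (continuous_const_mul c)).aestronglyMeasurable 1
    (Eventually.of_forall fun _ => abs_tanh_le_one _))

theorem integrable_mul_sech (f : LL p) (hc : 0 < c) : Integrable fun x => f x * sech (c * x) := by
  have hq : ENNReal.HolderConjugate p (ENNReal.conjExponent p) := .conjExponent Fact.out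
  exact (Lp.memLp f).integrable_mul (memLp_sech_mul (ENNReal.conjExponent p) hc.ne')

theorem contDiff_sech_mul (c : ℝ) : ContDiff ℝ ∞ fun x => sech (c * x) :=
  contDiff_sech.comp (contDiff_const.mul contDiff_id)

theorem contDiff_cosh_mul (c : ℝ) : ContDiff ℝ ∞ fun x => Real.cosh (c * x) :=
  Real.contDiff_cosh.comp (contDiff_const.mul contDiff_id)

theorem deriv_sech_mul (c : ℝ) :
    deriv (fun x => sech (c * x)) = fun x => -(sech (c * x) * Real.tanh (c * x)) * c := by
  funext x
  exact ((hasDerivAt_sech (c * x)).comp x (by simpa using (hasDerivAt_id x).const_mul c)).deriv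

theorem deriv_cosh_mul (c : ℝ) :
    deriv (fun x => Real.cosh (c * x)) = fun x => Real.sinh (c * x) * c := by
  funext x
  exact ((Real.hasDerivAt_cosh (c * x)).comp x
    (by simpa using (hasDerivAt_id x).const_mul c)).deriv

theorem integrable_sech_sq (hc : 0 < c) : Integrable fun x => sech (c * x) * sech (c * x) :=
  (memLp_sech_mul 2 hc.ne').integrable_mul (memLp_sech_mul 2 hc.ne')

theorem integral_sech_sq_pos (hc : 0 < c) : 0 < ∫ x, sech (c * x) * sech (c * x) := by
  rw [integral_pos_iff_support_of_nonneg
    (fun x => (mul_pos (sech_pos _) (sech_pos _)).le) (integrable_sech_sq hc)]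
  have : Function.support (fun x => sech (c * x) * sech (c * x)) = univ :=
    eq_univ_of_forall fun x => (mul_pos (sech_pos _) (sech_pos _)).ne'
  simp [this]

theorem tendsto_sech_mul (hc : 0 < c) : Tendsto (fun x => sech (c * x)) atTop (𝓝 0) := by
  have h : Tendsto (fun x : ℝ => 2 * Real.exp (-(c * x))) atTop (𝓝 (2 * 0)) :=
    (Real.tendsto_exp_neg_atTop_nhds_zero.comp
      (tendsto_id.const_mul_atTop hc)).const_mul 2
  rw [mul_zero] at h
  refine squeeze_zero' (Eventually.of_forall fun x => (sech_pos _).le) ?_ h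
  filter_upwards [eventually_ge_atTop 0] with x hx
  have := sech_le_exp (c * x)
  rwa [abs_of_nonneg (mul_nonneg hc.le hx)] at this

theorem W1.exists_of_memLp {v g : ℝ → ℝ} (hv : MemLp v p volume) (hg : MemLp g p volume)
    (h : HasWeakDeriv v g) : ∃ u : W1 p, u.fn =ᵐ[volume] v ∧ u.dx =ᵐ[volume] g :=
  ⟨W1.mk (hv.toLp v) (hg.toLp g) (h.congr hv.coeFn_toLp.symm hg.coeFn_toLp.symm),
    hv.coeFn_toLp, hg.coeFn_toLp⟩

variable (p c) in
/-- The operator `(d, v) ↦ v_x - c tanh(c x) v - d sech(c x)`. -/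
noncomputable def opT : ℝ × W1 p →L[ℝ] LL p :=
  (W1.dxL p - c • (LL.mulL p (tanhLp c) ∘L W1.fnL p)) ∘L ContinuousLinearMap.snd ℝ ℝ (W1 p)
    - (ContinuousLinearMap.fst ℝ ℝ (W1 p)).smulRight (sechLp p c)

variable (p c) in
/-- The operator `u ↦ (u_x + c tanh(c x) u, ∫ u sech(c x))`. -/
noncomputable def opR : W1 p →L[ℝ] LL p × ℝ :=
  (W1.dxL p + c • (LL.mulL p (tanhLp c) ∘L W1.fnL p)).prod
    (LL.pairing.flip (sechLp 1 c) ∘L W1.supL p)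

theorem opT_apply (z : ℝ × W1 p) : opT p c z =
    z.2.dx - c • LL.mulL p (tanhLp c) z.2.fn - z.1 • sechLp p c := rfl

theorem opR_apply (u : W1 p) : opR p c u =
    (u.dx + c • LL.mulL p (tanhLp c) u.fn, LL.pairing (W1.supL p u) (sechLp 1 c)) := rfl

theorem coeFn_opT (hc : 0 < c) (z : ℝ × W1 p) : opT p c z =ᵐ[volume] fun x =>
    z.2.dx x - c * (Real.tanh (c * x) * z.2.fn x) - z.1 * sech (c * x) := by
  rw [opT_apply]
  filter_upwards [Lp.coeFn_sub (z.2.dx - c • LL.mulL p (tanhLp c) z.2.fn) (z.1 • sechLp p c),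
    Lp.coeFn_sub z.2.dx (c • LL.mulL p (tanhLp c) z.2.fn),
    Lp.coeFn_smul c (LL.mulL p (tanhLp c) z.2.fn), Lp.coeFn_smul z.1 (sechLp p c),
    LL.coeFn_mulL (tanhLp c) z.2.fn, coeFn_tanhLp c, coeFn_sechLp p hc]
    with x h1 h2 h3 h4 h5 h6 h7
  rw [h1, Pi.sub_apply, h2, Pi.sub_apply, h3, h4, Pi.smul_apply, Pi.smul_apply, h5, h6, h7]
  rfl

theorem coeFn_opR_fst (u : W1 p) : (opR p c u).1 =ᵐ[volume] fun x =>
    u.dx x + c * (Real.tanh (c * x) * u.fn x) := by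
  rw [opR_apply]
  filter_upwards [Lp.coeFn_add u.dx (c • LL.mulL p (tanhLp c) u.fn),
    Lp.coeFn_smul c (LL.mulL p (tanhLp c) u.fn), LL.coeFn_mulL (tanhLp c) u.fn,
    coeFn_tanhLp c] with x h1 h2 h3 h4
  rw [h1, Pi.add_apply, h2, Pi.smul_apply, h3, h4]
  rfl

theorem opR_snd (hc : 0 < c) (u : W1 p) :
    (opR p c u).2 = ∫ x, u.fn x * sech (c * x) := by
  rw [opR_apply, LL.pairing_apply]
  refine integral_congr_ae ?_
  filter_upwards [u.coeFn_supL, coeFn_sechLp 1 hc] with x h1 h2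
  rw [h1, h2]

/-- On the kernel, `(v sech)_x = d sech²`, so `v sech = k + (d/c) tanh`. As `v` is bounded, the left
side tends to zero at both ends, and `k + d/c = k - d/c = 0`. -/
theorem opT_injective (hc : 0 < c) : Function.Injective (opT p c) := by
  rw [injective_iff_map_eq_zero]
  rintro ⟨d, v⟩ h0
  have hv : v.dx =ᵐ[volume] fun x => c * (Real.tanh (c * x) * v.fn x) + d * sech (c * x) := by
    have h := coeFn_opT hc (d, v)
    rw [h0] at h
    filter_upwards [h, Lp.coeFn_zero ℝ p (volume : Measure ℝ)] with x h1 h2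
    rw [h2, Pi.zero_apply] at h1
    linarith
  have w1 := v.hasWeakDeriv.mul_smooth (contDiff_sech_mul c) v.fn.locallyIntegrable
    v.dx.locallyIntegrable
  have ht : ContDiff ℝ ∞ fun x => d / c * Real.tanh (c * x) :=
    contDiff_const.mul (contDiff_tanh.comp (contDiff_const.mul contDiff_id))
  have htd : deriv (fun x => d / c * Real.tanh (c * x)) = fun x => d * sech (c * x) ^ 2 := by
    funext x
    have h1 : HasDerivAt (fun x => Real.tanh (c * x)) (sech (c * x) ^ 2 * c) x :=
      (hasDerivAt_tanh (c * x)).comp x (by simpa using (hasDerivAt_id x).const_mul c)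
    rw [(h1.const_mul (d / c)).deriv]
    field_simp
  have w2 := hasWeakDeriv_of_contDiff ht
  have hsq : Continuous fun x => d * sech (c * x) ^ 2 :=
    continuous_const.mul ((contDiff_sech_mul c).continuous.pow 2)
  have w1' : HasWeakDeriv (fun x => v.fn x * sech (c * x)) fun x => d * sech (c * x) ^ 2 := by
    refine w1.congr (ae_eq_refl _) ?_
    filter_upwards [hv] with x hx
    rw [hx, deriv_sech_mul]
    ring
  have hl : LocallyIntegrable fun x => v.fn x * sech (c * x) :=
    (integrable_mul_sech v.fn hc).locallyIntegrable
  rw [htd] at w2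
  have w3 := w1'.sub w2 hl hsq.locallyIntegrable ht.continuous.locallyIntegrable
    hsq.locallyIntegrable
  simp only [sub_self] at w3
  obtain ⟨k, hk⟩ := HasWeakDeriv.exists_ae_eq_const
    (hl.sub ht.continuous.locallyIntegrable) w3
  -- The inequality holds almost everywhere and both sides are continuous; a set of full measure is
  -- dense, so it holds everywhere.
  have hall : ∀ x, |k + d / c * Real.tanh (c * x)| ≤ ‖v‖ * sech (c * x) := by
    have hcl : IsClosed {x | |k + d / c * Real.tanh (c * x)| ≤ ‖v‖ * sech (c * x)} :=
      isClosed_le (continuous_const.add ht.continuous).abs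
        (continuous_const.mul (contDiff_sech_mul c).continuous)
    have hae : ∀ᵐ x, x ∈ {x | |k + d / c * Real.tanh (c * x)| ≤ ‖v‖ * sech (c * x)} := by
      filter_upwards [hk, v.ae_abs_le] with x h1 h2
      have h1' : v.fn x * sech (c * x) - d / c * Real.tanh (c * x) = k := h1
      have e : k + d / c * Real.tanh (c * x) = v.fn x * sech (c * x) := by linarith
      change |k + d / c * Real.tanh (c * x)| ≤ ‖v‖ * sech (c * x)
      rw [e, abs_mul, abs_of_pos (sech_pos _)]
      exact mul_le_mul_of_nonneg_right h2 (sech_pos _).le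
    have hx := (Measure.dense_of_ae hae).closure_eq
    intro x
    exact hcl.closure_subset (hx ▸ mem_univ x)
  have hs := tendsto_sech_mul hc
  -- Combining the bounds at `x` and `-x` removes the odd term `tanh`.
  have hk0 : k = 0 := by
    have h1 : ∀ x, |k| ≤ ‖v‖ * sech (c * x) := by
      intro x
      have a1 := abs_le.1 (hall x)
      have a2 := abs_le.1 (hall (-x))
      rw [mul_neg, Real.tanh_neg, sech_neg] at a2
      exact abs_le.2 ⟨by linarith [a1.1, a2.1], by linarith [a1.2, a2.2]⟩
    have h2 : |k| ≤ ‖v‖ * 0 := ge_of_tendsto' (hs.const_mul ‖v‖) h1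
    rw [mul_zero] at h2
    exact abs_nonpos_iff.1 h2
  have hd0 : d = 0 := by
    -- This is the square of `hall` after substituting `tanh² = 1 - sech²`; the right side vanishes
    -- at infinity.
    have h1 : ∀ x, (d / c) ^ 2 ≤ (‖v‖ ^ 2 + (d / c) ^ 2) * (sech (c * x) * sech (c * x)) := by
      intro x
      have a := hall x
      rw [hk0, zero_add] at a
      have a2 := pow_le_pow_left₀ (abs_nonneg _) a 2
      rw [sq_abs, mul_pow, mul_pow] at a2
      have a3 := sech_sq_add_tanh_sq (c * x)
      nlinarith
    have h2 := ge_of_tendsto' ((hs.mul hs).const_mul (‖v‖ ^ 2 + (d / c) ^ 2)) h1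
    have h3 : (d / c) ^ 2 = 0 := le_antisymm (by simpa using h2) (sq_nonneg _)
    have h4 : d / c = 0 := by simpa using h3
    rcases div_eq_zero_iff.1 h4 with h | h
    · exact h
    · exact absurd h hc.ne'
  have hv0 : v = 0 := by
    apply W1.fn_injective
    apply Lp.ext
    change v.fn =ᵐ[volume] (0 : LL p)
    filter_upwards [hk, Lp.coeFn_zero ℝ p (volume : Measure ℝ)] with x h1 h2
    have h1' : v.fn x * sech (c * x) - d / c * Real.tanh (c * x) = k := h1
    rw [hk0, hd0] at h1'
    simp only [zero_div, zero_mul, sub_zero] at h1'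
    rw [h2]
    exact (mul_eq_zero.1 h1').resolve_right (sech_pos _).ne'
  rw [hd0, hv0]
  rfl

/-- The equation `v_x - c tanh(c x) v = h` is solved by `cosh(c x)` times a primitive of `h sech`.
Avoiding growth at both ends requires `∫ h sech = 0`, and `d` is chosen to ensure it, with `h = f +
d sech`. -/
theorem opT_surjective (hc : 0 < c) : Function.Surjective (opT p c) := by
  intro f
  set D : ℝ := ∫ x, sech (c * x) * sech (c * x) with hD
  have hDpos : 0 < D := integral_sech_sq_pos hc
  set d : ℝ := -(∫ x, f x * sech (c * x)) / D with hd
  have hhm : MemLp (fun x => f x + d * sech (c * x)) p volume :=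
    (Lp.memLp f).add ((memLp_sech_mul p hc.ne').const_mul d)
  set h : ℝ → ℝ := fun x => f x + d * sech (c * x) with hh
  have hli : LocallyIntegrable h := hhm.locallyIntegrable Fact.out
  have hint : Integrable fun x => h x * sech (c * x) := by
    have := (integrable_mul_sech f hc).add ((integrable_sech_sq hc).const_mul d)
    refine this.congr (Eventually.of_forall fun x => ?_)
    simp only [hh, Pi.add_apply]; ring
  have hzero : ∫ x, h x * sech (c * x) = 0 := by
    have e : ∫ x, h x * sech (c * x)
        = (∫ x, f x * sech (c * x)) + d * ∫ x, sech (c * x) * sech (c * x) := by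
      rw [← integral_const_mul, ← integral_add (integrable_mul_sech f hc)
        ((integrable_sech_sq hc).const_mul d)]
      refine integral_congr_ae (Eventually.of_forall fun x => ?_)
      simp only [hh]; ring
    rw [e, ← hD, hd, div_mul_cancel₀ _ hDpos.ne']
    ring
  -- A constant plus a primitive from `0`, the shape required by `hasWeakDeriv_integral`; by the
  -- zero mean it is the integral from either end, up to sign.
  set W : ℝ → ℝ := fun x => (∫ t in Iic (0 : ℝ), h t * sech (c * t))
    + ∫ t in (0 : ℝ)..x, h t * sech (c * t) with hW
  have hWI : ∀ x, W x = ∫ t in Iic x, h t * sech (c * t) := by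
    intro x
    simp only [hW]
    rw [← intervalIntegral.integral_Iic_sub_Iic hint.integrableOn hint.integrableOn]
    ring
  have hWJ : ∀ x, W x = -∫ t in Ioi x, h t * sech (c * t) := by
    intro x
    have := intervalIntegral.integral_Iic_add_Ioi (b := x) (μ := volume)
      hint.integrableOn hint.integrableOn
    rw [hzero] at this
    rw [hWI]
    linarith
  have hWc : Continuous W := continuous_const.add
    (intervalIntegral.continuous_primitive (fun a b => hint.intervalIntegrable) 0)
  have w1 := (hasWeakDeriv_integral hint.locallyIntegrable
    (∫ t in Iic (0 : ℝ), h t * sech (c * t))).mul_smooth (contDiff_cosh_mul c)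
    hWc.locallyIntegrable hint.locallyIntegrable
  have w2 : HasWeakDeriv (fun x => W x * Real.cosh (c * x)) fun x =>
      h x + c * (Real.tanh (c * x) * (W x * Real.cosh (c * x))) := by
    refine w1.congr (ae_eq_refl _) (Eventually.of_forall fun x => ?_)
    have e := cosh_mul_sech (c * x)
    simp only [deriv_cosh_mul, Real.tanh_eq_sinh_div_cosh]
    have := (Real.cosh_pos (c * x)).ne'
    field_simp
    linear_combination h x * e
  have hcont : Continuous fun x => W x * Real.cosh (c * x) :=
    hWc.mul (contDiff_cosh_mul c).continuous
  have hvm : MemLp (fun x => W x * Real.cosh (c * x)) p volume := by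
    refine memLp_of_le_expKer Fact.out hc (K := 2) (by simp) hhm hcont.aestronglyMeasurable
      fun x => ?_
    have kb : ∀ y, |x - y| ≤ |y| - |x| → |Real.cosh (c * x)| * |h y * sech (c * y)|
        ≤ 2 * Real.exp (-(c * |x - y|)) * |h y| := by
      intro y hy
      rw [abs_mul, abs_of_pos (Real.cosh_pos _), abs_of_pos (sech_pos _)]
      have := mul_le_mul_of_nonneg_right (cosh_mul_sech_le hc hy) (abs_nonneg (h y))
      linarith
    -- Integrating over `(-∞, x]` when `x ≤ 0` and over `(x, ∞)` when `x ≥ 0` keeps `x` between `0`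
    -- and `y`, as `cosh_mul_sech_le` requires.
    rcases le_total x 0 with hx | hx
    · rw [hWI, mul_comm]
      refine enorm_mul_setIntegral_le measurableSet_Iic fun y hy => kb y ?_
      have hy' : y ≤ x := hy
      rw [abs_of_nonneg (by linarith : 0 ≤ x - y), abs_of_nonpos hx, abs_of_nonpos (by linarith)]
      linarith
    · rw [hWJ, mul_comm, mul_neg, enorm_neg]
      refine enorm_mul_setIntegral_le measurableSet_Ioi fun y hy => kb y ?_
      have hy' : x < y := hy
      rw [abs_of_nonpos (by linarith : x - y ≤ 0), abs_of_nonneg hx, abs_of_nonneg (by linarith)]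
      linarith
  have htm : MemLp (fun x => Real.tanh (c * x)) ∞ volume :=
    memLp_top_of_bound (continuous_tanh.comp (continuous_const_mul c)).aestronglyMeasurable 1
      (Eventually.of_forall fun _ => abs_tanh_le_one _)
  have hgm : MemLp (fun x => h x + c * (Real.tanh (c * x) * (W x * Real.cosh (c * x)))) p
      volume := hhm.add ((hvm.mul htm).const_mul c)
  obtain ⟨v, hv1, hv2⟩ := W1.exists_of_memLp hvm hgm w2
  refine ⟨(d, v), ?_⟩
  apply Lp.ext
  filter_upwards [coeFn_opT hc (d, v), hv1, hv2] with x h1 h2 h3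
  rw [h1, h2, h3]
  simp only [hh]
  ring

/-- With integrating factor `cosh`, the homogeneous equation has only the solutions `k sech`, and
the pairing with `sech` is nonzero on them unless `k = 0`. -/
theorem opR_injective (hc : 0 < c) : Function.Injective (opR p c) := by
  rw [injective_iff_map_eq_zero]
  intro u h0
  have hu : u.dx =ᵐ[volume] fun x => -(c * (Real.tanh (c * x) * u.fn x)) := by
    have h := coeFn_opR_fst (c := c) u
    rw [h0] at h
    filter_upwards [h, Lp.coeFn_zero ℝ p (volume : Measure ℝ)] with x h1 h2
    simp only [Prod.fst_zero] at h1
    rw [h2, Pi.zero_apply] at h1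
    linarith
  have w1 := u.hasWeakDeriv.mul_smooth (contDiff_cosh_mul c) u.fn.locallyIntegrable
    u.dx.locallyIntegrable
  have w2 : HasWeakDeriv (fun x => u.fn x * Real.cosh (c * x)) 0 := by
    refine w1.congr (ae_eq_refl _) ?_
    filter_upwards [hu] with x hx
    rw [hx, deriv_cosh_mul, Real.tanh_eq_sinh_div_cosh, Pi.zero_apply]
    have := (Real.cosh_pos (c * x)).ne'
    field_simp
    ring
  have hl : LocallyIntegrable fun x => u.fn x * Real.cosh (c * x) := by
    have := (u.fn.locallyIntegrable.locallyIntegrableOn univ).mul_continuousOn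
      (contDiff_cosh_mul c).continuous.continuousOn isOpen_univ.isLocallyClosed
    exact locallyIntegrableOn_univ.1 this
  obtain ⟨k, hk⟩ := HasWeakDeriv.exists_ae_eq_const hl w2
  have hk' : ∀ᵐ x, u.fn x = k * sech (c * x) := by
    filter_upwards [hk] with x hx
    rw [← hx, mul_assoc, cosh_mul_sech, mul_one]
  have h2 := opR_snd hc u
  rw [h0, Prod.snd_zero] at h2
  have h3 : ∫ x, u.fn x * sech (c * x) = k * ∫ x, sech (c * x) * sech (c * x) := by
    rw [← integral_const_mul]
    refine integral_congr_ae ?_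
    filter_upwards [hk'] with x hx
    rw [hx, mul_assoc]
  have hk0 : k = 0 := by
    rw [h3] at h2
    exact (mul_eq_zero.1 h2.symm).resolve_right (integral_sech_sq_pos hc).ne'
  apply W1.fn_injective
  apply Lp.ext
  change u.fn =ᵐ[volume] (0 : LL p)
  filter_upwards [hk', Lp.coeFn_zero ℝ p (volume : Measure ℝ)] with x h1 h2
  rw [h1, h2, hk0, zero_mul, Pi.zero_apply]

/-- The solution `sech(c x) ∫₀ˣ f cosh` involves only `y` between `0` and `x`, so the exponential
kernel controls it in `L^p` with no condition on `f`. Adding a multiple of `sech` keeps the equation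
and adjusts the prescribed integral. -/
theorem opR_surjective (hc : 0 < c) : Function.Surjective (opR p c) := by
  rintro ⟨f, m⟩
  have hli : LocallyIntegrable fun x => f x * Real.cosh (c * x) := by
    have := (f.locallyIntegrable.locallyIntegrableOn univ).mul_continuousOn
      (contDiff_cosh_mul c).continuous.continuousOn isOpen_univ.isLocallyClosed
    exact locallyIntegrableOn_univ.1 this
  set W : ℝ → ℝ := fun x => 0 + ∫ t in (0 : ℝ)..x, f t * Real.cosh (c * t) with hW
  have hWc : Continuous W := continuous_const.add (intervalIntegral.continuous_primitive
    (fun a b => (hli.integrableOn_isCompact isCompact_uIcc).intervalIntegrable) 0)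
  have hgc : Continuous fun x => W x * sech (c * x) := hWc.mul (contDiff_sech_mul c).continuous
  have hgm : MemLp (fun x => W x * sech (c * x)) p volume := by
    refine memLp_of_le_expKer Fact.out hc (K := 2) (by simp) (Lp.memLp f)
      hgc.aestronglyMeasurable fun x => ?_
    have e : ‖W x * sech (c * x)‖ₑ
        = ‖sech (c * x) * ∫ t in uIoc 0 x, f t * Real.cosh (c * t)‖ₑ := by
      rw [← ofReal_norm, ← ofReal_norm, norm_mul, norm_mul, mul_comm]
      simp only [hW]
      rw [zero_add, intervalIntegral.norm_intervalIntegral_eq]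
    rw [e]
    refine enorm_mul_setIntegral_le measurableSet_uIoc fun y hy => ?_
    have hxy : |y - x| ≤ |x| - |y| := by
      rcases le_total 0 x with hx | hx
      · rw [uIoc_of_le hx] at hy
        rw [abs_of_nonpos (by linarith [hy.2]), abs_of_nonneg hx, abs_of_nonneg hy.1.le]
        linarith
      · rw [uIoc_of_ge hx] at hy
        rw [abs_of_nonneg (by linarith [hy.1]), abs_of_nonpos hx, abs_of_nonpos hy.2]
        linarith
    have := mul_le_mul_of_nonneg_right (cosh_mul_sech_le hc hxy) (abs_nonneg (f y))
    rw [abs_sub_comm] at this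
    rw [abs_mul, abs_of_pos (Real.cosh_pos _), abs_of_pos (sech_pos _)]
    linarith
  set D : ℝ := ∫ x, sech (c * x) * sech (c * x) with hD
  have hDpos : 0 < D := integral_sech_sq_pos hc
  have hgi : Integrable fun x => W x * sech (c * x) * sech (c * x) := by
    have hq : ENNReal.HolderConjugate p (ENNReal.conjExponent p) := .conjExponent Fact.out
    exact hgm.integrable_mul (memLp_sech_mul (ENNReal.conjExponent p) hc.ne')
  -- The multiple of `sech` that corrects the integral of the particular solution to `m`.
  set k : ℝ := (m - ∫ x, W x * sech (c * x) * sech (c * x)) / D with hk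
  set V : ℝ → ℝ := fun x => k + ∫ t in (0 : ℝ)..x, f t * Real.cosh (c * t) with hV
  have hVW : ∀ x, V x = k + W x := fun x => by simp [hV, hW]
  have hVc : Continuous V := by
    have : V = fun x => k + W x := funext hVW
    rw [this]
    exact continuous_const.add hWc
  have hvm : MemLp (fun x => V x * sech (c * x)) p volume := by
    refine (((memLp_sech_mul p hc.ne').const_mul k).add hgm).ae_eq
      (Eventually.of_forall fun x => ?_)
    simp only [Pi.add_apply, hVW]
    ring
  have w1 := (hasWeakDeriv_integral hli k).mul_smooth (contDiff_sech_mul c)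
    hVc.locallyIntegrable hli
  have w2 : HasWeakDeriv (fun x => V x * sech (c * x)) fun x =>
      f x - c * (Real.tanh (c * x) * (V x * sech (c * x))) := by
    refine w1.congr (ae_eq_refl _) (Eventually.of_forall fun x => ?_)
    have e := cosh_mul_sech (c * x)
    simp only [deriv_sech_mul]
    linear_combination f x * e
  have htm : MemLp (fun x => Real.tanh (c * x)) ∞ volume :=
    memLp_top_of_bound (continuous_tanh.comp (continuous_const_mul c)).aestronglyMeasurable 1
      (Eventually.of_forall fun _ => abs_tanh_le_one _)
  have hdm : MemLp (fun x => f x - c * (Real.tanh (c * x) * (V x * sech (c * x)))) p volume :=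
    (Lp.memLp f).sub ((hvm.mul htm).const_mul c)
  obtain ⟨u, hu1, hu2⟩ := W1.exists_of_memLp hvm hdm w2
  refine ⟨u, Prod.ext ?_ ?_⟩
  · apply Lp.ext
    filter_upwards [coeFn_opR_fst (c := c) u, hu1, hu2] with x h1 h2 h3
    rw [h1, h2, h3]
    ring
  · rw [opR_snd hc]
    have e : ∫ x, u.fn x * sech (c * x) = k * D + ∫ x, W x * sech (c * x) * sech (c * x) := by
      rw [hD, ← integral_const_mul, ← integral_add ((integrable_sech_sq hc).const_mul k) hgi]
      refine integral_congr_ae ?_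
      filter_upwards [hu1] with x hx
      rw [hx, hVW]
      ring
    rw [e, hk, div_mul_cancel₀ _ hDpos.ne']
    ring

end Linear

/-! ### The kink profile -/

/-- The profile `4 arctan (e^{c x})` of a kink. -/
noncomputable def profile (c x : ℝ) : ℝ := 4 * Real.arctan (Real.exp (c * x))

theorem continuous_profile (c : ℝ) : Continuous (profile c) :=
  continuous_const.mul (Real.continuous_arctan.comp (Real.continuous_exp.comp
    (continuous_const_mul c)))

theorem hasDerivAt_profile (c x : ℝ) : HasDerivAt (profile c) (2 * c * sech (c * x)) x := by
  have h := ((hasDerivAt_arctan_exp (c * x)).comp x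
    (by simpa using (hasDerivAt_id x).const_mul c)).const_mul 2
  refine (h.congr_deriv (by ring)).congr_of_eventuallyEq (Eventually.of_forall fun x => ?_)
  simp only [profile, Function.comp_apply]
  ring

theorem kink_eq_profile (β x₀ t x : ℝ) :
    kink β x₀ t x = profile (lorentz β) (x - β * t - x₀) := rfl

theorem deriv_kink_space (β x₀ t x : ℝ) : deriv (fun z => kink β x₀ t z) x
    = 2 * lorentz β * sech (lorentz β * (x - β * t - x₀)) := by
  have h := (hasDerivAt_profile (lorentz β) (x - β * t - x₀)).comp x
    (((hasDerivAt_id x).sub_const (β * t)).sub_const x₀)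
  rw [mul_one] at h
  exact h.deriv

theorem deriv_kink_time (β x₀ t x : ℝ) : deriv (fun s => kink β x₀ s x) t
    = -(2 * β * lorentz β * sech (lorentz β * (x - β * t - x₀))) := by
  have h := (hasDerivAt_profile (lorentz β) (x - β * t - x₀)).comp t
    ((((hasDerivAt_id t).const_mul β).const_sub x).sub_const x₀)
  refine h.deriv.trans ?_
  ring

theorem sin_half_profile (c x : ℝ) : Real.sin (profile c x / 2) = sech (c * x) := by
  rw [profile, show 4 * Real.arctan (Real.exp (c * x)) / 2
    = 2 * Real.arctan (Real.exp (c * x)) by ring, Real.sin_two_mul, Real.sin_arctan,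
    Real.cos_arctan, sech, Real.cosh_eq, Real.exp_neg]
  have h := Real.exp_pos (c * x)
  have h1 : √(1 + Real.exp (c * x) ^ 2) ^ 2 = 1 + Real.exp (c * x) ^ 2 :=
    Real.sq_sqrt (by positivity)
  have h2 : 0 < √(1 + Real.exp (c * x) ^ 2) := Real.sqrt_pos.2 (by positivity)
  field_simp
  rw [h1]
  ring

theorem cos_half_profile (c x : ℝ) : Real.cos (profile c x / 2) = -Real.tanh (c * x) := by
  rw [profile, show 4 * Real.arctan (Real.exp (c * x)) / 2
    = 2 * Real.arctan (Real.exp (c * x)) by ring, Real.cos_two_mul, Real.cos_sq_arctan,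
    Real.tanh_eq_sinh_div_cosh, Real.cosh_eq, Real.sinh_eq, Real.exp_neg]
  have h := Real.exp_pos (c * x)
  field_simp
  ring

theorem abs_profile_le (c x : ℝ) : |profile c x| ≤ 2 * Real.pi := by
  have h1 := Real.arctan_lt_pi_div_two (Real.exp (c * x))
  have h2 := Real.arctan_pos.2 (Real.exp_pos (c * x))
  rw [profile, abs_of_pos (by linarith)]
  linarith

/-- The kink profile in `L^∞`. -/
noncomputable def profileLp (c : ℝ) : LL ∞ := mkLp ∞ (profile c)

theorem memLp_profile (c : ℝ) : MemLp (profile c) ∞ volume :=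
  memLp_top_of_bound (continuous_profile c).aestronglyMeasurable (2 * Real.pi)
    (Eventually.of_forall fun x => abs_profile_le c x)

theorem coeFn_profileLp (c : ℝ) : profileLp c =ᵐ[volume] profile c := coeFn_mkLp (memLp_profile c)

theorem tendsto_arctan_exp_atTop :
    Tendsto (fun x => 2 * Real.arctan (Real.exp x)) atTop (𝓝 Real.pi) := by
  have : Tendsto (fun x => 2 * Real.arctan (Real.exp x)) atTop (𝓝 (2 * (Real.pi / 2))) :=
    ((Real.tendsto_arctan_atTop.mono_right nhdsWithin_le_nhds).comp
      Real.tendsto_exp_atTop).const_mul 2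
  simpa [mul_div_cancel₀] using this

theorem tendsto_arctan_exp_atBot :
    Tendsto (fun x => 2 * Real.arctan (Real.exp x)) atBot (𝓝 0) := by
  have : Tendsto (fun x => 2 * Real.arctan (Real.exp x)) atBot (𝓝 (2 * Real.arctan 0)) :=
    ((Real.continuous_arctan.tendsto 0).comp Real.tendsto_exp_atBot).const_mul 2
  simpa using this

theorem integrable_profile_mul {f : ℝ → ℝ} (hf : Integrable f) (c : ℝ) :
    Integrable fun x => profile c x * f x :=
  hf.bdd_mul (continuous_profile c).aestronglyMeasurable
    (Eventually.of_forall fun x => abs_profile_le c x)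

/-- At `c = 1` the integrand is the derivative of `(2 arctan e^x)²`, which rises from `0` to `π²`;
the general case is scaling. This is why the unperturbed kink satisfies the orthogonality condition.
-/
theorem integral_profile_mul_sech {c : ℝ} (hc : 0 < c) :
    ∫ x, profile c x * sech (c * x) = Real.pi ^ 2 / c := by
  have h1 : ∫ x, profile 1 x * sech x = Real.pi ^ 2 := by
    have h := integral_of_hasDerivAt_of_tendsto (f := fun x => (2 * Real.arctan (Real.exp x)) ^ 2)
      (f' := fun x => profile 1 x * sech x) (fun x => ?_)
      (integrable_profile_mul integrable_sech 1) (tendsto_arctan_exp_atBot.pow 2)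
      (tendsto_arctan_exp_atTop.pow 2)
    · simpa using h
    · refine ((hasDerivAt_arctan_exp x).fun_pow 2).congr_deriv ?_
      simp only [profile, one_mul]
      push_cast
      ring
  have h2 := Measure.integral_comp_mul_left (fun x => profile 1 x * sech x) c
  rw [h1, abs_of_pos (inv_pos.2 hc), smul_eq_mul] at h2
  simp only [profile, one_mul] at h2 ⊢
  rw [h2]
  field_simp

theorem tendsto_sech_atTop : Tendsto sech atTop (𝓝 0) := by
  simpa using tendsto_sech_mul one_pos

theorem tendsto_sech_atBot : Tendsto sech atBot (𝓝 0) := by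
  have := tendsto_sech_atTop.comp tendsto_neg_atBot_atTop
  refine this.congr fun x => ?_
  simp [sech_neg]

/-- Integration by parts turns the integral at `c = 1` into `2 ∫ sech²`. Its positivity is the
nondegeneracy of the orthogonality condition in `y`. -/
theorem integral_profile_mul_sech_tanh_pos {c : ℝ} (hc : 0 < c) :
    0 < ∫ x, profile c x * (sech (c * x) * Real.tanh (c * x)) := by
  have i1 : Integrable fun x => sech x * Real.tanh x := by
    refine integrable_sech.mono' (continuous_sech.mul continuous_tanh).aestronglyMeasurable
      (Eventually.of_forall fun x => ?_)
    rw [Real.norm_eq_abs, ← abs_neg]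
    exact abs_deriv_sech_le x
  have i2 : Integrable fun x => sech x * sech x := by simpa using integrable_sech_sq one_pos
  have i3 := integrable_profile_mul i1 1
  have h1 : ∫ x, profile 1 x * (sech x * Real.tanh x) = 2 * ∫ x, sech x * sech x := by
    have hb : ∀ l : Filter ℝ, Tendsto sech l (𝓝 0) →
        Tendsto (fun x => profile 1 x * -sech x) l (𝓝 0) := by
      intro l hl
      refine squeeze_zero_norm (a := fun x => 2 * Real.pi * sech x) (fun x => ?_) ?_
      · rw [norm_mul, norm_neg, Real.norm_eq_abs, Real.norm_eq_abs, abs_of_pos (sech_pos x)]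
        exact mul_le_mul_of_nonneg_right (abs_profile_le 1 x) (sech_pos x).le
      · simpa using hl.const_mul (2 * Real.pi)
    have h := integral_of_hasDerivAt_of_tendsto (f := fun x => profile 1 x * -sech x)
      (f' := fun x => profile 1 x * (sech x * Real.tanh x) - 2 * (sech x * sech x)) (fun x => ?_)
      (i3.sub (i2.const_mul 2)) (hb _ tendsto_sech_atBot) (hb _ tendsto_sech_atTop)
    · rw [integral_sub i3 (i2.const_mul 2), integral_const_mul] at h
      linarith
    · refine ((hasDerivAt_profile 1 x).fun_mul (hasDerivAt_sech x).fun_neg).congr_deriv ?_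
      rw [one_mul]
      ring
  have h2 := Measure.integral_comp_mul_left (fun x => profile 1 x * (sech x * Real.tanh x)) c
  rw [h1, abs_of_pos (inv_pos.2 hc), smul_eq_mul] at h2
  simp only [profile, one_mul] at h2 ⊢
  rw [h2]
  have := integral_sech_sq_pos one_pos
  simp only [one_mul] at this
  positivity

/-! ### Parameters -/

theorem param_pos {β : ℝ} (hβ : β ∈ Ioo (-1 : ℝ) 1) : 0 < param β :=
  Real.sqrt_pos.2 (div_pos (by linarith [hβ.1]) (by linarith [hβ.2]))

theorem lorentz_of_param {a : ℝ} (ha : 0 < a) :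
    lorentz ((a ^ 2 - 1) / (a ^ 2 + 1)) = (a⁻¹ + a) / 2 := by
  have h : 1 - ((a ^ 2 - 1) / (a ^ 2 + 1)) ^ 2 = (2 * a / (a ^ 2 + 1)) ^ 2 := by
    field_simp
    ring
  rw [lorentz, h, Real.sqrt_sq (by positivity)]
  field_simp
  ring

theorem velocity_param {β : ℝ} (hβ : β ∈ Ioo (-1 : ℝ) 1) :
    (param β ^ 2 - 1) / (param β ^ 2 + 1) = β := by
  have h1 : 0 < 1 + β := by linarith [hβ.1]
  have h2 : 0 < 1 - β := by linarith [hβ.2]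
  rw [param, Real.sq_sqrt (div_pos h1 h2).le]
  field_simp
  ring

theorem lorentz_eq {β : ℝ} (hβ : β ∈ Ioo (-1 : ℝ) 1) :
    lorentz β = ((param β)⁻¹ + param β) / 2 := by
  rw [← lorentz_of_param (param_pos hβ), velocity_param hβ]

/-- Together with `lorentz_eq` this writes `Q_x` and `Q_t` as `(a₀⁻¹ + a₀) sech` and `(a₀⁻¹ - a₀)
sech`, the same combinations that multiply `sin (Q/2)` in the two equations. -/
theorem velocity_mul_lorentz {β : ℝ} (hβ : β ∈ Ioo (-1 : ℝ) 1) :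
    2 * β * lorentz β = param β - (param β)⁻¹ := by
  have h := velocity_param hβ
  have ha := param_pos hβ
  rw [lorentz_eq hβ]
  nth_rewrite 1 [← h]
  field_simp
  ring

theorem lorentz_pos {β : ℝ} (hβ : β ∈ Ioo (-1 : ℝ) 1) : 0 < lorentz β := by
  rw [lorentz_eq hβ]
  have := param_pos hβ
  positivity

theorem lorentzAt_eq {β δ : ℝ} (hδ : -param β < δ) :
    lorentzAt β δ = ((param β + δ)⁻¹ + (param β + δ)) / 2 :=
  lorentz_of_param (a := param β + δ) (by linarith)

theorem lorentzAt_pos {β δ : ℝ} (hδ : -param β < δ) : 0 < lorentzAt β δ := by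
  rw [lorentzAt_eq hδ]
  have : 0 < param β + δ := by linarith
  positivity

/-! ### The nonlinear terms -/

section Nonlinear

variable {p : ℝ≥0∞} [Fact (1 ≤ p)] {X : Type*} [NormedAddCommGroup X] [NormedSpace ℝ X]

/-- The nonlinear part of the Bäcklund transform, for `ε = ±1` and a space `X ↪ L^p`. -/
noncomputable def nonlin (β₀ ε : ℝ) (J : X →L[ℝ] LL p) (q : ℝ × X × X) : LL p :=
  (paramAt β₀ q.1)⁻¹ • sinShift p (profile (lorentz β₀)) (J (q.2.2 + q.2.1))
    + (ε * paramAt β₀ q.1) • sinShift p (profile (lorentz β₀)) (J (q.2.2 - q.2.1))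
    + ((paramAt β₀ q.1)⁻¹ + ε * paramAt β₀ q.1 - (param β₀)⁻¹ - ε * param β₀)
      • sechLp p (lorentz β₀)

/-- Half of the multiplication by `cos (Q/2)`. -/
noncomputable def cosMul (β₀ : ℝ) (J : X →L[ℝ] LL p) : X →L[ℝ] LL p :=
  LL.mulL p (cosShift (profile (lorentz β₀)) 0) ∘L J

/-- The derivative of `nonlin` at the origin. -/
noncomputable def nonlinDeriv (β₀ ε : ℝ) (J : X →L[ℝ] LL p) : ℝ × X × X →L[ℝ] LL p :=
  (param β₀)⁻¹ • (cosMul β₀ J ∘L (ContinuousLinearMap.snd ℝ X X + ContinuousLinearMap.fst ℝ X X)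
      ∘L ContinuousLinearMap.snd ℝ ℝ (X × X))
    + (ε * param β₀) • (cosMul β₀ J ∘L
      (ContinuousLinearMap.snd ℝ X X - ContinuousLinearMap.fst ℝ X X)
      ∘L ContinuousLinearMap.snd ℝ ℝ (X × X))
    + (ContinuousLinearMap.fst ℝ ℝ (X × X)).smulRight
      ((ε - ((param β₀) ^ 2)⁻¹) • sechLp p (lorentz β₀))

theorem nonlinDeriv_apply (β₀ ε : ℝ) (J : X →L[ℝ] LL p) (q : ℝ × X × X) :
    nonlinDeriv β₀ ε J q = (param β₀)⁻¹ • cosMul β₀ J (q.2.2 + q.2.1)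
      + (ε * param β₀) • cosMul β₀ J (q.2.2 - q.2.1)
      + q.1 • (ε - ((param β₀) ^ 2)⁻¹) • sechLp p (lorentz β₀) := rfl

theorem nonlin_zero (β₀ ε : ℝ) (J : X →L[ℝ] LL p) : nonlin β₀ ε J 0 = 0 := by
  simp [nonlin, sinShift_zero (continuous_profile _), paramAt]

theorem contDiffAt_nonlin {β₀ : ℝ} (hβ : β₀ ∈ Ioo (-1 : ℝ) 1) (ε : ℝ) (J : X →L[ℝ] LL p)
    (E : X →L[ℝ] LL ∞) (hJE : ∀ u, E u =ᵐ[volume] J u) :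
    ContDiffAt ℝ 1 (nonlin β₀ ε J) 0 ∧
      HasFDerivAt (nonlin β₀ ε J) (nonlinDeriv β₀ ε J) 0 := by
  have ha := param_pos hβ
  set Ap : ℝ × X × X →L[ℝ] X := (ContinuousLinearMap.snd ℝ X X + ContinuousLinearMap.fst ℝ X X)
      ∘L ContinuousLinearMap.snd ℝ ℝ (X × X) with hAp
  set Am : ℝ × X × X →L[ℝ] X := (ContinuousLinearMap.snd ℝ X X - ContinuousLinearMap.fst ℝ X X)
      ∘L ContinuousLinearMap.snd ℝ ℝ (X × X) with hAm
  have sp := contDiffAt_sinShift (continuous_profile (lorentz β₀)) (J ∘L Ap) (E ∘L Ap)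
    (fun u => hJE _) 0
  have sm := contDiffAt_sinShift (continuous_profile (lorentz β₀)) (J ∘L Am) (E ∘L Am)
    (fun u => hJE _) 0
  have hf : HasFDerivAt (fun q : ℝ × X × X => paramAt β₀ q.1)
      (ContinuousLinearMap.fst ℝ ℝ (X × X)) 0 := hasFDerivAt_fst.const_add _
  have hfc : ContDiffAt ℝ 1 (fun q : ℝ × X × X => paramAt β₀ q.1) 0 :=
    contDiffAt_const.add contDiffAt_fst
  have h0 : paramAt β₀ (0 : ℝ × X × X).1 = param β₀ := by simp [paramAt]
  have hne : paramAt β₀ (0 : ℝ × X × X).1 ≠ 0 := by rw [h0]; exact ha.ne'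
  have hi : HasFDerivAt (fun q : ℝ × X × X => (paramAt β₀ q.1)⁻¹)
      ((-((param β₀) ^ 2)⁻¹) • ContinuousLinearMap.fst ℝ ℝ (X × X)) 0 := by
    have := (hasDerivAt_inv hne).comp_hasFDerivAt (0 : ℝ × X × X) hf
    rwa [h0] at this
  have hic : ContDiffAt ℝ 1 (fun q : ℝ × X × X => (paramAt β₀ q.1)⁻¹) 0 := hfc.inv hne
  constructor
  · refine ((hic.smul sp.1).add ((contDiffAt_const.mul hfc).smul sm.1)).add ?_
    exact (((hic.add (contDiffAt_const.mul hfc)).sub contDiffAt_const).sub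
      contDiffAt_const).smul contDiffAt_const
  · have key := ((hi.smul sp.2).add ((hf.const_mul ε).smul sm.2)).add
      ((((hi.add (hf.const_mul ε)).sub_const (param β₀)⁻¹).sub_const (ε * param β₀)).smul_const
        (sechLp p (lorentz β₀)))
    refine key.congr_fderiv ?_
    refine ContinuousLinearMap.ext fun q => ?_
    simp only [map_zero, sinShift_zero (continuous_profile (lorentz β₀)), h0]
    simp only [add_apply, smul_apply, ContinuousLinearMap.comp_apply,
      ContinuousLinearMap.smulRight_apply, smul_zero, add_zero, nonlinDeriv, cosMul, hAp, hAm,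
      ContinuousLinearMap.coe_fst', sub_apply, smul_eq_mul]
    rw [smul_smul]
    congr 4
    ring

/-- Since `cos (Q/2) = -tanh`, linearizing the sines at the kink produces the `tanh` coefficient of
`opT` and `opR`. -/
theorem cosMul_eq (β₀ : ℝ) (J : X →L[ℝ] LL p) (u : X) :
    cosMul β₀ J u = -((1 / 2 : ℝ) • LL.mulL p (tanhLp (lorentz β₀)) (J u)) := by
  apply Lp.ext
  filter_upwards [LL.coeFn_mulL (cosShift (profile (lorentz β₀)) 0) (J u),
    LL.coeFn_mulL (tanhLp (lorentz β₀)) (J u), coeFn_tanhLp (lorentz β₀),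
    coeFn_cosShift (continuous_profile (lorentz β₀)) 0,
    Lp.coeFn_neg ((1 / 2 : ℝ) • LL.mulL p (tanhLp (lorentz β₀)) (J u)),
    Lp.coeFn_smul (1 / 2 : ℝ) (LL.mulL p (tanhLp (lorentz β₀)) (J u)),
    Lp.coeFn_zero ℝ ∞ (volume : Measure ℝ)] with x h1 h2 h3 h4 h5 h6 h7
  change (LL.mulL p (cosShift (profile (lorentz β₀)) 0) (J u)) x = _
  rw [h1, h4, h5, Pi.neg_apply, h6, Pi.smul_apply, h2, h3, h7, Pi.zero_apply, zero_add,
    cos_half_profile, smul_eq_mul]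
  ring

/-- For `ε = -1` the two contributions of `v` add up to `a₀⁻¹ + a₀ = 2 γ₀` instead of cancelling;
for `ε = 1` the same happens for `u`. Only these entries have to be computed, since the linearized
systems are triangular. -/
theorem nonlinDeriv_left {β₀ : ℝ} (hβ : β₀ ∈ Ioo (-1 : ℝ) 1) (J : X →L[ℝ] LL p) (δ : ℝ) (v : X) :
    nonlinDeriv β₀ (-1) J (δ, v, 0) = -(lorentz β₀ • LL.mulL p (tanhLp (lorentz β₀)) (J v))
      - ((1 + ((param β₀) ^ 2)⁻¹) * δ) • sechLp p (lorentz β₀) := by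
  rw [nonlinDeriv_apply]
  simp only [zero_add, zero_sub, map_neg, cosMul_eq]
  have h := lorentz_eq hβ
  generalize sechLp p (lorentz β₀) = s
  generalize LL.mulL p (tanhLp (lorentz β₀)) (J v) = m
  rw [h]
  module

theorem nonlinDeriv_right {β₀ : ℝ} (hβ : β₀ ∈ Ioo (-1 : ℝ) 1) (J : X →L[ℝ] LL p) (u : X) :
    nonlinDeriv β₀ 1 J (0, 0, u) = -(lorentz β₀ • LL.mulL p (tanhLp (lorentz β₀)) (J u)) := by
  rw [nonlinDeriv_apply]
  simp only [sub_zero, add_zero, zero_smul, cosMul_eq]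
  have h := lorentz_eq hβ
  generalize LL.mulL p (tanhLp (lorentz β₀)) (J u) = m
  rw [h]
  module

end Nonlinear

/-! ### The orthogonality condition -/

/-- The third component of the functional on `L^∞`. -/
noncomputable def orth (β₀ : ℝ) (q : ℝ × ℝ × LL ∞) : ℝ :=
  LL.pairing (q.2.2 + profileLp (lorentz β₀))
    (sechFam (((paramAt β₀ q.1)⁻¹ + paramAt β₀ q.1) / 2,
      ((paramAt β₀ q.1)⁻¹ + paramAt β₀ q.1) / 2 * q.2.1))
    - Real.pi ^ 2 / (((paramAt β₀ q.1)⁻¹ + paramAt β₀ q.1) / 2)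

theorem sechFam_zero_right {c : ℝ} (hc : 0 < c) : sechFam (c, 0) = sechLp 1 c := by
  apply Lp.ext
  filter_upwards [coeFn_sechFam (q := (c, 0)) hc, coeFn_sechLp 1 hc] with x h1 h2
  rw [h1, h2, sub_zero]

theorem pairing_profile_sech {c : ℝ} (hc : 0 < c) :
    LL.pairing (profileLp c) (sechLp 1 c) = Real.pi ^ 2 / c := by
  rw [LL.pairing_apply, ← integral_profile_mul_sech hc]
  refine integral_congr_ae ?_
  filter_upwards [coeFn_profileLp c, coeFn_sechLp 1 hc] with x h1 h2
  rw [h1, h2]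

theorem orth_eq_of_fst_zero {β₀ : ℝ} (hβ : β₀ ∈ Ioo (-1 : ℝ) 1) (y : ℝ) (h : LL ∞) :
    orth β₀ (0, y, h) = LL.pairing (h + profileLp (lorentz β₀))
      (sechFam (lorentz β₀, lorentz β₀ * y)) - Real.pi ^ 2 / lorentz β₀ := by
  simp only [orth, paramAt, add_zero, ← lorentz_eq hβ]

theorem orth_zero {β₀ : ℝ} (hβ : β₀ ∈ Ioo (-1 : ℝ) 1) : orth β₀ 0 = 0 := by
  have := orth_eq_of_fst_zero hβ 0 0
  rw [mul_zero, zero_add, sechFam_zero_right (lorentz_pos hβ),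
    pairing_profile_sech (lorentz_pos hβ), sub_self] at this
  exact this

theorem contDiffAt_orth {β₀ : ℝ} (hβ : β₀ ∈ Ioo (-1 : ℝ) 1) : ContDiffAt ℝ 1 (orth β₀) 0 := by
  have ha := param_pos hβ
  have hfc : ContDiffAt ℝ 1 (fun q : ℝ × ℝ × LL ∞ => paramAt β₀ q.1) 0 :=
    contDiffAt_const.add contDiffAt_fst
  have h0 : paramAt β₀ (0 : ℝ × ℝ × LL ∞).1 = param β₀ := by simp [paramAt]
  have hl : ContDiffAt ℝ 1
      (fun q : ℝ × ℝ × LL ∞ => ((paramAt β₀ q.1)⁻¹ + paramAt β₀ q.1) / 2) 0 :=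
    ((hfc.inv (by rw [h0]; exact ha.ne')).add hfc).div_const 2
  have hy : ContDiffAt ℝ 1 (fun q : ℝ × ℝ × LL ∞ => q.2.1) 0 :=
    contDiffAt_fst.comp _ contDiffAt_snd
  have hh : ContDiffAt ℝ 1 (fun q : ℝ × ℝ × LL ∞ => q.2.2) 0 :=
    contDiffAt_snd.comp _ contDiffAt_snd
  have hpos : 0 < ((paramAt β₀ (0 : ℝ × ℝ × LL ∞).1)⁻¹ + paramAt β₀ (0 : ℝ × ℝ × LL ∞).1) / 2 := by
    rw [h0]; positivity
  have hs : ContDiffAt ℝ 1 (fun q : ℝ × ℝ × LL ∞ =>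
      sechFam (((paramAt β₀ q.1)⁻¹ + paramAt β₀ q.1) / 2,
        ((paramAt β₀ q.1)⁻¹ + paramAt β₀ q.1) / 2 * q.2.1)) 0 :=
    ContDiffAt.comp (g := sechFam) (0 : ℝ × ℝ × LL ∞) (contDiffAt_sechFam hpos).1
      (hl.prodMk (hl.mul hy))
  have hm : ContDiffAt ℝ 1 (fun q : ℝ × ℝ × LL ∞ => LL.pairing (q.2.2 + profileLp (lorentz β₀))) 0 :=
    LL.pairing.contDiff.contDiffAt.comp _ (hh.add contDiffAt_const)
  exact (hm.clm_apply hs).sub (contDiffAt_const.div hl hpos.ne')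

/-- At `δ = y = 0` the condition is affine in its last argument. -/
theorem fderiv_orth_right {β₀ : ℝ} (hβ : β₀ ∈ Ioo (-1 : ℝ) 1) (h : LL ∞) :
    fderiv ℝ (orth β₀) 0 (0, 0, h) = LL.pairing h (sechLp 1 (lorentz β₀)) := by
  have hc := lorentz_pos hβ
  have hd : HasFDerivAt (orth β₀) (fderiv ℝ (orth β₀) 0) 0 :=
    ((contDiffAt_orth hβ).differentiableAt one_ne_zero).hasFDerivAt
  let i : LL ∞ →L[ℝ] ℝ × ℝ × LL ∞ :=
    ContinuousLinearMap.inr ℝ ℝ (ℝ × LL ∞) ∘L ContinuousLinearMap.inr ℝ ℝ (LL ∞)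
  have h1 : HasFDerivAt (fun h => orth β₀ (i h)) (fderiv ℝ (orth β₀) 0 ∘L i) 0 :=
    HasFDerivAt.comp (g := orth β₀) (f := i) (0 : LL ∞) (by rw [map_zero]; exact hd) i.hasFDerivAt
  have h2 : HasFDerivAt (fun h => orth β₀ (i h)) (LL.pairing.flip (sechLp 1 (lorentz β₀))) 0 := by
    have e : (fun h => orth β₀ (i h)) = fun h =>
        LL.pairing.flip (sechLp 1 (lorentz β₀)) h
          + (LL.pairing (profileLp (lorentz β₀)) (sechLp 1 (lorentz β₀))
            - Real.pi ^ 2 / lorentz β₀) := by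
      funext h
      have : orth β₀ (i h) = orth β₀ (0, 0, h) := rfl
      rw [this, orth_eq_of_fst_zero hβ, mul_zero, sechFam_zero_right hc, map_add, add_apply,
        ContinuousLinearMap.flip_apply]
      ring
    rw [e]
    exact (LL.pairing.flip (sechLp 1 (lorentz β₀))).hasFDerivAt.add_const _
  have := congrArg (fun L : LL ∞ →L[ℝ] ℝ => L h) (h1.unique h2)
  exact this

theorem fderiv_orth_middle {β₀ : ℝ} (hβ : β₀ ∈ Ioo (-1 : ℝ) 1) :
    fderiv ℝ (orth β₀) 0 (0, 1, 0) ≠ 0 := by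
  have hc := lorentz_pos hβ
  set c := lorentz β₀ with hcd
  have hd : HasFDerivAt (orth β₀) (fderiv ℝ (orth β₀) 0) 0 :=
    ((contDiffAt_orth hβ).differentiableAt one_ne_zero).hasFDerivAt
  let i : ℝ →L[ℝ] ℝ × ℝ × LL ∞ :=
    ContinuousLinearMap.inr ℝ ℝ (ℝ × LL ∞) ∘L ContinuousLinearMap.inl ℝ ℝ (LL ∞)
  have h1 : HasFDerivAt (fun y => orth β₀ (i y)) (fderiv ℝ (orth β₀) 0 ∘L i) 0 :=
    HasFDerivAt.comp (g := orth β₀) (f := i) (0 : ℝ) (by rw [map_zero]; exact hd) i.hasFDerivAt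
  have h2 : HasDerivAt (fun y => orth β₀ (i y))
      (LL.pairing (profileLp c) (sechFamDeriv (c, 0) (0, c))) 0 := by
    have e : (fun y => orth β₀ (i y)) = fun y =>
        LL.pairing (profileLp c) (sechFam (c, c * y)) - Real.pi ^ 2 / c := by
      funext y
      have : orth β₀ (i y) = orth β₀ (0, y, 0) := rfl
      rw [this, orth_eq_of_fst_zero hβ, zero_add]
    rw [e]
    have hg : HasDerivAt (fun y : ℝ => (c, c * y)) (0, c) 0 := by
      refine (hasDerivAt_const (0 : ℝ) c).prodMk ?_
      simpa using (hasDerivAt_id (0 : ℝ)).const_mul c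
    have hs : HasFDerivAt sechFam (sechFamDeriv (c, 0)) (c, c * 0) := by
      rw [mul_zero]; exact (contDiffAt_sechFam (q := (c, 0)) hc).2
    exact ((LL.pairing (profileLp c)).hasFDerivAt.comp_hasDerivAt (0 : ℝ)
      (hs.comp_hasDerivAt (0 : ℝ) hg)).sub_const _
  have h3 := h1.hasDerivAt.unique h2
  have h4 : fderiv ℝ (orth β₀) 0 (0, 1, 0)
      = LL.pairing (profileLp c) (sechFamDeriv (c, 0) (0, c)) := h3
  rw [h4]
  have h5 : sechFamDeriv (c, 0) (0, c) = -(c • dsechFam (c, 0)) := by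
    simp [sechFamDeriv]
  rw [h5, map_neg, map_smul, LL.pairing_apply]
  have h6 : ∫ x, profileLp c x * dsechFam (c, 0) x
      = -∫ x, profile c x * (sech (c * x) * Real.tanh (c * x)) := by
    rw [← integral_neg]
    refine integral_congr_ae ?_
    filter_upwards [coeFn_profileLp c, coeFn_dsechFam (q := (c, 0)) hc] with x h7 h8
    rw [h7, h8, sub_zero]
    ring
  rw [h6, smul_eq_mul, mul_neg, neg_neg]
  exact (mul_pos hc (integral_profile_mul_sech_tanh_pos hc)).ne'

/-! ### The functional as a map of Banach spaces -/

/-- Bijectivity suffices for invertibility, by the open mapping theorem. The conclusion includes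
local uniqueness, from which the inverse relations will follow. -/
theorem exists_implicit {X Y H : Type*} [NormedAddCommGroup X] [NormedSpace ℝ X] [CompleteSpace X]
    [NormedAddCommGroup Y] [NormedSpace ℝ Y] [CompleteSpace Y]
    [NormedAddCommGroup H] [NormedSpace ℝ H] [CompleteSpace H] {f : X × Y → H}
    {f' : X × Y →L[ℝ] H} (hc : ContDiffAt ℝ 1 f 0) (hf : HasFDerivAt f f' 0) (h0 : f 0 = 0)
    (hb : Function.Bijective fun y => f' (0, y)) :
    ∃ ψ : X → Y, ContDiffAt ℝ 1 ψ 0 ∧ ψ 0 = 0 ∧ ∀ᶠ q in 𝓝 (0 : X × Y), f q = 0 ↔ ψ q.1 = q.2 := by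
  have hinv : (fderiv ℝ f 0 ∘L .inr ℝ X Y).IsInvertible := by
    rw [hf.fderiv]
    refine ⟨ContinuousLinearEquiv.ofBijective (f' ∘L .inr ℝ X Y) ?_ ?_, ?_⟩
    · exact LinearMap.ker_eq_bot.2 hb.1
    · exact LinearMap.range_eq_top.2 hb.2
    · exact ContinuousLinearEquiv.coe_ofBijective _ _ _
  refine ⟨hc.implicitFunction one_ne_zero hinv, hc.contDiffAt_implicitFunction one_ne_zero hinv,
    hc.implicitFunction_apply_self one_ne_zero hinv, ?_⟩
  have := hc.eventually_apply_eq_iff_implicitFunction one_ne_zero hinv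
  rwa [h0] at this

section Functional

variable {p : ℝ≥0∞} [Fact (1 ≤ p)]

/-- The part `(δ, v₀, u₀)` of the unknowns. -/
noncomputable def nonlinArg (p : ℝ≥0∞) [Fact (1 ≤ p)] :
    (ℝ × ℝ × W1 p × LL p) × (W1 p × LL p) →L[ℝ] ℝ × W1 p × W1 p :=
  (ContinuousLinearMap.fst ℝ ℝ _ ∘L ContinuousLinearMap.fst ℝ _ _).prod
    ((ContinuousLinearMap.fst ℝ _ _ ∘L ContinuousLinearMap.snd ℝ ℝ _ ∘L
      ContinuousLinearMap.snd ℝ ℝ _ ∘L ContinuousLinearMap.fst ℝ _ _).prod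
      (ContinuousLinearMap.fst ℝ _ _ ∘L ContinuousLinearMap.snd ℝ _ _))

/-- The part `(δ, y, u₀)` of the unknowns. -/
noncomputable def orthArg (p : ℝ≥0∞) [Fact (1 ≤ p)] :
    (ℝ × ℝ × W1 p × LL p) × (W1 p × LL p) →L[ℝ] ℝ × ℝ × LL ∞ :=
  (ContinuousLinearMap.fst ℝ ℝ _ ∘L ContinuousLinearMap.fst ℝ _ _).prod
    ((ContinuousLinearMap.fst ℝ ℝ _ ∘L ContinuousLinearMap.snd ℝ ℝ _ ∘L
      ContinuousLinearMap.fst ℝ _ _).prod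
      (W1.supL p ∘L ContinuousLinearMap.fst ℝ _ _ ∘L ContinuousLinearMap.snd ℝ _ _))

/-- The linear part of the first component of the functional. -/
noncomputable def linFst (p : ℝ≥0∞) [Fact (1 ≤ p)] :
    (ℝ × ℝ × W1 p × LL p) × (W1 p × LL p) →L[ℝ] LL p :=
  W1.dxL p ∘L ContinuousLinearMap.fst ℝ _ _ ∘L ContinuousLinearMap.snd ℝ _ _
    - ContinuousLinearMap.snd ℝ _ _ ∘L ContinuousLinearMap.snd ℝ ℝ _ ∘L
      ContinuousLinearMap.snd ℝ ℝ _ ∘L ContinuousLinearMap.fst ℝ _ _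

/-- The linear part of the second component of the functional. -/
noncomputable def linSnd (p : ℝ≥0∞) [Fact (1 ≤ p)] :
    (ℝ × ℝ × W1 p × LL p) × (W1 p × LL p) →L[ℝ] LL p :=
  ContinuousLinearMap.snd ℝ _ _ ∘L ContinuousLinearMap.snd ℝ _ _
    - W1.dxL p ∘L ContinuousLinearMap.fst ℝ _ _ ∘L ContinuousLinearMap.snd ℝ ℝ _ ∘L
      ContinuousLinearMap.snd ℝ ℝ _ ∘L ContinuousLinearMap.fst ℝ _ _

/-- The functional for `(t, x₀) = (0, 0)`. -/
noncomputable def functional (β₀ : ℝ) (q : (ℝ × ℝ × W1 p × LL p) × (W1 p × LL p)) :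
    LL p × LL p × ℝ :=
  (linFst p q - nonlin β₀ 1 (W1.fnL p) (nonlinArg p q),
    linSnd p q - nonlin β₀ (-1) (W1.fnL p) (nonlinArg p q), orth β₀ (orthArg p q))

/-- The derivative of the functional at the origin. -/
noncomputable def functionalDeriv (β₀ : ℝ) :
    (ℝ × ℝ × W1 p × LL p) × (W1 p × LL p) →L[ℝ] LL p × LL p × ℝ :=
  (linFst p - nonlinDeriv β₀ 1 (W1.fnL p) ∘L nonlinArg p).prod
    ((linSnd p - nonlinDeriv β₀ (-1) (W1.fnL p) ∘L nonlinArg p).prod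
      (fderiv ℝ (orth β₀) 0 ∘L orthArg p))

theorem functional_zero {β₀ : ℝ} (hβ : β₀ ∈ Ioo (-1 : ℝ) 1) :
    functional (p := p) β₀ 0 = 0 := by
  simp only [functional, map_zero, nonlin_zero, orth_zero hβ, sub_zero]
  rfl

theorem contDiffAt_functional {β₀ : ℝ} (hβ : β₀ ∈ Ioo (-1 : ℝ) 1) :
    ContDiffAt ℝ 1 (functional (p := p) β₀) 0 ∧
      HasFDerivAt (functional (p := p) β₀) (functionalDeriv β₀) 0 := by
  have hn : ∀ ε : ℝ, ContDiffAt ℝ 1 (fun q => nonlin β₀ ε (W1.fnL p) (nonlinArg p q)) 0 ∧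
      HasFDerivAt (fun q => nonlin β₀ ε (W1.fnL p) (nonlinArg p q))
        (nonlinDeriv β₀ ε (W1.fnL p) ∘L nonlinArg p) 0 := by
    intro ε
    have h := contDiffAt_nonlin hβ ε (W1.fnL p) (W1.supL p) W1.coeFn_supL
    rw [← map_zero (nonlinArg p)] at h
    exact ⟨h.1.comp _ (nonlinArg p).contDiff.contDiffAt, h.2.comp _ (nonlinArg p).hasFDerivAt⟩
  have ho : ContDiffAt ℝ 1 (fun q => orth β₀ (orthArg p q)) 0 ∧
      HasFDerivAt (fun q => orth β₀ (orthArg p q)) (fderiv ℝ (orth β₀) 0 ∘L orthArg p) 0 := by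
    have h := contDiffAt_orth hβ
    have h2 := (h.differentiableAt one_ne_zero).hasFDerivAt
    have e : fderiv ℝ (orth β₀) 0 = fderiv ℝ (orth β₀) (orthArg p 0) := by rw [map_zero]
    rw [← map_zero (orthArg p)] at h h2
    rw [e]
    exact ⟨h.comp _ (orthArg p).contDiff.contDiffAt, h2.comp _ (orthArg p).hasFDerivAt⟩
  exact ⟨((linFst p).contDiff.contDiffAt.sub (hn 1).1).prodMk
      (((linSnd p).contDiff.contDiffAt.sub (hn (-1)).1).prodMk ho.1),
    ((linFst p).hasFDerivAt.sub (hn 1).2).prodMk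
      (((linSnd p).hasFDerivAt.sub (hn (-1)).2).prodMk ho.2)⟩

/-- The triangular form is visible here: the second component involves only `δ` and `v₀`, through
`opT`; then `y` is found from the third component and `v₁` from the first. -/
theorem functionalDeriv_left {β₀ : ℝ} (hβ : β₀ ∈ Ioo (-1 : ℝ) 1) (z : ℝ × ℝ × W1 p × LL p) :
    functionalDeriv β₀ (z, (0 : W1 p × LL p)) =
      (-z.2.2.2 - nonlinDeriv β₀ 1 (W1.fnL p) (z.1, z.2.2.1, 0),
        -opT p (lorentz β₀) ((1 + ((param β₀) ^ 2)⁻¹) * z.1, z.2.2.1),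
        fderiv ℝ (orth β₀) 0 (z.1, 0, 0) + z.2.1 * fderiv ℝ (orth β₀) 0 (0, 1, 0)) := by
  have h1 : linFst p (z, (0 : W1 p × LL p)) = -z.2.2.2 := by
    change W1.dxL p 0 - z.2.2.2 = _
    rw [map_zero, zero_sub]
  have h2 : linSnd p (z, (0 : W1 p × LL p)) = -z.2.2.1.dx := by
    change (0 : LL p) - z.2.2.1.dx = _
    rw [zero_sub]
  have h3 : nonlinArg p (z, (0 : W1 p × LL p)) = (z.1, z.2.2.1, 0) := rfl
  have h4 : orthArg p (z, (0 : W1 p × LL p))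
      = (z.1, 0, 0) + z.2.1 • ((0 : ℝ), (1 : ℝ), (0 : LL ∞)) := by
    change (z.1, z.2.1, W1.supL p 0) = _
    simp
  change (linFst p _ - nonlinDeriv β₀ 1 (W1.fnL p) (nonlinArg p _),
    linSnd p _ - nonlinDeriv β₀ (-1) (W1.fnL p) (nonlinArg p _),
      fderiv ℝ (orth β₀) 0 (orthArg p _)) = _
  rw [h1, h2, h3, h4, map_add, map_smul, nonlinDeriv_left hβ, opT_apply, W1.fnL_apply, smul_eq_mul]
  congr 2
  dsimp only
  abel

/-- The first and third components form `opR` and determine `u₀`; `u₁` enters only the second one,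
with coefficient one. -/
theorem functionalDeriv_right {β₀ : ℝ} (hβ : β₀ ∈ Ioo (-1 : ℝ) 1) (u : W1 p × LL p) :
    functionalDeriv β₀ ((0 : ℝ × ℝ × W1 p × LL p), u) =
      ((opR p (lorentz β₀) u.1).1, u.2 - nonlinDeriv β₀ (-1) (W1.fnL p) (0, 0, u.1),
        (opR p (lorentz β₀) u.1).2) := by
  have h1 : linFst p ((0 : ℝ × ℝ × W1 p × LL p), u) = u.1.dx := by
    change u.1.dx - 0 = _
    rw [sub_zero]
  have h2 : linSnd p ((0 : ℝ × ℝ × W1 p × LL p), u) = u.2 := by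
    change u.2 - W1.dxL p 0 = _
    rw [map_zero, sub_zero]
  have h3 : nonlinArg p ((0 : ℝ × ℝ × W1 p × LL p), u) = (0, 0, u.1) := rfl
  have h4 : orthArg p ((0 : ℝ × ℝ × W1 p × LL p), u) = (0, 0, W1.supL p u.1) := rfl
  change (linFst p _ - nonlinDeriv β₀ 1 (W1.fnL p) (nonlinArg p _),
    linSnd p _ - nonlinDeriv β₀ (-1) (W1.fnL p) (nonlinArg p _),
      fderiv ℝ (orth β₀) 0 (orthArg p _)) = _
  rw [h1, h2, h3, h4, nonlinDeriv_right hβ, fderiv_orth_right hβ, opR_apply, W1.fnL_apply]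
  congr 1
  dsimp only
  abel

theorem bijective_functionalDeriv_left {β₀ : ℝ} (hβ : β₀ ∈ Ioo (-1 : ℝ) 1) :
    Function.Bijective fun z : ℝ × ℝ × W1 p × LL p =>
      functionalDeriv β₀ (z, (0 : W1 p × LL p)) := by
  have hc := lorentz_pos hβ
  have ha := param_pos hβ
  set m := 1 + ((param β₀) ^ 2)⁻¹ with hm
  have hm0 : m ≠ 0 := by positivity
  have hk := fderiv_orth_middle hβ
  simp only [functionalDeriv_left hβ]
  constructor
  · rintro ⟨δ, y, v, v₁⟩ ⟨δ', y', v', v₁'⟩ h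
    simp only [Prod.mk.injEq] at h
    obtain ⟨h1, h2, h3⟩ := h
    have h4 := opT_injective hc (neg_injective h2)
    simp only [Prod.mk.injEq] at h4
    have h5 : δ = δ' := mul_left_cancel₀ hm0 h4.1
    obtain ⟨-, rfl⟩ := h4
    subst h5
    have h6 : y = y' := mul_right_cancel₀ hk (add_left_cancel h3)
    have h7 : v₁ = v₁' := neg_injective (sub_left_injective h1)
    rw [h6, h7]
  · rintro ⟨h₁, h₂, h₃⟩
    obtain ⟨⟨d, v⟩, hd⟩ := opT_surjective (p := p) hc (-h₂)
    refine ⟨(d / m, (h₃ - fderiv ℝ (orth β₀) 0 (d / m, 0, 0)) / fderiv ℝ (orth β₀) 0 (0, 1, 0), v,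
      -h₁ - nonlinDeriv β₀ 1 (W1.fnL p) (d / m, v, 0)), ?_⟩
    simp only
    rw [mul_div_cancel₀ _ hm0, hd, div_mul_cancel₀ _ hk, neg_neg]
    refine Prod.ext ?_ (Prod.ext rfl ?_)
    · simp only
      abel
    · exact add_sub_cancel _ _

theorem bijective_functionalDeriv_right {β₀ : ℝ} (hβ : β₀ ∈ Ioo (-1 : ℝ) 1) :
    Function.Bijective fun u : W1 p × LL p =>
      functionalDeriv β₀ ((0 : ℝ × ℝ × W1 p × LL p), u) := by
  have hc := lorentz_pos hβ
  simp only [functionalDeriv_right hβ]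
  constructor
  · rintro ⟨u, u₁⟩ ⟨u', u₁'⟩ h
    simp only [Prod.mk.injEq] at h
    obtain ⟨h1, h2, h3⟩ := h
    obtain rfl : u = u' := opR_injective hc (Prod.ext h1 h3)
    rw [sub_left_injective h2]
  · rintro ⟨h₁, h₂, h₃⟩
    obtain ⟨u, hu⟩ := opR_surjective (p := p) hc (h₁, h₃)
    refine ⟨(u, h₂ + nonlinDeriv β₀ (-1) (W1.fnL p) (0, 0, u)), ?_⟩
    simp only
    rw [hu, add_sub_cancel_right]

/-! ### The equation at a general center -/

/-- Because `sin (Q/2) = sech`, `nonlin` is the original combination of sines minus its value at the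
origin, which equals `Q_x` for `ε = 1` and `Q_t` for `ε = -1`. Its definition through differences of
sines is what places it in `L^p`. -/
theorem coeFn_nonlin {X : Type*} [NormedAddCommGroup X] [NormedSpace ℝ X] {β₀ : ℝ}
    (hβ : β₀ ∈ Ioo (-1 : ℝ) 1) (ε : ℝ) (J : X →L[ℝ] LL p) (q : ℝ × X × X) :
    nonlin β₀ ε J q =ᵐ[volume] fun x =>
      1 / paramAt β₀ q.1 * Real.sin ((J q.2.2 x + profile (lorentz β₀) x + J q.2.1 x) / 2)
      + ε * (paramAt β₀ q.1
        * Real.sin ((J q.2.2 x + profile (lorentz β₀) x - J q.2.1 x) / 2))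
      - ((param β₀)⁻¹ + ε * param β₀) * sech (lorentz β₀ * x) := by
  have hQ := continuous_profile (lorentz β₀)
  set s₁ := sinShift p (profile (lorentz β₀)) (J (q.2.2 + q.2.1))
  set s₂ := sinShift p (profile (lorentz β₀)) (J (q.2.2 - q.2.1))
  set a := paramAt β₀ q.1
  filter_upwards [Lp.coeFn_add (a⁻¹ • s₁ + (ε * a) • s₂)
      ((a⁻¹ + ε * a - (param β₀)⁻¹ - ε * param β₀) • sechLp p (lorentz β₀)),
    Lp.coeFn_add (a⁻¹ • s₁) ((ε * a) • s₂), Lp.coeFn_smul a⁻¹ s₁, Lp.coeFn_smul (ε * a) s₂,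
    Lp.coeFn_smul (a⁻¹ + ε * a - (param β₀)⁻¹ - ε * param β₀) (sechLp p (lorentz β₀)),
    coeFn_sechLp p (lorentz_pos hβ), coeFn_sinShift hQ (J (q.2.2 + q.2.1)),
    coeFn_sinShift hQ (J (q.2.2 - q.2.1)), Lp.coeFn_add (J q.2.2) (J q.2.1),
    Lp.coeFn_sub (J q.2.2) (J q.2.1)] with x h1 h2 h3 h4 h5 h6 h7 h8 h9 h10
  have e1 : (J (q.2.2 + q.2.1)) x = J q.2.2 x + J q.2.1 x := by rw [map_add, h9, Pi.add_apply]
  have e2 : (J (q.2.2 - q.2.1)) x = J q.2.2 x - J q.2.1 x := by rw [map_sub, h10, Pi.sub_apply]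
  change (a⁻¹ • s₁ + (ε * a) • s₂
    + (a⁻¹ + ε * a - (param β₀)⁻¹ - ε * param β₀) • sechLp p (lorentz β₀)) x = _
  rw [h1, Pi.add_apply, h2, Pi.add_apply, h3, h4, h5, Pi.smul_apply, Pi.smul_apply, Pi.smul_apply,
    h6, h7, h8, e1, e2, sin_half_profile]
  simp only [smul_eq_mul]
  rw [add_right_comm (J q.2.2 x), sub_add_eq_add_sub, one_div]
  ring

/-- Translation of the data. -/
noncomputable def shiftZ (p : ℝ≥0∞) [Fact (1 ≤ p)] (c : ℝ) :
    ℝ × ℝ × W1 p × LL p →L[ℝ] ℝ × ℝ × W1 p × LL p :=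
  (ContinuousLinearMap.id ℝ ℝ).prodMap ((ContinuousLinearMap.id ℝ ℝ).prodMap
    ((W1.shift p c).prodMap (LL.shift p c)))

/-- Translation of the data. -/
noncomputable def shiftU (p : ℝ≥0∞) [Fact (1 ≤ p)] (c : ℝ) : W1 p × LL p →L[ℝ] W1 p × LL p :=
  (W1.shift p c).prodMap (LL.shift p c)

theorem shiftZ_apply (c : ℝ) (z : ℝ × ℝ × W1 p × LL p) :
    shiftZ p c z = (z.1, z.2.1, W1.shift p c z.2.2.1, LL.shift p c z.2.2.2) := rfl

theorem shiftU_apply (c : ℝ) (u : W1 p × LL p) :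
    shiftU p c u = (W1.shift p c u.1, LL.shift p c u.2) := rfl

@[simp] theorem norm₁_shiftZ (c : ℝ) (z : ℝ × ℝ × W1 p × LL p) :
    norm₁ (shiftZ p c z) = norm₁ z := by
  simp only [norm₁, shiftZ_apply, W1.norm_shift, LL.norm_shift]

@[simp] theorem norm₀_shiftU (c : ℝ) (u : W1 p × LL p) : norm₀ (shiftU p c u) = norm₀ u := by
  simp only [norm₀, shiftU_apply, W1.norm_shift, LL.norm_shift]

theorem shiftZ_shiftZ (c d : ℝ) (h : d + c = 0) (z : ℝ × ℝ × W1 p × LL p) :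
    shiftZ p c (shiftZ p d z) = z := by
  simp only [shiftZ_apply, W1.shift_shift c d h, LL.shift_shift c d h]

theorem shiftU_shiftU (c d : ℝ) (h : d + c = 0) (u : W1 p × LL p) :
    shiftU p c (shiftU p d u) = u := by
  simp only [shiftU_apply, W1.shift_shift c d h, LL.shift_shift c d h]

theorem ae_comp_add_iff {P : ℝ → Prop} (c : ℝ) : (∀ᵐ x, P (x + c)) ↔ ∀ᵐ x, P x := by
  refine ⟨fun h => ?_, fun h => ae_comp_add h c⟩
  have := ae_comp_add h (-c)
  simpa using this

/-- After the translation by `β₀ * t + x₀` no trace of `t` and `x₀` is left. The condition on `δ` is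
kept separate because `functional` makes sense for every `δ`, while `lorentzAt` agrees with `(a⁻¹ +
a)/2` for `a > 0`. -/
theorem fEqZero_iff_functional {β₀ : ℝ} (hβ : β₀ ∈ Ioo (-1 : ℝ) 1) (t x₀ : ℝ)
    (z : ℝ × ℝ × W1 p × LL p) (u : W1 p × LL p) :
    FEqZero β₀ t x₀ z u ↔ -param β₀ < z.1 ∧
      functional β₀ (shiftZ p (β₀ * t + x₀) z, shiftU p (β₀ * t + x₀) u) = 0 := by
  set c := β₀ * t + x₀ with hc
  refine and_congr_right fun hδ => ?_
  have hk : ∀ x, x + c - β₀ * t - x₀ = x := fun x => by linarith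
  have hg := lorentz_eq hβ
  have hv := velocity_mul_lorentz hβ
  set q : (ℝ × ℝ × W1 p × LL p) × (W1 p × LL p) := (shiftZ p c z, shiftU p c u) with hq
  have hw : (nonlinArg p q) = (z.1, W1.shift p c z.2.2.1, W1.shift p c u.1) := rfl
  have e1 : (∀ᵐ x, F₁ β₀ t x₀ z.1 z.2.2.1 z.2.2.2 u.1 x = 0) ↔
      linFst p q - nonlin β₀ 1 (W1.fnL p) (nonlinArg p q) = 0 := by
    rw [← ae_comp_add_iff c, Lp.eq_zero_iff_ae_eq_zero]
    have hl : linFst p q = LL.shift p c u.1.dx - LL.shift p c z.2.2.2 := rfl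
    rw [hl, hw]
    have : (fun x => F₁ β₀ t x₀ z.1 z.2.2.1 z.2.2.2 u.1 (x + c)) =ᵐ[volume]
        (LL.shift p c u.1.dx - LL.shift p c z.2.2.2
          - nonlin β₀ 1 (W1.fnL p) (z.1, W1.shift p c z.2.2.1, W1.shift p c u.1) : LL p) := by
      filter_upwards [Lp.coeFn_sub (LL.shift p c u.1.dx - LL.shift p c z.2.2.2)
          (nonlin β₀ 1 (W1.fnL p) (z.1, W1.shift p c z.2.2.1, W1.shift p c u.1)),
        Lp.coeFn_sub (LL.shift p c u.1.dx) (LL.shift p c z.2.2.2),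
        coeFn_nonlin hβ 1 (W1.fnL p) (z.1, W1.shift p c z.2.2.1, W1.shift p c u.1),
        LL.coeFn_shift c u.1.dx, LL.coeFn_shift c z.2.2.2, LL.coeFn_shift c u.1.fn,
        LL.coeFn_shift c z.2.2.1.fn] with x h1 h2 h3 h4 h5 h6 h7
      rw [h1, Pi.sub_apply, h2, Pi.sub_apply, h3, h4, h5]
      simp only [W1.fnL_apply, W1.fn_shift]
      rw [h6, h7, F₁, deriv_kink_space, kink_eq_profile, hk, hg]
      ring
    exact ⟨fun h => this.symm.trans h, fun h => this.trans h⟩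
  have e2 : (∀ᵐ x, F₂ β₀ t x₀ z.1 z.2.2.1 u.1 u.2 x = 0) ↔
      linSnd p q - nonlin β₀ (-1) (W1.fnL p) (nonlinArg p q) = 0 := by
    rw [← ae_comp_add_iff c, Lp.eq_zero_iff_ae_eq_zero]
    have hl : linSnd p q = LL.shift p c u.2 - LL.shift p c z.2.2.1.dx := rfl
    rw [hl, hw]
    have : (fun x => F₂ β₀ t x₀ z.1 z.2.2.1 u.1 u.2 (x + c)) =ᵐ[volume]
        (LL.shift p c u.2 - LL.shift p c z.2.2.1.dx
          - nonlin β₀ (-1) (W1.fnL p) (z.1, W1.shift p c z.2.2.1, W1.shift p c u.1) : LL p) := by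
      filter_upwards [Lp.coeFn_sub (LL.shift p c u.2 - LL.shift p c z.2.2.1.dx)
          (nonlin β₀ (-1) (W1.fnL p) (z.1, W1.shift p c z.2.2.1, W1.shift p c u.1)),
        Lp.coeFn_sub (LL.shift p c u.2) (LL.shift p c z.2.2.1.dx),
        coeFn_nonlin hβ (-1) (W1.fnL p) (z.1, W1.shift p c z.2.2.1, W1.shift p c u.1),
        LL.coeFn_shift c u.2, LL.coeFn_shift c z.2.2.1.dx, LL.coeFn_shift c u.1.fn,
        LL.coeFn_shift c z.2.2.1.fn] with x h1 h2 h3 h4 h5 h6 h7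
      rw [h1, Pi.sub_apply, h2, Pi.sub_apply, h3, h4, h5]
      simp only [W1.fnL_apply, W1.fn_shift]
      rw [h6, h7, F₂, deriv_kink_time, kink_eq_profile, hk, hv]
      ring
    exact ⟨fun h => this.symm.trans h, fun h => this.trans h⟩
  have e3 : F₃ β₀ t x₀ z.1 z.2.1 u.1 = orth β₀ (orthArg p q) := by
    have ho : orthArg p q = (z.1, z.2.1, W1.supL p (W1.shift p c u.1)) := rfl
    have hl : ((paramAt β₀ z.1)⁻¹ + paramAt β₀ z.1) / 2 = lorentzAt β₀ z.1 :=
      (lorentzAt_eq hδ).symm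
    rw [ho, orth, F₃]
    simp only [hl]
    congr 1
    rw [LL.pairing_apply, ← integral_add_right_eq_self _ c]
    refine integral_congr_ae ?_
    filter_upwards [Lp.coeFn_add (W1.supL p (W1.shift p c u.1)) (profileLp (lorentz β₀)),
      (W1.shift p c u.1).coeFn_supL, LL.coeFn_shift c u.1.fn, coeFn_profileLp (lorentz β₀),
      coeFn_sechFam (q := (lorentzAt β₀ z.1, lorentzAt β₀ z.1 * z.2.1)) (lorentzAt_pos hδ)]
      with x h1 h2 h3 h4 h5
    rw [h1, Pi.add_apply, h2, h4, h5, W1.fn_shift, h3, kink_eq_profile, hk]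
    congr 2
    ring
  rw [e1, e2, e3]
  simp only [functional, Prod.mk_eq_zero]

end Functional

/-! ### Existence of the maps -/

/-- Near the origin the zero set is at once a graph over `Y` and a graph over `X`. A point of one
graph lies on the other, which gives both inverse identities. -/
theorem exists_implicit_pair {X Y H : Type*} [NormedAddCommGroup X] [NormedSpace ℝ X]
    [CompleteSpace X] [NormedAddCommGroup Y] [NormedSpace ℝ Y] [CompleteSpace Y]
    [NormedAddCommGroup H] [NormedSpace ℝ H] [CompleteSpace H] {f : X × Y → H}
    {f' : X × Y →L[ℝ] H} (hc : ContDiffAt ℝ 1 f 0) (hf : HasFDerivAt f f' 0) (h0 : f 0 = 0)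
    (hl : Function.Bijective fun x => f' (x, 0)) (hr : Function.Bijective fun y => f' (0, y)) :
    ∃ (φ : Y → X) (ψ : X → Y), ContDiffAt ℝ 1 φ 0 ∧ ContDiffAt ℝ 1 ψ 0 ∧ φ 0 = 0 ∧ ψ 0 = 0 ∧
      (∀ᶠ y in 𝓝 0, f (φ y, y) = 0 ∧ ψ (φ y) = y) ∧
      (∀ᶠ x in 𝓝 0, f (x, ψ x) = 0 ∧ φ (ψ x) = x) := by
  obtain ⟨ψ, hψ, hψ0, hψe⟩ := exists_implicit hc hf h0 hr
  -- Exchanging the factors lets `exists_implicit` solve for the other variable.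
  set S : Y × X →L[ℝ] X × Y := (ContinuousLinearEquiv.prodComm ℝ Y X : Y × X →L[ℝ] X × Y) with hS
  have hS0 : S 0 = 0 := map_zero _
  obtain ⟨φ, hφ, hφ0, hφe⟩ := exists_implicit (f := fun q => f (S q)) (f' := f' ∘L S)
    (ContDiffAt.comp (g := f) (0 : Y × X) (by rwa [hS0]) S.contDiff.contDiffAt)
    (HasFDerivAt.comp (g := f) (0 : Y × X) (by rwa [hS0]) S.hasFDerivAt)
    (by rwa [hS0]) hl
  have hφe' : ∀ᶠ q in 𝓝 (0 : X × Y), f q = 0 ↔ φ q.2 = q.1 := by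
    have : Tendsto (Prod.swap : X × Y → Y × X) (𝓝 0) (𝓝 0) := continuous_swap.tendsto' _ _ rfl
    exact this.eventually hφe
  have tφ : Tendsto (fun y => (φ y, y)) (𝓝 0) (𝓝 (0 : X × Y)) := by
    have h := hφ.continuousAt.tendsto
    rw [hφ0] at h
    exact h.prodMk_nhds tendsto_id
  have tψ : Tendsto (fun x => (x, ψ x)) (𝓝 0) (𝓝 (0 : X × Y)) := by
    have h := hψ.continuousAt.tendsto
    rw [hψ0] at h
    exact tendsto_id.prodMk_nhds h
  refine ⟨φ, ψ, hφ, hψ, hφ0, hψ0, ?_, ?_⟩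
  · filter_upwards [tφ.eventually hφe', tφ.eventually hψe] with y h1 h2
    exact ⟨h1.2 rfl, h2.1 (h1.2 rfl)⟩
  · filter_upwards [tψ.eventually hφe', tψ.eventually hψe] with y h1 h2
    exact ⟨h2.2 rfl, h1.1 (h2.2 rfl)⟩

theorem exists_norm_le_of_contDiffAt {X Y : Type*} [NormedAddCommGroup X] [NormedSpace ℝ X]
    [NormedAddCommGroup Y] [NormedSpace ℝ Y] {f : X → Y} (h : ContDiffAt ℝ 1 f 0) (h0 : f 0 = 0) :
    ∃ C, 0 < C ∧ ∀ᶠ x in 𝓝 0, ‖f x‖ ≤ C * ‖x‖ := by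
  have := (h.differentiableAt one_ne_zero).hasFDerivAt.isBigO_sub
  simp only [h0, sub_zero] at this
  obtain ⟨C, hC, h⟩ := this.exists_pos
  exact ⟨C, hC, h.bound⟩

/-! ### Comparison of the sum norms with the product norms, and neighborhoods of the origin. -/

section Balls

variable {p : ℝ≥0∞} [Fact (1 ≤ p)]

theorem norm_le_norm₀ (u : W1 p × LL p) : ‖u‖ ≤ norm₀ u :=
  max_le (le_add_of_nonneg_right (norm_nonneg _)) (le_add_of_nonneg_left (norm_nonneg _))

theorem norm₀_le_norm (u : W1 p × LL p) : norm₀ u ≤ 2 * ‖u‖ := by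
  have h1 : ‖u.1‖ ≤ ‖u‖ := norm_fst_le u
  have h2 : ‖u.2‖ ≤ ‖u‖ := norm_snd_le u
  rw [norm₀]
  linarith

theorem norm₀_nonneg (u : W1 p × LL p) : 0 ≤ norm₀ u := (norm_nonneg u).trans (norm_le_norm₀ u)

theorem norm₁_eq (z : ℝ × ℝ × W1 p × LL p) : norm₁ z = |z.1| + |z.2.1| + norm₀ z.2.2 := by
  rw [norm₁, norm₀, add_assoc]

theorem norm_le_norm₁ (z : ℝ × ℝ × W1 p × LL p) : ‖z‖ ≤ norm₁ z := by
  rw [norm₁_eq]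
  have h1 := norm_le_norm₀ z.2.2
  have h2 := abs_nonneg z.1
  have h3 := abs_nonneg z.2.1
  have h4 := norm₀_nonneg z.2.2
  refine max_le ?_ (max_le ?_ ?_)
  · rw [Real.norm_eq_abs]
    linarith
  · rw [Real.norm_eq_abs]
    linarith
  · linarith

theorem norm₁_le_norm (z : ℝ × ℝ × W1 p × LL p) : norm₁ z ≤ 4 * ‖z‖ := by
  rw [norm₁_eq]
  have h1 : |z.1| ≤ ‖z‖ := norm_fst_le z
  have h2 : ‖z.2‖ ≤ ‖z‖ := norm_snd_le z
  have h3 : |z.2.1| ≤ ‖z.2‖ := norm_fst_le z.2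
  have h4 : ‖z.2.2‖ ≤ ‖z.2‖ := norm_snd_le z.2
  have h5 := norm₀_le_norm z.2.2
  linarith

theorem norm₁_nonneg (z : ℝ × ℝ × W1 p × LL p) : 0 ≤ norm₁ z :=
  (norm_nonneg z).trans (norm_le_norm₁ z)

theorem isOpen_Y₀ (r : ℝ) : IsOpen (Y₀ p r) :=
  isOpen_lt (continuous_fst.norm.add continuous_snd.norm) continuous_const

theorem isOpen_Y₁ (r : ℝ) : IsOpen (Y₁ p r) := by
  refine isOpen_lt ?_ continuous_const
  unfold norm₁
  fun_prop

theorem zero_mem_Y₀ {r : ℝ} (hr : 0 < r) : (0 : W1 p × LL p) ∈ Y₀ p r := by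
  simpa [Y₀, norm₀] using hr

theorem zero_mem_Y₁ {r : ℝ} (hr : 0 < r) : (0 : ℝ × ℝ × W1 p × LL p) ∈ Y₁ p r := by
  simpa [Y₁, norm₁] using hr

theorem exists_forall_Y₀ {P : W1 p × LL p → Prop} (h : ∀ᶠ u in 𝓝 0, P u) :
    ∃ r > 0, ∀ u ∈ Y₀ p r, P u := by
  obtain ⟨r, hr, h⟩ := Metric.eventually_nhds_iff.1 h
  exact ⟨r, hr, fun u hu => h (by rw [dist_zero_right]; exact (norm_le_norm₀ u).trans_lt hu)⟩

theorem exists_forall_Y₁ {P : ℝ × ℝ × W1 p × LL p → Prop} (h : ∀ᶠ z in 𝓝 0, P z) :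
    ∃ r > 0, ∀ z ∈ Y₁ p r, P z := by
  obtain ⟨r, hr, h⟩ := Metric.eventually_nhds_iff.1 h
  exact ⟨r, hr, fun u hu => h (by rw [dist_zero_right]; exact (norm_le_norm₁ u).trans_lt hu)⟩

theorem Y₀_mono {r s : ℝ} (h : r ≤ s) : Y₀ p r ⊆ Y₀ p s := fun _ hu => lt_of_lt_of_le hu h

theorem Y₁_mono {r s : ℝ} (h : r ≤ s) : Y₁ p r ⊆ Y₁ p s := fun _ hu => lt_of_lt_of_le hu h

theorem shiftU_mem_Y₀ {c r : ℝ} {u : W1 p × LL p} : shiftU p c u ∈ Y₀ p r ↔ u ∈ Y₀ p r := by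
  simp only [Y₀, mem_ofPred_eq, norm₀_shiftU]

theorem shiftZ_mem_Y₁ {c r : ℝ} {z : ℝ × ℝ × W1 p × LL p} :
    shiftZ p c z ∈ Y₁ p r ↔ z ∈ Y₁ p r := by
  simp only [Y₁, mem_ofPred_eq, norm₁_shiftZ]

end Balls

/-- Maps that are locally inverse on balls restrict to a bijection between open sets. -/
theorem exists_bijOn_invOn {X Y : Type*} [TopologicalSpace X] [TopologicalSpace Y] {φ : X → Y}
    {ψ : Y → X} {A : Set X} {B : Set Y} {a : X} {b : Y} (hA : IsOpen A) (hB : IsOpen B)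
    (hφ : ContinuousOn φ A) (hψ : ContinuousOn ψ B) (ha : a ∈ A) (hb : b ∈ B) (hab : φ a = b)
    (hba : ψ b = a) (hl : ∀ u ∈ A, ψ (φ u) = u) (hr : ∀ z ∈ B, φ (ψ z) = z) :
    ∃ (U : Set X) (V : Set Y), IsOpen U ∧ IsOpen V ∧ a ∈ U ∧ b ∈ V ∧ U ⊆ A ∧ V ⊆ B ∧
      BijOn φ U V ∧ InvOn ψ φ U V := by
  refine ⟨A ∩ φ ⁻¹' B, B ∩ ψ ⁻¹' A, hφ.isOpen_inter_preimage hA hB,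
    hψ.isOpen_inter_preimage hB hA, ⟨ha, by rwa [mem_preimage, hab]⟩,
    ⟨hb, by rwa [mem_preimage, hba]⟩, inter_subset_left, inter_subset_left, ?_⟩
  have hinv : InvOn ψ φ (A ∩ φ ⁻¹' B) (B ∩ ψ ⁻¹' A) :=
    ⟨fun u hu => hl u hu.1, fun z hz => hr z hz.1⟩
  refine ⟨hinv.bijOn ?_ ?_, hinv⟩
  · intro u hu
    exact ⟨hu.2, by rw [mem_preimage, hl u hu.1]; exact hu.1⟩
  · intro z hz
    exact ⟨hz.2, by rw [mem_preimage, hr z hz.1]; exact hz.1⟩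

theorem exists_isBacklundPair {β₀ : ℝ} (hβ : β₀ ∈ Ioo (-1 : ℝ) 1) (p : ℝ≥0∞) [Fact (1 ≤ p)] :
    ∃ (r₀ r₁ r₂ C : ℝ) (Φ : ℝ → ℝ → W1 p × LL p → ℝ × ℝ × W1 p × LL p)
      (Ψ : ℝ → ℝ → ℝ × ℝ × W1 p × LL p → W1 p × LL p), IsBacklundPair β₀ r₀ r₁ r₂ C Φ Ψ := by
  obtain ⟨φ, ψ, hφ, hψ, hφ0, hψ0, hφe, hψe⟩ := exists_implicit_pair
    (contDiffAt_functional (p := p) hβ).1 (contDiffAt_functional hβ).2 (functional_zero hβ)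
    (bijective_functionalDeriv_left hβ) (bijective_functionalDeriv_right hβ)
  obtain ⟨C, hC, hφC⟩ := exists_norm_le_of_contDiffAt hφ hφ0
  obtain ⟨D, hD, hψD⟩ := exists_norm_le_of_contDiffAt hψ hψ0
  have hpar : ∀ᶠ z : ℝ × ℝ × W1 p × LL p in 𝓝 0, -param β₀ < z.1 :=
    continuous_fst.continuousAt.eventually (lt_mem_nhds (neg_lt_zero.2 (param_pos hβ)))
  have tφ : Tendsto φ (𝓝 0) (𝓝 0) := by
    have := hφ.continuousAt.tendsto
    rwa [hφ0] at this
  have tψ : Tendsto ψ (𝓝 0) (𝓝 0) := by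
    have := hψ.continuousAt.tendsto
    rwa [hψ0] at this
  obtain ⟨s₀, hs₀, h₀⟩ := exists_forall_Y₀ ((hφ.eventually (by simp)).and
    (hφe.and (hφC.and (tφ.eventually hpar))))
  obtain ⟨s₁, hs₁, h₁⟩ := exists_forall_Y₁ ((hψ.eventually (by simp)).and
    (hψe.and (hψD.and hpar)))
  obtain ⟨r₀, hr₀, hr₀s, hr₀1⟩ : ∃ r₀, 0 < r₀ ∧ r₀ ≤ s₀ ∧ r₀ < 1 :=
    ⟨min s₀ (1 / 2), by positivity, min_le_left _ _, (min_le_right _ _).trans_lt (by norm_num)⟩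
  obtain ⟨r₁, hr₁, hr₁s, hr₁1⟩ : ∃ r₁, 0 < r₁ ∧ r₁ ≤ s₁ ∧ r₁ < 1 :=
    ⟨min s₁ (1 / 2), by positivity, min_le_left _ _, (min_le_right _ _).trans_lt (by norm_num)⟩
  obtain ⟨σ₀, hσ₀, hm₀⟩ := exists_forall_Y₀
    (tφ.eventually ((isOpen_Y₁ r₁).mem_nhds (zero_mem_Y₁ hr₁)))
  obtain ⟨σ₁, hσ₁, hm₁⟩ := exists_forall_Y₁
    (tψ.eventually ((isOpen_Y₀ r₀).mem_nhds (zero_mem_Y₀ hr₀)))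
  -- The inverse identities already hold on the balls of radii `r₀` and `r₁`; `r₂` is smaller so
  -- that the images of the balls of radius `r₂` stay in `Y₁(r₁)` and `Y₀(r₀)`.
  obtain ⟨r₂, hr₂, h20, h21, h2s, h2s'⟩ : ∃ r₂, 0 < r₂ ∧ r₂ ≤ r₀ ∧ r₂ ≤ r₁ ∧ r₂ ≤ σ₀ ∧ r₂ ≤ σ₁ :=
    ⟨min (min r₀ r₁) (min σ₀ σ₁), by positivity, (min_le_left _ _).trans (min_le_left _ _),
      (min_le_left _ _).trans (min_le_right _ _), (min_le_right _ _).trans (min_le_left _ _),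
      (min_le_right _ _).trans (min_le_right _ _)⟩
  -- Conjugating by translations transports the solution at `(0, 0)` to every `(t, x₀)` without
  -- changing any norm.
  set Φ : ℝ → ℝ → W1 p × LL p → ℝ × ℝ × W1 p × LL p :=
    fun t x₀ u => shiftZ p (-(β₀ * t + x₀)) (φ (shiftU p (β₀ * t + x₀) u)) with hΦ
  set Ψ : ℝ → ℝ → ℝ × ℝ × W1 p × LL p → W1 p × LL p :=
    fun t x₀ z => shiftU p (-(β₀ * t + x₀)) (ψ (shiftZ p (β₀ * t + x₀) z)) with hΨ
  have g₀ : ∀ c, ∀ u ∈ Y₀ p r₀, _ := fun c u hu =>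
    h₀ (shiftU p c u) (Y₀_mono hr₀s (shiftU_mem_Y₀.2 hu))
  have g₁ : ∀ c, ∀ z ∈ Y₁ p r₁, _ := fun c z hz =>
    h₁ (shiftZ p c z) (Y₁_mono hr₁s (shiftZ_mem_Y₁.2 hz))
  have cΦ : ∀ t x₀, ContDiffOn ℝ 1 (Φ t x₀) (Y₀ p r₀) := fun t x₀ u hu =>
    ((shiftZ p _).contDiff.contDiffAt.comp u (ContDiffAt.comp (g := φ) u (g₀ _ u hu).1
      (shiftU p _).contDiff.contDiffAt)).contDiffWithinAt
  have cΨ : ∀ t x₀, ContDiffOn ℝ 1 (Ψ t x₀) (Y₁ p r₁) := fun t x₀ z hz =>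
    ((shiftU p _).contDiff.contDiffAt.comp z (ContDiffAt.comp (g := ψ) z (g₁ _ z hz).1
      (shiftZ p _).contDiff.contDiffAt)).contDiffWithinAt
  have lΦ : ∀ t x₀, ∀ u ∈ Y₀ p r₀, Ψ t x₀ (Φ t x₀ u) = u := by
    intro t x₀ u hu
    simp only [hΦ, hΨ]
    rw [shiftZ_shiftZ _ _ (neg_add_cancel _), (g₀ _ u hu).2.1.2,
      shiftU_shiftU _ _ (add_neg_cancel _)]
  have lΨ : ∀ t x₀, ∀ z ∈ Y₁ p r₁, Φ t x₀ (Ψ t x₀ z) = z := by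
    intro t x₀ z hz
    simp only [hΦ, hΨ]
    rw [shiftU_shiftU _ _ (neg_add_cancel _), (g₁ _ z hz).2.1.2,
      shiftZ_shiftZ _ _ (add_neg_cancel _)]
  -- The factors `4` and `2` are the costs of passing from the product norms to `norm₁` and `norm₀`.
  have hK := le_max_left (4 * C) (2 * D)
  have hK' := le_max_right (4 * C) (2 * D)
  refine ⟨r₀, r₁, r₂, max (4 * C) (2 * D), Φ, Ψ, ⟨hr₀, hr₀1⟩, ⟨hr₁, hr₁1⟩,
    ⟨hr₂, h20.trans_lt hr₀1⟩, cΦ, cΨ, ?_, ?_, ?_, ?_, h20, h21, ?_, ?_,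
    fun t x₀ u hu => lΦ t x₀ u (Y₀_mono h20 hu), fun t x₀ z hz => lΨ t x₀ z (Y₁_mono h21 hz), ?_⟩
  · intro t x₀ u hu
    have h := g₀ (β₀ * t + x₀) u hu
    rw [fEqZero_iff_functional hβ]
    refine ⟨h.2.2.2, ?_⟩
    simp only [hΦ]
    rw [shiftZ_shiftZ _ _ (neg_add_cancel _)]
    exact h.2.1.1
  · intro t x₀ z hz
    have h := g₁ (β₀ * t + x₀) z hz
    rw [fEqZero_iff_functional hβ]
    refine ⟨h.2.2.2, ?_⟩
    simp only [hΨ]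
    rw [shiftU_shiftU _ _ (neg_add_cancel _)]
    exact h.2.1.1
  · intro t x₀ u hu
    have h := (g₀ (β₀ * t + x₀) u hu).2.2.1
    simp only [hΦ, norm₁_shiftZ]
    set w := shiftU p (β₀ * t + x₀) u
    calc norm₁ (φ w) ≤ 4 * ‖φ w‖ := norm₁_le_norm _
      _ ≤ 4 * (C * norm₀ w) := by
        have := mul_le_mul_of_nonneg_left (norm_le_norm₀ w) hC.le
        linarith
      _ = 4 * C * norm₀ u := by rw [norm₀_shiftU, mul_assoc]
      _ ≤ _ := mul_le_mul_of_nonneg_right hK (norm₀_nonneg u)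
  · intro t x₀ z hz
    have h := (g₁ (β₀ * t + x₀) z hz).2.2.1
    simp only [hΨ, norm₀_shiftU]
    set w := shiftZ p (β₀ * t + x₀) z
    calc norm₀ (ψ w) ≤ 2 * ‖ψ w‖ := norm₀_le_norm _
      _ ≤ 2 * (D * norm₁ w) := by
        have := mul_le_mul_of_nonneg_left (norm_le_norm₁ w) hD.le
        linarith
      _ = 2 * D * norm₁ z := by rw [norm₁_shiftZ, mul_assoc]
      _ ≤ _ := mul_le_mul_of_nonneg_right hK' (norm₁_nonneg z)
  · intro t x₀ u hu
    exact shiftZ_mem_Y₁.2 (hm₀ _ (Y₀_mono h2s (shiftU_mem_Y₀.2 hu)))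
  · intro t x₀ z hz
    exact shiftU_mem_Y₀.2 (hm₁ _ (Y₁_mono h2s' (shiftZ_mem_Y₁.2 hz)))
  · intro t x₀
    obtain ⟨U, V, hU, hV, h0U, h0V, hUA, hVB, hbij, hinv⟩ := exists_bijOn_invOn (isOpen_Y₀ r₀)
      (isOpen_Y₁ r₁) (cΦ t x₀).continuousOn (cΨ t x₀).continuousOn (zero_mem_Y₀ hr₀)
      (zero_mem_Y₁ hr₁) (by simp only [hΦ, map_zero, hφ0]) (by simp only [hΨ, map_zero, hψ0])
      (lΦ t x₀) (lΨ t x₀)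
    exact ⟨U, V, hU, hV, h0U, h0V, hUA, hVB, hbij, hinv, (cΦ t x₀).mono hUA, (cΨ t x₀).mono hVB⟩

/-! ### Uniqueness of small solutions -/

theorem exists_norm_le_of_bijective {E F : Type*} [NormedAddCommGroup E] [NormedSpace ℝ E]
    [CompleteSpace E] [NormedAddCommGroup F] [NormedSpace ℝ F] [CompleteSpace F] (f : E →L[ℝ] F)
    (hf : Function.Bijective f) : ∃ K > 0, ∀ z, ‖z‖ ≤ K * ‖f z‖ := by
  set e := ContinuousLinearEquiv.ofBijective f (LinearMap.ker_eq_bot.2 hf.1)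
    (LinearMap.range_eq_top.2 hf.2)
  refine ⟨‖(e.symm : F →L[ℝ] E)‖ + 1, by positivity, fun z => ?_⟩
  have h := (e.symm : F →L[ℝ] E).le_opNorm (f z)
  have h2 : (e.symm : F →L[ℝ] E) (f z) = z := e.symm_apply_apply z
  rw [h2] at h
  have := norm_nonneg (f z)
  linarith

/-- Strict differentiability: near the origin the remainder is Lipschitz with a constant as small as
desired, so it can be absorbed by a linear part that is bounded below. -/
theorem exists_norm_sub_le {E F : Type*} [NormedAddCommGroup E] [NormedSpace ℝ E]
    [NormedAddCommGroup F] [NormedSpace ℝ F] {f : E → F} {f' : E →L[ℝ] F}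
    (hc : ContDiffAt ℝ 1 f 0) (hf : HasFDerivAt f f' 0) {η : ℝ} (hη : 0 < η) :
    ∃ ρ > 0, ∀ a b, ‖a‖ < ρ → ‖b‖ < ρ → ‖f a - f b - f' (a - b)‖ ≤ η * ‖a - b‖ := by
  have h := (hc.hasStrictFDerivAt' hf one_ne_zero).isLittleO.def hη
  obtain ⟨ρ, hρ, h⟩ := Metric.eventually_nhds_iff.1 h
  refine ⟨ρ, hρ, fun a b ha hb => h (y := (a, b)) ?_⟩
  rw [Prod.dist_eq]
  exact max_lt (by simpa using ha) (by simpa using hb)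

theorem eq_zero_of_le_half {a : ℝ} (h0 : 0 ≤ a) (h : a ≤ 1 / 2 * a) : a = 0 := by linarith

/-- The nonlinear terms on `L^∞`. -/
noncomputable abbrev nonlinTop (β₀ ε : ℝ) : ℝ × LL ∞ × LL ∞ → LL ∞ :=
  nonlin β₀ ε (ContinuousLinearMap.id ℝ (LL ∞))

/-- Derivative of the nonlinear terms on `L^∞`. -/
noncomputable abbrev nonlinTopDeriv (β₀ ε : ℝ) : ℝ × LL ∞ × LL ∞ →L[ℝ] LL ∞ :=
  nonlinDeriv β₀ ε (ContinuousLinearMap.id ℝ (LL ∞))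

theorem contDiffAt_nonlinTop {β₀ : ℝ} (hβ : β₀ ∈ Ioo (-1 : ℝ) 1) (ε : ℝ) :
    ContDiffAt ℝ 1 (nonlinTop β₀ ε) 0 ∧ HasFDerivAt (nonlinTop β₀ ε) (nonlinTopDeriv β₀ ε) 0 :=
  contDiffAt_nonlin hβ ε _ (ContinuousLinearMap.id ℝ (LL ∞)) fun _ => EventuallyEq.rfl

theorem nonlin_ae_eq_nonlinTop {p : ℝ≥0∞} [Fact (1 ≤ p)] {β₀ : ℝ} (hβ : β₀ ∈ Ioo (-1 : ℝ) 1)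
    (ε δ : ℝ) (v u : W1 p) :
    nonlin β₀ ε (W1.fnL p) (δ, v, u) =ᵐ[volume]
      nonlinTop β₀ ε (δ, W1.supL p v, W1.supL p u) := by
  filter_upwards [coeFn_nonlin hβ ε (W1.fnL p) (δ, v, u),
    coeFn_nonlin hβ ε (ContinuousLinearMap.id ℝ (LL ∞)) (δ, W1.supL p v, W1.supL p u),
    v.coeFn_supL, u.coeFn_supL] with x h1 h2 h3 h4
  rw [h1, h2]
  simp only [ContinuousLinearMap.id_apply, W1.fnL_apply, h3, h4]

/-- Two small solutions of the second equation with the same `u₀` and `u₁` agree. -/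
theorem exists_unique_left {β₀ : ℝ} (hβ : β₀ ∈ Ioo (-1 : ℝ) 1) :
    ∃ ρ > 0, ∀ (δ δ' : ℝ) (v v' U : LL ∞), ‖(δ, v, U)‖ < ρ → ‖(δ', v', U)‖ < ρ →
      HasWeakDeriv (v - v' : LL ∞)
        (nonlinTop β₀ (-1) (δ', v', U) - nonlinTop β₀ (-1) (δ, v, U) : LL ∞) →
      δ = δ' ∧ v = v' := by
  have hc := lorentz_pos hβ
  obtain ⟨K, hK, hKb⟩ := exists_norm_le_of_bijective (opT ∞ (lorentz β₀))
    ⟨opT_injective hc, opT_surjective hc⟩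
  -- With `η = 1/(2K)` the lower bound for `opT` yields that the difference is at most half of
  -- itself.
  obtain ⟨ρ, hρ, h⟩ := exists_norm_sub_le (contDiffAt_nonlinTop hβ (-1)).1
    (contDiffAt_nonlinTop hβ (-1)).2 (η := 1 / 2 / K) (by positivity)
  refine ⟨ρ, hρ, fun δ δ' v v' U hq hq' hw => ?_⟩
  set m := 1 + ((param β₀) ^ 2)⁻¹ with hm
  -- Since `m ≥ 1`, the norm of `m (δ - δ')` dominates that of `δ - δ'`.
  have hm1 : 1 ≤ m := by
    have : 0 < ((param β₀) ^ 2)⁻¹ := by have := param_pos hβ; positivity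
    linarith
  have h1 := h _ _ hq hq'
  -- The weak derivative of `v - v'` is a difference of bounded nonlinear terms, so the difference
  -- belongs to `W^{1,∞}`, where `opT` is bounded below.
  set w : W1 ∞ := W1.mk _ _ hw with hwd
  have hd : ((δ, v, U) - (δ', v', U) : ℝ × LL ∞ × LL ∞) = (δ - δ', v - v', 0) := by
    simp
  rw [hd] at h1
  have e : opT ∞ (lorentz β₀) (m * (δ - δ'), w)
      = -(nonlinTop β₀ (-1) (δ, v, U) - nonlinTop β₀ (-1) (δ', v', U)
        - nonlinTopDeriv β₀ (-1) (δ - δ', v - v', 0)) := by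
    rw [opT_apply, nonlinTopDeriv, nonlinDeriv_left hβ]
    simp only [hwd, W1.fn_mk, W1.dx_mk, ContinuousLinearMap.id_apply]
    abel
  have h2 := hKb (m * (δ - δ'), w)
  rw [e, norm_neg] at h2
  have h3 : ‖(δ - δ', v - v', (0 : LL ∞))‖ ≤ ‖(m * (δ - δ'), w)‖ := by
    refine max_le ?_ (max_le ?_ ?_)
    · refine le_trans ?_ (norm_fst_le (m * (δ - δ'), w))
      simp only [norm_mul]
      have : 1 ≤ ‖m‖ := hm1.trans (le_abs_self m)
      nlinarith [norm_nonneg (δ - δ')]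
    · have h4 := W1.norm_fn_le w
      rw [hwd, W1.fn_mk] at h4
      exact h4.trans (norm_snd_le (m * (δ - δ'), w))
    · simp
  have h5 : ‖(δ - δ', v - v', (0 : LL ∞))‖ = 0 := by
    refine eq_zero_of_le_half (norm_nonneg _) (h3.trans (h2.trans ?_))
    calc _ ≤ K * (1 / 2 / K * ‖(δ - δ', v - v', (0 : LL ∞))‖) :=
          mul_le_mul_of_nonneg_left h1 hK.le
      _ = _ := by field_simp
  rw [norm_eq_zero, Prod.mk_eq_zero, Prod.mk_eq_zero, sub_eq_zero, sub_eq_zero] at h5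
  exact ⟨h5.1, h5.2.1⟩

/-- The orthogonality condition determines `y`. -/
theorem exists_unique_orth {β₀ : ℝ} (hβ : β₀ ∈ Ioo (-1 : ℝ) 1) :
    ∃ ρ > 0, ∀ (δ y y' : ℝ) (U : LL ∞), ‖(δ, y, U)‖ < ρ → ‖(δ, y', U)‖ < ρ →
      orth β₀ (δ, y, U) = orth β₀ (δ, y', U) → y = y' := by
  have hk := fderiv_orth_middle hβ
  set k := fderiv ℝ (orth β₀) 0 (0, 1, 0) with hkd
  have hk0 : 0 < |k| := abs_pos.2 hk
  have hc := contDiffAt_orth hβ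
  obtain ⟨ρ, hρ, h⟩ := exists_norm_sub_le hc (hc.differentiableAt one_ne_zero).hasFDerivAt
    (η := |k| / 2) (by positivity)
  refine ⟨ρ, hρ, fun δ y y' U hq hq' e => ?_⟩
  have h1 := h _ _ hq hq'
  have hd : ((δ, y, U) - (δ, y', U) : ℝ × ℝ × LL ∞)
      = (y - y') • ((0 : ℝ), (1 : ℝ), (0 : LL ∞)) := by
    simp
  have hn : ‖((0 : ℝ), (1 : ℝ), (0 : LL ∞))‖ = 1 := by simp [Prod.norm_def]
  rw [e, sub_self, zero_sub, norm_neg, hd, map_smul, norm_smul, norm_smul, hn, ← hkd, mul_one,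
    Real.norm_eq_abs, Real.norm_eq_abs] at h1
  have h2 : |y - y'| * |k| = 0 :=
    eq_zero_of_le_half (by positivity) (h1.trans (le_of_eq (by ring)))
  exact sub_eq_zero.1 (abs_eq_zero.1 ((mul_eq_zero.1 h2).resolve_right hk0.ne'))

/-- Two small solutions of the first and third equations with the same `δ`, `y`, `v₀`, `v₁`
agree. -/
theorem exists_unique_right {β₀ : ℝ} (hβ : β₀ ∈ Ioo (-1 : ℝ) 1) :
    ∃ ρ > 0, ∀ (δ y : ℝ) (v U U' : LL ∞), ‖(δ, v, U)‖ < ρ → ‖(δ, v, U')‖ < ρ →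
      ‖(δ, y, U)‖ < ρ → ‖(δ, y, U')‖ < ρ → orth β₀ (δ, y, U) = orth β₀ (δ, y, U') →
      HasWeakDeriv (U - U' : LL ∞)
        (nonlinTop β₀ 1 (δ, v, U) - nonlinTop β₀ 1 (δ, v, U') : LL ∞) →
      U = U' := by
  have hc := lorentz_pos hβ
  obtain ⟨K, hK, hKb⟩ := exists_norm_le_of_bijective (opR ∞ (lorentz β₀))
    ⟨opR_injective hc, opR_surjective hc⟩
  have ho := contDiffAt_orth hβ
  obtain ⟨ρ₁, hρ₁, h⟩ := exists_norm_sub_le (contDiffAt_nonlinTop hβ 1).1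
    (contDiffAt_nonlinTop hβ 1).2 (η := 1 / 2 / K) (by positivity)
  obtain ⟨ρ₂, hρ₂, h'⟩ := exists_norm_sub_le ho (ho.differentiableAt one_ne_zero).hasFDerivAt
    (η := 1 / 2 / K) (by positivity)
  refine ⟨min ρ₁ ρ₂, lt_min hρ₁ hρ₂, fun δ y v U U' hq hq' hr hr' e hw => ?_⟩
  have h1 := h _ _ (hq.trans_le (min_le_left _ _)) (hq'.trans_le (min_le_left _ _))
  have h2 := h' _ _ (hr.trans_le (min_le_right _ _)) (hr'.trans_le (min_le_right _ _))
  set w : W1 ∞ := W1.mk _ _ hw with hwd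
  have hd : ((δ, v, U) - (δ, v, U') : ℝ × LL ∞ × LL ∞) = (0, 0, U - U') := by simp
  have hd' : ((δ, y, U) - (δ, y, U') : ℝ × ℝ × LL ∞) = (0, 0, U - U') := by simp
  have hn : ‖((0 : ℝ), (0 : LL ∞), U - U')‖ = ‖U - U'‖ := by simp [Prod.norm_def]
  have hn' : ‖((0 : ℝ), (0 : ℝ), U - U')‖ = ‖U - U'‖ := by simp [Prod.norm_def]
  have hs : W1.supL ∞ w = U - U' := by
    apply Lp.ext
    refine w.coeFn_supL.trans ?_
    rw [hwd, W1.fn_mk]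
  rw [hd, hn] at h1
  rw [hd', hn', e, sub_self, zero_sub, norm_neg, fderiv_orth_right hβ] at h2
  have e1 : (opR ∞ (lorentz β₀) w).1 = nonlinTop β₀ 1 (δ, v, U) - nonlinTop β₀ 1 (δ, v, U')
        - nonlinTopDeriv β₀ 1 (0, 0, U - U') := by
    rw [opR_apply, nonlinTopDeriv, nonlinDeriv_right hβ]
    simp only [hwd, W1.fn_mk, W1.dx_mk, ContinuousLinearMap.id_apply]
    abel
  have e2 : (opR ∞ (lorentz β₀) w).2 = LL.pairing (U - U') (sechLp 1 (lorentz β₀)) := by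
    rw [opR_apply, hs]
  have h3 : ‖opR ∞ (lorentz β₀) w‖ ≤ 1 / 2 / K * ‖U - U'‖ := by
    refine max_le ?_ ?_
    · rw [e1]
      exact h1
    · rw [e2]
      exact h2
  have h4 := W1.norm_fn_le w
  rw [hwd, W1.fn_mk] at h4
  have h5 : ‖U - U'‖ = 0 := by
    refine eq_zero_of_le_half (norm_nonneg _) (h4.trans ((hKb w).trans ?_))
    calc _ ≤ K * (1 / 2 / K * ‖U - U'‖) := mul_le_mul_of_nonneg_left h3 hK.le
      _ = _ := by field_simp
  exact sub_eq_zero.1 (norm_eq_zero.1 h5)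

/-! ### Comparison of solutions for two exponents. -/

section TwoExponents

variable {p q : ℝ≥0∞} [Fact (1 ≤ p)] [Fact (1 ≤ q)]

theorem W1.dx_ae_eq {u : W1 p} {w : W1 q} (h : u.fn =ᵐ[volume] w.fn) :
    u.dx =ᵐ[volume] w.dx := by
  refine ae_eq_of_integral_contDiff_smul_eq u.dx.locallyIntegrable w.dx.locallyIntegrable ?_
  intro φ hφ hc
  have h1 := u.hasWeakDeriv.congr h EventuallyEq.rfl φ hφ hc
  have h2 := w.hasWeakDeriv φ hφ hc
  rw [h2] at h1
  simpa [mul_comm] using (neg_injective h1).symm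

theorem W1.supL_eq_iff {u : W1 p} {w : W1 q} :
    W1.supL p u = W1.supL q w ↔ u.fn =ᵐ[volume] w.fn := by
  constructor
  · intro h
    have := u.coeFn_supL
    rw [h] at this
    exact this.symm.trans w.coeFn_supL
  · intro h
    exact Lp.ext (u.coeFn_supL.trans (h.trans w.coeFn_supL.symm))

theorem SamePair.shift {u : W1 p × LL p} {w : W1 q × LL q} (h : SamePair u w) (c : ℝ) :
    SamePair (shiftU p c u) (shiftU q c w) := by
  constructor
  · filter_upwards [LL.coeFn_shift c u.1.fn, LL.coeFn_shift c w.1.fn, ae_comp_add h.1 c]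
      with x h1 h2 h3
    simp only [shiftU_apply, W1.fn_shift]
    rw [h1, h2, h3]
  · filter_upwards [LL.coeFn_shift c u.2, LL.coeFn_shift c w.2, ae_comp_add h.2 c]
      with x h1 h2 h3
    simp only [shiftU_apply]
    rw [h1, h2, h3]

theorem SamePair.of_shift {u : W1 p × LL p} {w : W1 q × LL q} {c : ℝ}
    (h : SamePair (shiftU p c u) (shiftU q c w)) : SamePair u w := by
  have := h.shift (-c)
  rwa [shiftU_shiftU _ _ (add_neg_cancel c), shiftU_shiftU _ _ (add_neg_cancel c)] at this

theorem ae_of_functional_eq_zero {β₀ : ℝ} (hβ : β₀ ∈ Ioo (-1 : ℝ) 1) {z : ℝ × ℝ × W1 p × LL p}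
    {u : W1 p × LL p} (h : functional β₀ (z, u) = 0) :
    (∀ᵐ x, u.1.dx x - z.2.2.2 x
        = nonlinTop β₀ 1 (z.1, W1.supL p z.2.2.1, W1.supL p u.1) x) ∧
      (∀ᵐ x, u.2 x - z.2.2.1.dx x
        = nonlinTop β₀ (-1) (z.1, W1.supL p z.2.2.1, W1.supL p u.1) x) ∧
      orth β₀ (z.1, z.2.1, W1.supL p u.1) = 0 := by
  simp only [functional, Prod.mk_eq_zero, sub_eq_zero] at h
  obtain ⟨h1, h2, h3⟩ := h
  have e1 : u.1.dx - z.2.2.2 = nonlin β₀ 1 (W1.fnL p) (z.1, z.2.2.1, u.1) := h1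
  have e2 : u.2 - z.2.2.1.dx = nonlin β₀ (-1) (W1.fnL p) (z.1, z.2.2.1, u.1) := h2
  refine ⟨?_, ?_, h3⟩
  · filter_upwards [Lp.coeFn_sub u.1.dx z.2.2.2, nonlin_ae_eq_nonlinTop hβ 1 z.1 z.2.2.1 u.1]
      with x h4 h5
    rw [← h5, ← e1, h4, Pi.sub_apply]
  · filter_upwards [Lp.coeFn_sub u.2 z.2.2.1.dx, nonlin_ae_eq_nonlinTop hβ (-1) z.1 z.2.2.1 u.1]
      with x h4 h5
    rw [← h5, ← e2, h4, Pi.sub_apply]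

theorem norm_triple_lt {E F : Type*} [NormedAddCommGroup E] [NormedAddCommGroup F] {a : ℝ}
    {x : E} {y : F} {ρ : ℝ} (ha : |a| < ρ) (hx : ‖x‖ < ρ) (hy : ‖y‖ < ρ) : ‖(a, x, y)‖ < ρ :=
  max_lt ha (max_lt hx hy)

/-- Subtracting the second equations cancels the common `u₁` and leaves a relation among bounded
functions, in which the exponents no longer appear. It determines `δ` and `v₀`; the orthogonality
condition then gives `y`, and `v₁` is read off from the first equation. -/
theorem exists_samePair_left {β₀ : ℝ} (hβ : β₀ ∈ Ioo (-1 : ℝ) 1) (p q : ℝ≥0∞) [Fact (1 ≤ p)]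
    [Fact (1 ≤ q)] :
    ∃ ρ > 0, ∀ (z : ℝ × ℝ × W1 p × LL p) (u : W1 p × LL p) (z' : ℝ × ℝ × W1 q × LL q)
      (u' : W1 q × LL q), functional β₀ (z, u) = 0 → functional β₀ (z', u') = 0 →
      SamePair u u' → norm₀ u < ρ → norm₁ z < ρ → norm₁ z' < ρ →
      z.1 = z'.1 ∧ z.2.1 = z'.2.1 ∧ SamePair z.2.2 z'.2.2 := by
  obtain ⟨ρ₁, hρ₁, H₁⟩ := exists_unique_left hβ
  obtain ⟨ρ₂, hρ₂, H₂⟩ := exists_unique_orth hβ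
  refine ⟨min ρ₁ ρ₂, lt_min hρ₁ hρ₂, ?_⟩
  rintro ⟨δ, y, v, v₁⟩ ⟨u, u₁⟩ ⟨δ', y', v', v₁'⟩ ⟨u', u₁'⟩ h h' hs hu hz hz'
  obtain ⟨a1, a2, a3⟩ := ae_of_functional_eq_zero hβ h
  obtain ⟨b1, b2, b3⟩ := ae_of_functional_eq_zero hβ h'
  have hU : W1.supL p u = W1.supL q u' := W1.supL_eq_iff.2 hs.1
  simp only at a1 a2 a3 b1 b2 b3
  rw [← hU] at b1 b2 b3
  rw [norm₀] at hu
  rw [norm₁] at hz hz'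
  simp only at hu hz hz'
  have n1 := W1.norm_supL_le u
  have n2 := W1.norm_supL_le v
  have n3 := W1.norm_supL_le v'
  have p1 := norm_nonneg u₁
  have p2 := norm_nonneg v₁
  have p3 := norm_nonneg v₁'
  have p4 := norm_nonneg v
  have p5 := norm_nonneg v'
  have p6 := abs_nonneg δ
  have p7 := abs_nonneg δ'
  have p8 := abs_nonneg y
  have p9 := abs_nonneg y'
  obtain ⟨hu1, hu2⟩ := lt_min_iff.1 hu
  obtain ⟨hz1, hz2⟩ := lt_min_iff.1 hz
  obtain ⟨hz1', hz2'⟩ := lt_min_iff.1 hz'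
  have hw : HasWeakDeriv (W1.supL p v - W1.supL q v' : LL ∞)
      (nonlinTop β₀ (-1) (δ', W1.supL q v', W1.supL p u)
        - nonlinTop β₀ (-1) (δ, W1.supL p v, W1.supL p u) : LL ∞) := by
    refine (v.hasWeakDeriv.sub v'.hasWeakDeriv v.fn.locallyIntegrable v.dx.locallyIntegrable
      v'.fn.locallyIntegrable v'.dx.locallyIntegrable).congr ?_ ?_
    · filter_upwards [Lp.coeFn_sub (W1.supL p v) (W1.supL q v'), v.coeFn_supL, v'.coeFn_supL]
        with x h1 h2 h3
      rw [h1, Pi.sub_apply, h2, h3]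
    · filter_upwards [Lp.coeFn_sub (nonlinTop β₀ (-1) (δ', W1.supL q v', W1.supL p u))
        (nonlinTop β₀ (-1) (δ, W1.supL p v, W1.supL p u)), a2, b2, hs.2] with x h1 h2 h3 h4
      rw [h1, Pi.sub_apply, ← h2, ← h3, h4]
      ring
  obtain ⟨rfl, hv⟩ := H₁ δ δ' (W1.supL p v) (W1.supL q v') (W1.supL p u)
    (norm_triple_lt (by linarith) (by linarith) (by linarith))
    (norm_triple_lt (by linarith) (by linarith) (by linarith)) hw
  refine ⟨rfl, H₂ δ y y' (W1.supL p u) (norm_triple_lt (by linarith)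
    (by rw [Real.norm_eq_abs]; linarith) (by linarith)) (norm_triple_lt (by linarith)
    (by rw [Real.norm_eq_abs]; linarith) (by linarith)) (a3.trans b3.symm),
    W1.supL_eq_iff.1 hv, ?_⟩
  rw [← hv] at b1
  filter_upwards [a1, b1, W1.dx_ae_eq hs.1] with x h1 h2 h3
  linarith

/-- Here the common `v₁` cancels from the first equations. Together with the orthogonality condition
they determine `u₀`, and the second equation then gives `u₁`. -/
theorem exists_samePair_right {β₀ : ℝ} (hβ : β₀ ∈ Ioo (-1 : ℝ) 1) (p q : ℝ≥0∞) [Fact (1 ≤ p)]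
    [Fact (1 ≤ q)] :
    ∃ ρ > 0, ∀ (δ y : ℝ) (v u : W1 p × LL p) (v' u' : W1 q × LL q),
      functional β₀ ((δ, y, v), u) = 0 → functional β₀ ((δ, y, v'), u') = 0 →
      SamePair v v' → norm₁ (δ, y, v) < ρ → norm₀ u < ρ → norm₀ u' < ρ → SamePair u u' := by
  obtain ⟨ρ, hρ, H⟩ := exists_unique_right hβ
  refine ⟨ρ, hρ, ?_⟩
  rintro δ y ⟨v, v₁⟩ ⟨u, u₁⟩ ⟨v', v₁'⟩ ⟨u', u₁'⟩ h h' hs hz hu hu'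
  obtain ⟨a1, a2, a3⟩ := ae_of_functional_eq_zero hβ h
  obtain ⟨b1, b2, b3⟩ := ae_of_functional_eq_zero hβ h'
  have hV : W1.supL p v = W1.supL q v' := W1.supL_eq_iff.2 hs.1
  simp only at a1 a2 a3 b1 b2 b3
  rw [← hV] at b1 b2
  rw [norm₀] at hu hu'
  rw [norm₁] at hz
  simp only at hu hu' hz
  have n1 := W1.norm_supL_le u
  have n2 := W1.norm_supL_le u'
  have n3 := W1.norm_supL_le v
  have p1 := norm_nonneg u₁
  have p2 := norm_nonneg u₁'
  have p3 := norm_nonneg v₁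
  have p4 := norm_nonneg v
  have p6 := abs_nonneg δ
  have p8 := abs_nonneg y
  have hw : HasWeakDeriv (W1.supL p u - W1.supL q u' : LL ∞)
      (nonlinTop β₀ 1 (δ, W1.supL p v, W1.supL p u)
        - nonlinTop β₀ 1 (δ, W1.supL p v, W1.supL q u') : LL ∞) := by
    refine (u.hasWeakDeriv.sub u'.hasWeakDeriv u.fn.locallyIntegrable u.dx.locallyIntegrable
      u'.fn.locallyIntegrable u'.dx.locallyIntegrable).congr ?_ ?_
    · filter_upwards [Lp.coeFn_sub (W1.supL p u) (W1.supL q u'), u.coeFn_supL, u'.coeFn_supL]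
        with x h1 h2 h3
      rw [h1, Pi.sub_apply, h2, h3]
    · filter_upwards [Lp.coeFn_sub (nonlinTop β₀ 1 (δ, W1.supL p v, W1.supL p u))
        (nonlinTop β₀ 1 (δ, W1.supL p v, W1.supL q u')), a1, b1, hs.2] with x h1 h2 h3 h4
      rw [h1, Pi.sub_apply, ← h2, ← h3, h4]
      ring
  have hU := H δ y (W1.supL p v) (W1.supL p u) (W1.supL q u')
    (norm_triple_lt (by linarith) (by linarith) (by linarith))
    (norm_triple_lt (by linarith) (by linarith) (by linarith))
    (norm_triple_lt (by linarith) (by rw [Real.norm_eq_abs]; linarith) (by linarith))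
    (norm_triple_lt (by linarith) (by rw [Real.norm_eq_abs]; linarith) (by linarith))
    (a3.trans b3.symm) hw
  refine ⟨W1.supL_eq_iff.1 hU, ?_⟩
  rw [← hU] at b2
  filter_upwards [a2, b2, W1.dx_ae_eq hs.1] with x h1 h2 h3
  linarith

theorem exists_radius_samePair {β₀ : ℝ} (hβ : β₀ ∈ Ioo (-1 : ℝ) 1)
    {r₀ r₁ r₂ C r₀' r₁' r₂' C' : ℝ} {Φp : ℝ → ℝ → W1 p × LL p → ℝ × ℝ × W1 p × LL p}
    {Ψp : ℝ → ℝ → ℝ × ℝ × W1 p × LL p → W1 p × LL p}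
    {Φq : ℝ → ℝ → W1 q × LL q → ℝ × ℝ × W1 q × LL q}
    {Ψq : ℝ → ℝ → ℝ × ℝ × W1 q × LL q → W1 q × LL q}
    (hp : IsBacklundPair β₀ r₀ r₁ r₂ C Φp Ψp) (hq : IsBacklundPair β₀ r₀' r₁' r₂' C' Φq Ψq) :
    ∃ r ∈ Ioo (0 : ℝ) 1, r ≤ r₀ ∧ r ≤ r₁ ∧ r ≤ r₀' ∧ r ≤ r₁' ∧ ∀ t x₀ : ℝ,
      (∀ (u : W1 p × LL p) (w : W1 q × LL q), SamePair u w → norm₀ u + norm₀ w < r →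
        (Φp t x₀ u).1 = (Φq t x₀ w).1 ∧ (Φp t x₀ u).2.1 = (Φq t x₀ w).2.1 ∧
          SamePair (Φp t x₀ u).2.2 (Φq t x₀ w).2.2) ∧
      (∀ (δ y : ℝ) (v : W1 p × LL p) (w : W1 q × LL q), SamePair v w →
        |δ| + |y| + norm₀ v + norm₀ w < r →
        SamePair (Ψp t x₀ (δ, y, v)) (Ψq t x₀ (δ, y, w))) := by
  obtain ⟨ρ, hρ, H⟩ := exists_samePair_left hβ p q
  obtain ⟨ρ', hρ', H'⟩ := exists_samePair_right hβ p q
  -- The entry `1` controls the data, and `C`, `C'` control the images; `r ≤ ρ / M` thus makes all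
  -- of them smaller than the uniqueness radius.
  set M := max 1 (max C C') with hM
  have hM1 : 1 ≤ M := le_max_left _ _
  have hMC : C ≤ M := (le_max_left _ _).trans (le_max_right _ _)
  have hMC' : C' ≤ M := (le_max_right _ _).trans (le_max_right _ _)
  have hM0 : 0 < M := by linarith
  obtain ⟨r, hr, e₀, e₁, e₀', e₁', e, e'⟩ : ∃ r > 0, r ≤ r₀ ∧ r ≤ r₁ ∧ r ≤ r₀' ∧ r ≤ r₁' ∧
      r ≤ ρ / M ∧ r ≤ ρ' / M := by
    have := hp.r₀_mem.1
    have := hp.r₁_mem.1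
    have := hq.r₀_mem.1
    have := hq.r₁_mem.1
    refine ⟨min (min r₀ r₁) (min (min r₀' r₁') (min (ρ / M) (ρ' / M))), by positivity, ?_⟩
    simp
  have small : ∀ {a D σ : ℝ}, 0 ≤ a → a < r → r ≤ σ / M → D ≤ M → D * a < σ := by
    intro a D σ h0 ha hσ hD
    calc D * a ≤ M * a := mul_le_mul_of_nonneg_right hD h0
      _ < M * (σ / M) := mul_lt_mul_of_pos_left (ha.trans_le hσ) hM0
      _ = σ := mul_div_cancel₀ _ hM0.ne'
  refine ⟨r, ⟨hr, e₀.trans_lt hp.r₀_mem.2⟩, e₀, e₁, e₀', e₁', fun t x₀ => ⟨?_, ?_⟩⟩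
  · intro u w hs hn
    have hu0 := norm₀_nonneg u
    have hw0 := norm₀_nonneg w
    have hu : norm₀ u < r := by linarith
    have hw : norm₀ w < r := by linarith
    have hup : u ∈ Y₀ p r₀ := hu.trans_le e₀
    have hwq : w ∈ Y₀ q r₀' := hw.trans_le e₀'
    have f1 := ((fEqZero_iff_functional hβ t x₀ _ _).1 (hp.eq_Φ t x₀ u hup)).2
    have f2 := ((fEqZero_iff_functional hβ t x₀ _ _).1 (hq.eq_Φ t x₀ w hwq)).2
    have := H _ _ _ _ f1 f2 (hs.shift _)
      (by rw [norm₀_shiftU]; simpa using small hu0 hu e hM1)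
      (by rw [norm₁_shiftZ]; exact (hp.bound_Φ t x₀ u hup).trans_lt (small hu0 hu e hMC))
      (by rw [norm₁_shiftZ]; exact (hq.bound_Φ t x₀ w hwq).trans_lt (small hw0 hw e hMC'))
    exact ⟨this.1, this.2.1, SamePair.of_shift this.2.2⟩
  · intro δ y v w hs hn
    have hv0 := norm₀_nonneg v
    have hw0 := norm₀_nonneg w
    have ev := norm₁_eq (δ, y, v)
    have ew := norm₁_eq (δ, y, w)
    simp only at ev ew
    have hv : norm₁ (δ, y, v) < r := by linarith
    have hw : norm₁ (δ, y, w) < r := by linarith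
    have hvp : (δ, y, v) ∈ Y₁ p r₁ := hv.trans_le e₁
    have hwq : (δ, y, w) ∈ Y₁ q r₁' := hw.trans_le e₁'
    have f1 := ((fEqZero_iff_functional hβ t x₀ _ _).1 (hp.eq_Ψ t x₀ _ hvp)).2
    have f2 := ((fEqZero_iff_functional hβ t x₀ _ _).1 (hq.eq_Ψ t x₀ _ hwq)).2
    refine SamePair.of_shift (c := β₀ * t + x₀) (H' δ y _ _ _ _ f1 f2 (hs.shift _) ?_ ?_ ?_)
    · have : norm₁ (shiftZ p (β₀ * t + x₀) (δ, y, v)) < ρ' := by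
        rw [norm₁_shiftZ]
        simpa using small (norm₁_nonneg _) hv e' hM1
      exact this
    · rw [norm₀_shiftU]
      exact (hp.bound_Ψ t x₀ _ hvp).trans_lt (small (norm₁_nonneg _) hv e' hMC)
    · rw [norm₀_shiftU]
      exact (hq.bound_Ψ t x₀ _ hwq).trans_lt (small (norm₁_nonneg _) hw e' hMC')

end TwoExponents

end SineGordon

theorem mainTheorem3 (β₀ : ℝ) (hβ₀ : β₀ ∈ Set.Ioo (-1 : ℝ) 1) :
    (∀ (p : ℝ≥0∞) [Fact (1 ≤ p)], ∃ (r₀ r₁ r₂ C : ℝ)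
      (Φ : ℝ → ℝ → SineGordon.W1 p × SineGordon.LL p →
        ℝ × ℝ × SineGordon.W1 p × SineGordon.LL p)
      (Ψ : ℝ → ℝ → ℝ × ℝ × SineGordon.W1 p × SineGordon.LL p →
        SineGordon.W1 p × SineGordon.LL p),
      SineGordon.IsBacklundPair β₀ r₀ r₁ r₂ C Φ Ψ) ∧
    (∀ (p q : ℝ≥0∞) [Fact (1 ≤ p)] [Fact (1 ≤ q)], 1 < p → p ≤ q →
      ∀ (r₀ r₁ r₂ C r₀' r₁' r₂' C' : ℝ)
        (Φp : ℝ → ℝ → SineGordon.W1 p × SineGordon.LL p →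
          ℝ × ℝ × SineGordon.W1 p × SineGordon.LL p)
        (Ψp : ℝ → ℝ → ℝ × ℝ × SineGordon.W1 p × SineGordon.LL p →
          SineGordon.W1 p × SineGordon.LL p)
        (Φq : ℝ → ℝ → SineGordon.W1 q × SineGordon.LL q →
          ℝ × ℝ × SineGordon.W1 q × SineGordon.LL q)
        (Ψq : ℝ → ℝ → ℝ × ℝ × SineGordon.W1 q × SineGordon.LL q →
          SineGordon.W1 q × SineGordon.LL q),
        SineGordon.IsBacklundPair β₀ r₀ r₁ r₂ C Φp Ψp →
        SineGordon.IsBacklundPair β₀ r₀' r₁' r₂' C' Φq Ψq →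
        ∃ r ∈ Set.Ioo (0 : ℝ) 1, r ≤ r₀ ∧ r ≤ r₁ ∧ r ≤ r₀' ∧ r ≤ r₁' ∧ ∀ t x₀ : ℝ,
          (∀ (u : SineGordon.W1 p × SineGordon.LL p) (w : SineGordon.W1 q × SineGordon.LL q),
            SineGordon.SamePair u w →
            SineGordon.norm₀ u + SineGordon.norm₀ w < r →
            (Φp t x₀ u).1 = (Φq t x₀ w).1 ∧ (Φp t x₀ u).2.1 = (Φq t x₀ w).2.1 ∧
              SineGordon.SamePair (Φp t x₀ u).2.2 (Φq t x₀ w).2.2) ∧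
          (∀ (δ y : ℝ) (v : SineGordon.W1 p × SineGordon.LL p)
            (w : SineGordon.W1 q × SineGordon.LL q),
            SineGordon.SamePair v w →
            |δ| + |y| + SineGordon.norm₀ v + SineGordon.norm₀ w < r →
            SineGordon.SamePair (Ψp t x₀ (δ, y, v)) (Ψq t x₀ (δ, y, w)))) := by
  refine ⟨fun p _ => SineGordon.exists_isBacklundPair hβ₀ p, ?_⟩
  intro p q _ _ _ _ r₀ r₁ r₂ C r₀' r₁' r₂' C' Φp Ψp Φq Ψq hp hq
  exact SineGordon.exists_radius_samePair hβ₀ hp hq
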